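/- **Setting.** Let $g,m,l>0$ and $\omega\in\mathbb R$; put $I_-=(-m,0)$, $I_+=(0,l)$ and $\Omega_\pm=\mathbb R^2\times I_\pm$. Let $p_+,p_-\in C^\infty(0,\infty)$ be non-negative and strictly increasing, with $1/p_\pm'$ locally bounded on $(0,\infty)$. Let $\rho_0$ be a Rayleigh–Taylor steady state: a function of $x_3$ that is smooth on $I_-$ and on $I_+$, continuous up to the end points from each side (with traces $\rho_0^\pm$ at $x_3=0$), bounded above and below by positive constants, with $$\frac{d}{dx_3}\,p_\pm(\rho_0)=-g\rho_0\ \text{ in } I_\pm,\qquad p_+(\rho_0^+)=p_-(\rho_0^-),\qquad \rho_0^+-\rho_0^->0 .$$ Write $p=p_\pm$ in $\Omega_\pm$, and $\llbracket f\rrbracket=f_+|_{x_3=0}-f_-|_{x_3=0}$. The linearized problem for real-valued $\eta,v$ (with values in $\mathbb R^3$) and $q$ (scalar) is $$\partial_t\eta=v,\qquad \partial_t q+\rho_0\,\mathrm{div}\,v=0,$$ $$\rho_0\partial_t v+\nabla(p'(\rho_0)q)=-gq\,e_3-g\rho_0\nabla\eta_3+2\rho_0\omega v_2e_1-2\rho_0\omega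 v_1e_2$$ for $t>0$ in $\Omega_+$ and $\Omega_-$, with the jump and boundary conditions, for $t\ge 0$, $$\llbracket v_3\rrbracket=0,\qquad \llbracket p'(\rho_0)q\rrbracket=0,\qquad v_{-,3}|_{x_3=-m}=v_{+,3}|_{x_3=l}=0 .$$ A solution is a classical one: in each layer it is $C^1$ on $[0,\infty)\times\overline{\Omega_\pm}$ and satisfies all of this pointwise. For $f$ on $\Omega_+\cup\Omega_-$ with restrictions $f_\pm\in L^2(\Omega_\pm)$ let $\hat f_\pm(\xi,x_3)=\int_{\mathbb R^2}f_\pm(x',x_3)e^{-ix'\cdot\xi}\,dx'$ be the horizontal Fourier transform, and for $k\in\mathbb N=\{0,1,2,\dots\}$ let $$\|f\|_{H^k}^2=\sum_{\pm}\sum_{i=0}^k\int_{\mathbb R^2\times I_\pm}(1+|\xi|^2)^{k-i}\,|\partial_{x_3}^i\hat f_\pm(\xi,x_3)|^2\,d\xi\,dx_3$$ with weak derivatives in $\Omega_\pm$ (none across $x_3=0$ is required); $H^k$ is the space where this is finite. For vector fields the squares of the norms of the components are added. **Theorem.** The linearized problem is ill-posed in the sense of Hadamard in the piecewise Sobolev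 space $H^k$ for every $k$. More precisely, for all $k,j\in\mathbb N$ with $j\ge k$ and all $T_0>0$, $\alpha>0$ there is a sequence $\{(\eta_n,v_n,q_n)\}_{n\ge1}$ of solutions of the linearized equations with the jump and boundary conditions, with $\eta_n(t),v_n(t),q_n(t)\in H^j$ for all $t\ge0$, such that for every $n\ge 1$ $$\|\eta_n(0)\|_{H^j}+\|v_n(0)\|_{H^j}+\|q_n(0)\|_{H^j}\le\frac1n ,$$ but $$\|v_n(t)\|_{H^k}\ge\|\eta_n(t)\|_{H^k}\ge\alpha\qquad\text{for all } t\ge T_0 .$$ -/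

import Mathlib

open MeasureTheory Set
open scoped ENNReal FourierTransform ContDiff

noncomputable section

namespace RotatingRT

/-- The two fluid layers: the lower one is `ℝ² × (-m, 0)`, the upper one `ℝ² × (0, l)`. -/
inductive Layer
  | lower
  | upper
  deriving DecidableEq

instance : Fintype Layer := ⟨{Layer.lower, Layer.upper}, fun s => by cases s <;> simp⟩

/-- The height of the bottom of a layer. -/
def Layer.bot (m : ℝ) : Layer → ℝ
  | .lower => -m
  | .upper => 0

/-- The height of the top of a layer. -/
def Layer.top (l : ℝ) : Layer → ℝ
  | .lower => 0
  | .upper => l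

/-- The open vertical interval of a layer. -/
def Layer.interval (m l : ℝ) (s : Layer) : Set ℝ := Ioo (s.bot m) (s.top l)

/-- The closed vertical interval of a layer. -/
def Layer.closedInterval (m l : ℝ) (s : Layer) : Set ℝ := Icc (s.bot m) (s.top l)

/-- The horizontal plane `ℝ²`. -/
abbrev Plane := EuclideanSpace ℝ (Fin 2)

/-- Points `x = (x', x₃)` of `ℝ³`, split in the horizontal and the vertical part. -/
abbrev Pt := Plane × ℝ

/-! ### Pressure laws and the Rayleigh-Taylor steady state -/

/-- A barotropic pressure law on `(0, ∞)`: smooth, non-negative, strictly increasing, with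
`1 / p'` locally bounded. -/
structure IsPressureLaw (p : ℝ → ℝ) : Prop where
  smooth : ContDiffOn ℝ ∞ p (Ioi 0)
  nonneg : ∀ z, 0 < z → 0 ≤ p z
  strictMono : StrictMonoOn p (Ioi 0)
  inv_deriv_locally_bounded :
    ∀ a b : ℝ, 0 < a → a ≤ b → ∃ C : ℝ, ∀ z ∈ Icc a b, 1 ≤ C * deriv p z

/-- `ρ₀` is a steady density profile with the denser fluid above the interface `x₃ = 0`. The value
of `ρ₀ s` at an end point of its interval is its trace there. -/
structure IsSteadyState (g m l : ℝ) (p ρ₀ : Layer → ℝ → ℝ) : Prop where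
  continuousOn : ∀ s, ContinuousOn (ρ₀ s) (s.closedInterval m l)
  smooth : ∀ s, ContDiffOn ℝ ∞ (ρ₀ s) (s.interval m l)
  bounds : ∃ c C : ℝ, 0 < c ∧ ∀ s, ∀ y ∈ s.closedInterval m l, c ≤ ρ₀ s y ∧ ρ₀ s y ≤ C
  hydrostatic : ∀ s, ∀ y ∈ s.interval m l,
    deriv (fun z => p s (ρ₀ s z)) y = -g * ρ₀ s y
  pressure_jump : p .upper (ρ₀ .upper 0) = p .lower (ρ₀ .lower 0)
  density_jump : 0 < ρ₀ .upper 0 - ρ₀ .lower 0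

/-! ### The linearized problem -/

/-- The unit vector in the direction of the `i`-th coordinate of the domain. -/
def dir : Fin 3 → Pt :=
  ![(EuclideanSpace.single 0 1, 0), (EuclideanSpace.single 1 1, 0), (0, 1)]

/-- The partial derivative `∂ᵢ f`. -/
def pd (i : Fin 3) (f : Pt → ℝ) (x : Pt) : ℝ := fderiv ℝ f x (dir i)

/-- The gradient. -/
def grad (f : Pt → ℝ) (x : Pt) : Fin 3 → ℝ := fun i => pd i f x

/-- The divergence. -/
def divergence (u : Pt → Fin 3 → ℝ) (x : Pt) : ℝ := ∑ i, pd i (fun y => u y i) x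

/-- The standard basis vector of the target `ℝ³`. -/
def e (i : Fin 3) : Fin 3 → ℝ := Pi.single i 1

/-- Real-valued linear unknowns `(η, v, q)` on the two layers, as functions of time and place. -/
structure Unknowns where
  η : Layer → ℝ → Pt → Fin 3 → ℝ
  v : Layer → ℝ → Pt → Fin 3 → ℝ
  q : Layer → ℝ → Pt → ℝ

/-- Classical solutions, on the time interval `[0, ∞)`, of the linearized equations with the jump
and boundary conditions. The unknowns are `C¹` up to the boundary of each layer, and their traces
are their boundary values. In the indices, `0, 1, 2 : Fin 3` are the coordinates `1, 2, 3`; `Ω` is the angular velocity. -/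
structure IsSolution (g Ω m l : ℝ) (p ρ₀ : Layer → ℝ → ℝ) (U : Unknowns) : Prop where
  regular_η : ∀ s, ContDiffOn ℝ 1 (fun z : ℝ × Pt => U.η s z.1 z.2)
    (Ici 0 ×ˢ (univ ×ˢ s.closedInterval m l))
  regular_v : ∀ s, ContDiffOn ℝ 1 (fun z : ℝ × Pt => U.v s z.1 z.2)
    (Ici 0 ×ˢ (univ ×ˢ s.closedInterval m l))
  regular_q : ∀ s, ContDiffOn ℝ 1 (fun z : ℝ × Pt => U.q s z.1 z.2)
    (Ici 0 ×ˢ (univ ×ˢ s.closedInterval m l))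
  flow : ∀ s, ∀ t : ℝ, 0 < t → ∀ x : Pt, x.2 ∈ s.interval m l →
    deriv (fun τ => U.η s τ x) t = U.v s t x
  continuity : ∀ s, ∀ t : ℝ, 0 < t → ∀ x : Pt, x.2 ∈ s.interval m l →
    deriv (fun τ => U.q s τ x) t + ρ₀ s x.2 * divergence (U.v s t) x = 0
  momentum : ∀ s, ∀ t : ℝ, 0 < t → ∀ x : Pt, x.2 ∈ s.interval m l →
    ρ₀ s x.2 • deriv (fun τ => U.v s τ x) t
        + grad (fun y => deriv (p s) (ρ₀ s y.2) * U.q s t y) x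
      = -(g * U.q s t x) • e 2
        - (g * ρ₀ s x.2) • grad (fun y => U.η s t y 2) x
        + (2 * ρ₀ s x.2 * Ω * U.v s t x 1) • e 0
        - (2 * ρ₀ s x.2 * Ω * U.v s t x 0) • e 1
  velocity_jump : ∀ t : ℝ, 0 ≤ t → ∀ x' : Plane,
    U.v .upper t (x', 0) 2 - U.v .lower t (x', 0) 2 = 0
  pressure_jump : ∀ t : ℝ, 0 ≤ t → ∀ x' : Plane,
    deriv (p .upper) (ρ₀ .upper 0) * U.q .upper t (x', 0)
      - deriv (p .lower) (ρ₀ .lower 0) * U.q .lower t (x', 0) = 0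
  bottom : ∀ t : ℝ, 0 ≤ t → ∀ x' : Plane, U.v .lower t (x', -m) 2 = 0
  lid : ∀ t : ℝ, 0 ≤ t → ∀ x' : Plane, U.v .upper t (x', l) 2 = 0

/-! ### The piecewise Sobolev norms -/

/-- `F` is the horizontal Fourier transform of `f` on `ℝ² × I`, with the convention
`F (ξ, x₃) = ∫ f (x', x₃) e ^ (-i x'·ξ) dx'`. For almost every height it is the Plancherel
transform of the slice; Mathlib's transform has the kernel `e ^ (-2πi x'·ξ)`, hence the
rescaling of `ξ`. -/
def IsHorizontalFourier (I : Set ℝ) (f F : Pt → ℂ) : Prop :=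
  ∀ᵐ y ∂(volume.restrict I), ∃ h : MemLp (fun x' : Plane => f (x', y)) 2 volume,
    (fun ξ : Plane => F (ξ, y)) =ᵐ[volume]
      fun ξ => (𝓕 (h.toLp (fun x' : Plane => f (x', y))) : Lp ℂ 2 (volume : Measure Plane))
        ((2 * Real.pi)⁻¹ • ξ)

/-- `G` is the weak derivative of `F` with respect to `x₃` on the open set `ℝ² × I`. -/
def IsWeakVerticalDeriv (I : Set ℝ) (F G : Pt → ℂ) : Prop :=
  ∀ φ : Pt → ℝ, ContDiff ℝ ∞ φ → HasCompactSupport φ → tsupport φ ⊆ univ ×ˢ I →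
    ∫ z in univ ×ˢ I, deriv (fun y => φ (z.1, y)) z.2 • F z
      = -∫ z in univ ×ˢ I, φ z • G z

/-- `F j`, for `j ≤ k`, is the `j`-th weak vertical derivative of the horizontal Fourier transform
of `f`, and all of these are square integrable on `ℝ² × I`. -/
structure IsFourierJet (I : Set ℝ) (k : ℕ) (f : Pt → ℝ) (F : ℕ → Pt → ℂ) : Prop where
  memLp : MemLp f 2 (volume.restrict (univ ×ˢ I))
  fourier : IsHorizontalFourier I (fun x => (f x : ℂ)) (F 0)
  jet_memLp : ∀ j ≤ k, MemLp (F j) 2 (volume.restrict (univ ×ˢ I))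
  weakDeriv : ∀ j < k, IsWeakVerticalDeriv I (F j) (F (j + 1))

/-- The square of the norm of `H^k(ℝ² × I)`, that is
`∑_{j ≤ k} ∫ (1 + |ξ|²)^(k - j) |∂₃^j f̂ (ξ, x₃)|² dξ dx₃`. The derivatives are unique up to null
sets, so the infimum is over a set with at most one element; it is `∞` if `f` is not in `H^k`. -/
def sobolevSq (I : Set ℝ) (k : ℕ) (f : Pt → ℝ) : ℝ≥0∞ :=
  ⨅ (F : ℕ → Pt → ℂ) (_ : IsFourierJet I k f F),
    ∑ j ∈ Finset.range (k + 1),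
      ∫⁻ z in univ ×ˢ I, ENNReal.ofReal ((1 + ‖z.1‖ ^ 2) ^ (k - j)) * ‖F j z‖ₑ ^ 2

/-- The norm of the piecewise Sobolev space `H^k` for scalar functions. -/
def scalarNorm (m l : ℝ) (k : ℕ) (f : Layer → Pt → ℝ) : ℝ≥0∞ :=
  (∑ s, sobolevSq (s.interval m l) k (f s)) ^ (1 / 2 : ℝ)

/-- The norm of the piecewise Sobolev space `H^k` for vector fields. -/
def vectorNorm (m l : ℝ) (k : ℕ) (u : Layer → Pt → Fin 3 → ℝ) : ℝ≥0∞ :=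
  (∑ s, ∑ i, sobolevSq (s.interval m l) k (fun x => u s x i)) ^ (1 / 2 : ℝ)

end RotatingRT

end

open MeasureTheory Set
open scoped ENNReal FourierTransform ContDiff

noncomputable section

namespace RotatingRT

/-! ### The Fourier transform on `L²` -/

section

section FourierL2
variable {V : Type*} [NormedAddCommGroup V] [InnerProductSpace ℝ V] [FiniteDimensional ℝ V]
  [MeasurableSpace V] [BorelSpace V]

/-! High frequencies grow arbitrarily fast, while the price of a high frequency in a Sobolev norm is
only polynomial.

Normal modes. Look for solutions `exp (λ t + i ξ·x')` times a profile in the height. Write the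
density perturbation as `ρ₀ / p'(ρ₀)` times a function `π`. By the hydrostatic equation the term
`ρ₀' π` of the pressure gradient cancels `-g q`, and the momentum equation becomes `∂ₜ v + ∇(π + g
η₃) = 2 Ω (v₂, -v₁, 0)`. With `Φ` for `λ (π + g η₃)` and `Ψ = Φ'`, the horizontal equations are a
2×2 system of determinant `λ² + 4Ω²`, the vertical one gives `η₃ = -λ⁻³ Ψ`, and continuity becomes
`Ψ' = (g/c) Ψ + (λ²/c + λ²|ξ|²/(λ² + 4Ω²)) Φ`, with `c = p'(ρ₀)`. The conditions are `Ψ = 0` at the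
walls, and continuity of `Ψ` and of `ρ₀ (Φ + g λ⁻² Ψ)` at the interface.

Growth rate. No variational problem is needed. Solve the equation from each wall with data `(1, 0)`.
Matching at the interface leaves one scalar equation, `dispersion = 0`. Monotonicity of `(ρψ)² - c
φ²` compares `ψ` at the interface with multiples of `φ` of the order of the wave number
(`LayerSolution.le_sq_ψ`, `LayerSolution.sq_ψ_le`). Because the heavy fluid is on top, the
dispersion function is therefore negative at `λ = L` and positive at `λ = R + 1`, for every wave
number in `[R, R + 1]` with `R = γ L²` and `L` large. A zero, chosen measurably in the wave number,
is a growth rate of at least `L` (`exists_modeFamily`).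

Superposition. A single plane wave is not square integrable, so the modes are integrated over the
annulus `R ≤ |ξ| ≤ R + 1`. The Hermitian symmetry of the coefficients makes the result real, and its
horizontal Fourier transform is explicit, so the norms can be computed (`isFourierJet_waveJet`).

Comparison of norms. All vertical derivatives of a mode are bounded, at the same height, by a power
of `R + 1` times `|Φ| + |Ψ|` (`exists_bound_of_system`). Hence the initial norms and the norms at
later times are compared with one and the same energy, whatever the shape of the modes: from above
with a polynomial in `R` at time zero, from below with `exp (2 L t)` over a polynomial. As `R = γ
L²`, the exponential wins for large `L` (`eventually_upperConst_le`), and a scalar factor `ε`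
normalizes the data. -/

theorem integral_fourierInv_mul_eq {f g : V → ℂ} (hf : Integrable f) (hg : Integrable g) :
    ∫ x, 𝓕⁻ f x * g x = ∫ x, f x * 𝓕⁻ g x := by
  have h := VectorFourier.integral_fourierIntegral_smul_eq_flip (L := -innerₗ V)
      (f := f) (g := g) (μ := volume) (ν := volume)
      Real.continuous_fourierChar (by
        have : Continuous fun p : V × V => -inner ℝ p.1 p.2 := by fun_prop
        simpa using this) hf hg
  have e1 : ∀ f : V → ℂ, 𝓕⁻ f
      = VectorFourier.fourierIntegral Real.fourierChar volume (-innerₗ V) f := by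
    intro f
    ext x
    simp [Real.fourierInv_eq, VectorFourier.fourierIntegral]
  have e2 : ∀ f : V → ℂ, 𝓕⁻ f
      = VectorFourier.fourierIntegral Real.fourierChar volume (-innerₗ V).flip f := by
    intro f
    ext x
    simp [Real.fourierInv_eq, VectorFourier.fourierIntegral, real_inner_comm]
  rw [e1 f, e2 g]
  simpa [smul_eq_mul] using h

/-- Both inverse transforms, the integral and the `L²` extension, pair with a test function `ψ` to
`∫ G 𝓕⁻ψ`: the first by Fubini, the second because the `L²` transform is the one of tempered
distributions. -/
theorem fourierInv_ae_eq_coeFn_fourierInv {G : V → ℂ} (h1 : Integrable G) (h2 : MemLp G 2 volume) :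
    𝓕⁻ G =ᵐ[volume] (𝓕⁻ (h2.toLp G) : Lp ℂ 2 (volume : Measure V)) := by
  have hcont : Continuous (𝓕⁻ G) := by
    have := VectorFourier.fourierIntegral_continuous (V := V) (W := V) (μ := volume) (L := -innerₗ V)
      Real.continuous_fourierChar (by
        have : Continuous fun p : V × V => -inner ℝ p.1 p.2 := by fun_prop
        simpa using this) h1
    convert! this using 1
  refine ae_eq_of_integral_contDiff_smul_eq hcont.locallyIntegrable
    ((Lp.memLp _).locallyIntegrable (by norm_num)) fun φ hφ hcφ => ?_
  have hg₁ : HasCompactSupport (Complex.ofRealCLM ∘ φ) := hcφ.comp_left rfl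
  have hg₂ : ContDiff ℝ ∞ (Complex.ofRealCLM ∘ φ) := by fun_prop
  set ψ : SchwartzMap V ℂ := hg₁.toSchwartzMap hg₂ with hψ
  have hψφ : ∀ x, ψ x = (φ x : ℂ) := fun x => rfl
  have key := Lp.fourierInv_toTemperedDistribution_eq (h2.toLp G)
  have key2 := DFunLike.congr_fun key ψ
  rw [TemperedDistribution.fourierInv_apply, Lp.toTemperedDistribution_apply,
    Lp.toTemperedDistribution_apply] at key2
  have e3 : ∀ x, φ x • 𝓕⁻ G x = ψ x * 𝓕⁻ G x := by
    intro x; rw [hψφ]; simp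
  simp_rw [e3]
  rw [← integral_fourierInv_mul_eq ψ.integrable h1]
  have : ∫ x, φ x • (𝓕⁻ (h2.toLp G) : Lp ℂ 2 (volume : Measure V)) x
      = ∫ x, ψ x • (𝓕⁻ (h2.toLp G) : Lp ℂ 2 (volume : Measure V)) x := by
    congr 1
  rw [this, ← key2]
  refine integral_congr_ae ?_
  filter_upwards [h2.coeFn_toLp] with x hx
  rw [hx, smul_eq_mul, SchwartzMap.fourierInv_coe]

theorem memLp_fourierInv {G : V → ℂ} (h1 : Integrable G) (h2 : MemLp G 2 volume) :
    MemLp (𝓕⁻ G) 2 volume :=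
  (memLp_congr_ae (fourierInv_ae_eq_coeFn_fourierInv h1 h2)).2 (Lp.memLp _)

theorem fourier_toLp_fourierInv {G : V → ℂ} (h1 : Integrable G) (h2 : MemLp G 2 volume)
    (h : MemLp (𝓕⁻ G) 2 volume) :
    (𝓕 (h.toLp (𝓕⁻ G)) : Lp ℂ 2 (volume : Measure V)) = h2.toLp G := by
  have : h.toLp (𝓕⁻ G) = (𝓕⁻ (h2.toLp G) : Lp ℂ 2 (volume : Measure V)) := by
    apply Lp.ext
    exact h.coeFn_toLp.trans (fourierInv_ae_eq_coeFn_fourierInv h1 h2)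
  rw [this, FourierTransform.fourier_fourierInv_eq]

theorem lintegral_enorm_sq_fourierInv {G : V → ℂ} (h1 : Integrable G) (h2 : MemLp G 2 volume) :
    ∫⁻ x, ‖𝓕⁻ G x‖ₑ ^ 2 = ∫⁻ x, ‖G x‖ₑ ^ 2 := by
  have h := memLp_fourierInv h1 h2
  have e : ‖h.toLp (𝓕⁻ G)‖ = ‖h2.toLp G‖ := by
    rw [← fourier_toLp_fourierInv h1 h2 h, Lp.norm_fourier_eq]
  rw [Lp.norm_toLp, Lp.norm_toLp, ENNReal.toReal_eq_toReal_iff' h.2.ne h2.2.ne] at e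
  have e' : ∀ f : V → ℂ, ∫⁻ x, ‖f x‖ₑ ^ 2 = eLpNorm f 2 volume ^ 2 := by
    intro f
    rw [eLpNorm_eq_lintegral_rpow_enorm_toReal (by norm_num) (by norm_num)]
    simp only [ENNReal.toReal_ofNat, ENNReal.rpow_ofNat, one_div]
    rw [← ENNReal.rpow_natCast, ← ENNReal.rpow_mul]
    simp
  rw [e', e', e]

end FourierL2

end

/-! ### Fourier jets and their uniqueness -/

section

theorem volume_restrict_univ_prod (I : Set ℝ) :
    (volume : Measure Pt).restrict (univ ×ˢ I)
      = (volume : Measure Plane).prod (volume.restrict I) := by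
  rw [Measure.volume_eq_prod, ← Measure.prod_restrict, Measure.restrict_univ]

/-- Functions on `ℝ² × I` which agree on almost every horizontal slice agree almost everywhere. -/
theorem ae_eq_of_forall_slice {I : Set ℝ} {F G : Pt → ℂ}
    (hF : AEStronglyMeasurable F (volume.restrict (univ ×ˢ I)))
    (hG : AEStronglyMeasurable G (volume.restrict (univ ×ˢ I)))
    (h : ∀ᵐ y ∂(volume.restrict I), ∀ᵐ ξ : Plane, F (ξ, y) = G (ξ, y)) :
    F =ᵐ[volume.restrict (univ ×ˢ I)] G := by
  rw [volume_restrict_univ_prod] at *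
  have hm : AEMeasurable (fun z => ‖F z - G z‖ₑ) ((volume : Measure Plane).prod (volume.restrict I)) :=
    (hF.sub hG).enorm
  have : ∫⁻ z, ‖F z - G z‖ₑ ∂((volume : Measure Plane).prod (volume.restrict I)) = 0 := by
    rw [lintegral_prod_symm _ hm, ← lintegral_zero (μ := volume.restrict I)]
    refine lintegral_congr_ae ?_
    filter_upwards [h] with y hy
    rw [← lintegral_zero (μ := (volume : Measure Plane))]
    refine lintegral_congr_ae ?_
    filter_upwards [hy] with ξ hξ
    simp [hξ]
  rw [lintegral_eq_zero_iff' hm] at this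
  filter_upwards [this] with z hz
  simpa [sub_eq_zero] using hz

/-- The difference integrates to zero against every test function supported in the open slab. Square
integrability serves only to provide local integrability. -/
theorem isWeakVerticalDeriv_ae_unique {I : Set ℝ} (hI : IsOpen I) {F F' G G' : Pt → ℂ}
    (hF : F =ᵐ[volume.restrict (univ ×ˢ I)] F')
    (hG : MemLp G 2 (volume.restrict (univ ×ˢ I))) (hG' : MemLp G' 2 (volume.restrict (univ ×ˢ I)))
    (h : IsWeakVerticalDeriv I F G) (h' : IsWeakVerticalDeriv I F' G') :
    G =ᵐ[volume.restrict (univ ×ˢ I)] G' := by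
  have hU : IsOpen ((univ : Set Plane) ×ˢ I) := isOpen_univ.prod hI
  have hlG : LocallyIntegrable G (volume.restrict (univ ×ˢ I)) :=
    hG.locallyIntegrable (by norm_num)
  have hlG' : LocallyIntegrable G' (volume.restrict (univ ×ˢ I)) :=
    hG'.locallyIntegrable (by norm_num)
  have hl : LocallyIntegrableOn (fun z => G z - G' z) (univ ×ˢ I) volume :=
    locallyIntegrableOn_of_locallyIntegrable_restrict (hlG.sub hlG')
  have key := hU.ae_eq_zero_of_integral_contDiff_smul_eq_zero hl fun φ hφ hc hs => by
    have e1 := h φ hφ hc hs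
    have e2 := h' φ hφ hc hs
    have e3 : ∫ z in univ ×ˢ I, deriv (fun y => φ (z.1, y)) z.2 • F z
        = ∫ z in univ ×ˢ I, deriv (fun y => φ (z.1, y)) z.2 • F' z := by
      refine integral_congr_ae ?_
      filter_upwards [hF] with z hz
      rw [hz]
    have i1 : Integrable (fun z => φ z • G z) (volume.restrict (univ ×ˢ I)) :=
      hlG.integrable_smul_left_of_hasCompactSupport hφ.continuous hc
    have i2 : Integrable (fun z => φ z • G' z) (volume.restrict (univ ×ˢ I)) :=
      hlG'.integrable_smul_left_of_hasCompactSupport hφ.continuous hc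
    have e4 : ∫ z, φ z • (G z - G' z) = ∫ z in univ ×ˢ I, φ z • (G z - G' z) := by
      rw [setIntegral_eq_integral_of_forall_compl_eq_zero]
      intro z hz
      rw [image_eq_zero_of_notMem_tsupport (fun hz' => hz (hs hz')), zero_smul]
    rw [e4]
    simp_rw [smul_sub]
    rw [integral_sub i1 i2]
    rw [e3, e2] at e1
    rw [neg_inj.1 e1, sub_self]
  rw [Filter.EventuallyEq, ae_restrict_iff' hU.measurableSet]
  filter_upwards [key] with z hz hzI
  exact sub_eq_zero.1 (hz hzI)

/-- The jet of a function is unique up to null sets. -/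
theorem IsFourierJet.ae_unique {I : Set ℝ} (hI : IsOpen I) {k : ℕ} {f : Pt → ℝ}
    {F G : ℕ → Pt → ℂ} (hF : IsFourierJet I k f F) (hG : IsFourierJet I k f G) :
    ∀ j ≤ k, F j =ᵐ[volume.restrict (univ ×ˢ I)] G j := by
  intro j
  induction j with
  | zero =>
    intro _
    refine ae_eq_of_forall_slice (hF.jet_memLp 0 (Nat.zero_le k)).1
      (hG.jet_memLp 0 (Nat.zero_le k)).1 ?_
    filter_upwards [hF.fourier, hG.fourier] with y h1 h2
    obtain ⟨h1, e1⟩ := h1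
    obtain ⟨h2, e2⟩ := h2
    exact e1.trans e2.symm
  | succ j ih =>
    intro hj
    exact isWeakVerticalDeriv_ae_unique hI (ih (by omega)) (hF.jet_memLp _ hj) (hG.jet_memLp _ hj)
      (hF.weakDeriv j (by omega)) (hG.weakDeriv j (by omega))

/-- By uniqueness of the jet all members of the infimum are equal, so the norm can be computed from
any jet at hand. The upper, lower and comparison estimates of norms all rest on this. -/
theorem IsFourierJet.sobolevSq_eq {I : Set ℝ} (hI : IsOpen I) {k : ℕ} {f : Pt → ℝ}
    {F : ℕ → Pt → ℂ} (hF : IsFourierJet I k f F) :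
    sobolevSq I k f = ∑ j ∈ Finset.range (k + 1),
      ∫⁻ z in univ ×ˢ I, ENNReal.ofReal ((1 + ‖z.1‖ ^ 2) ^ (k - j)) * ‖F j z‖ₑ ^ 2 := by
  refine le_antisymm (iInf₂_le F hF) (le_iInf₂ fun G hG => le_of_eq ?_)
  refine Finset.sum_congr rfl fun j hj => lintegral_congr_ae ?_
  filter_upwards [hF.ae_unique hI hG j (by simpa [Nat.lt_succ_iff] using hj)] with z hz
  rw [hz]

/-- Fubini reduces the weak identity to vertical lines, where it is integration by parts without
boundary terms. -/
theorem isWeakVerticalDeriv_of_hasDerivAt {a b : ℝ} {F G : Pt → ℂ}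
    (hF : LocallyIntegrable F (volume.restrict (univ ×ˢ Ioo a b)))
    (hG : LocallyIntegrable G (volume.restrict (univ ×ˢ Ioo a b)))
    (h : ∀ ξ, ∀ y ∈ Ioo a b, HasDerivAt (fun y => F (ξ, y)) (G (ξ, y)) y) :
    IsWeakVerticalDeriv (Ioo a b) F G := by
  intro φ hφ hc hs
  have hφd : ∀ z : Pt, HasDerivAt (fun y => φ (z.1, y)) (fderiv ℝ φ z (0, 1)) z.2 := by
    intro z
    have h1 : HasFDerivAt φ (fderiv ℝ φ z) (z.1, z.2) :=
      (hφ.differentiable (by simp) z).hasFDerivAt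
    have h2 : HasDerivAt (fun y : ℝ => (z.1, y)) ((0 : Plane), (1 : ℝ)) z.2 :=
      (hasDerivAt_const _ _).prodMk (hasDerivAt_id _)
    exact h1.comp_hasDerivAt z.2 h2
  have hdc : Continuous fun z : Pt => fderiv ℝ φ z (0, 1) :=
    (hφ.continuous_fderiv (by simp)).clm_apply continuous_const
  have hdcs : HasCompactSupport fun z : Pt => fderiv ℝ φ z (0, 1) :=
    (hc.fderiv (𝕜 := ℝ)).comp_left (g := fun T : Pt →L[ℝ] ℝ => T (0, 1)) (by simp)
  have i1 : Integrable (fun z => fderiv ℝ φ z (0, 1) • F z) (volume.restrict (univ ×ˢ Ioo a b)) :=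
    hF.integrable_smul_left_of_hasCompactSupport hdc hdcs
  have i2 : Integrable (fun z => φ z • G z) (volume.restrict (univ ×ˢ Ioo a b)) :=
    hG.integrable_smul_left_of_hasCompactSupport hφ.continuous hc
  have e1 : ∀ z : Pt, deriv (fun y => φ (z.1, y)) z.2 • F z = fderiv ℝ φ z (0, 1) • F z :=
    fun z => by rw [(hφd z).deriv]
  simp_rw [e1]
  rw [eq_neg_iff_add_eq_zero, ← integral_add i1 i2]
  have i3 : Integrable (fun z => fderiv ℝ φ z (0, 1) • F z + φ z • G z)
      (volume.restrict (univ ×ˢ Ioo a b)) := i1.add i2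
  rw [volume_restrict_univ_prod] at i3 ⊢
  rw [integral_prod _ i3, ← integral_zero Plane ℂ (μ := volume)]
  refine integral_congr_ae ?_
  filter_upwards [i3.prod_right_ae] with ξ hξ
  -- on each vertical line, the derivative of a compactly supported function integrates to zero
  set u : ℝ → ℂ := fun y => φ (ξ, y) • (Ioo a b).indicator (fun y => F (ξ, y)) y with hu
  have hzero : ∀ y ∉ Ioo a b, φ (ξ, y) = 0 := fun y hy =>
    image_eq_zero_of_notMem_tsupport fun h => hy (hs h).2
  set w : ℝ → ℂ := (Ioo a b).indicator fun y => fderiv ℝ φ (ξ, y) (0, 1) • F (ξ, y)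
    + φ (ξ, y) • G (ξ, y) with hw
  have hder : ∀ y, HasDerivAt u (w y) y := by
    intro y
    by_cases hy : y ∈ Ioo a b
    · have h1 := (hφd (ξ, y)).smul (h ξ y hy)
      have : w y = φ (ξ, y) • G (ξ, y) + fderiv ℝ φ (ξ, y) (0, 1) • F (ξ, y) := by
        simp only [hw, indicator_of_mem hy]; ring
      rw [this]
      refine h1.congr_of_eventuallyEq ?_
      filter_upwards [isOpen_Ioo.mem_nhds hy] with y' hy'
      simp only [hu, indicator_of_mem hy', Pi.smul_apply']
    -- The support of `φ` is closed and lies in the open slab, so `φ` vanishes near every height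
    -- outside the interval, end points included. The cut-off of `F` therefore creates no jump.
    · have hev : ∀ᶠ y' in nhds y, φ (ξ, y') = 0 := by
        have : (ξ, y) ∉ tsupport φ := fun h => hy (hs h).2
        have h2 := (isClosed_tsupport φ).isOpen_compl.mem_nhds this
        have h3 : Filter.Tendsto (fun y' : ℝ => (ξ, y')) (nhds y) (nhds (ξ, y)) :=
          (Continuous.prodMk_right ξ).tendsto y
        filter_upwards [h3 h2] with y' hy'
        exact image_eq_zero_of_notMem_tsupport hy'
      have : w y = 0 := by simp only [hw, indicator_of_notMem hy]
      rw [this]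
      refine (hasDerivAt_const y (0 : ℂ)).congr_of_eventuallyEq ?_
      filter_upwards [hev] with y' hy'
      simp only [hu, hy', zero_smul]
  have hcu : HasCompactSupport u := by
    have : HasCompactSupport fun y => φ (ξ, y) := by
      refine HasCompactSupport.of_support_subset_isCompact (hc.image continuous_snd) ?_
      intro y hy
      exact ⟨(ξ, y), subset_tsupport _ hy, rfl⟩
    exact this.smul_right
  have hwint : Integrable w volume := by
    rw [hw, integrable_indicator_iff measurableSet_Ioo]
    exact hξ
  have := integral_eq_zero_of_hasDerivAt_of_integrable hder hwint
    ((continuous_iff_continuousAt.2 fun y => (hder y).continuousAt).integrable_of_hasCompactSupport hcu)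
  rw [hw, integral_indicator measurableSet_Ioo] at this
  exact this

/-- The derivative is the pointwise limit of the difference quotients with step `1 / (n + 1)`. Thus
measurability of a whole jet follows from that of its first member. -/
theorem measurable_indicator_of_hasDerivAt {a b : ℝ} {F G : Pt → ℂ}
    (hF : Measurable ((univ ×ˢ Ioo a b).indicator F))
    (h : ∀ ξ, ∀ y ∈ Ioo a b, HasDerivAt (fun y => F (ξ, y)) (G (ξ, y)) y) :
    Measurable ((univ ×ˢ Ioo a b).indicator G) := by
  set H := (univ ×ˢ Ioo a b).indicator F with hH
  have hI : MeasurableSet ((univ : Set Plane) ×ˢ Ioo a b) :=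
    MeasurableSet.univ.prod measurableSet_Ioo
  have hm : ∀ n : ℕ, Measurable ((univ ×ˢ Ioo a b).indicator fun z : Pt =>
      ((n : ℝ) + 1) • (H (z.1, z.2 + ((n : ℝ) + 1)⁻¹) - H z)) := fun n => by
    refine Measurable.indicator ?_ hI
    have : Measurable fun z : Pt => H (z.1, z.2 + ((n : ℝ) + 1)⁻¹) :=
      hF.comp (by fun_prop)
    exact (this.sub hF).const_smul ((n : ℝ) + 1)
  refine measurable_of_tendsto_metrizable hm (tendsto_pi_nhds.2 ?_)
  rintro ⟨ξ, y⟩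
  by_cases hy : y ∈ Ioo a b
  · have hz : (ξ, y) ∈ (univ : Set Plane) ×ˢ Ioo a b := ⟨mem_univ _, hy⟩
    simp only [indicator_of_mem hz]
    have h1 := (h ξ y hy).tendsto_slope_zero_right
    have h2 : Filter.Tendsto (fun n : ℕ => ((n : ℝ) + 1)⁻¹) Filter.atTop (nhdsWithin 0 (Ioi 0)) := by
      refine tendsto_nhdsWithin_iff.2 ⟨?_, Filter.Eventually.of_forall fun n => ?_⟩
      · simpa using tendsto_one_div_add_atTop_nhds_zero_nat (𝕜 := ℝ)
      · simp only [mem_Ioi]; positivity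
    refine (h1.comp h2).congr' ?_
    have h3 : ∀ᶠ n : ℕ in Filter.atTop, y + ((n : ℝ) + 1)⁻¹ ∈ Ioo a b := by
      have h4 : Filter.Tendsto (fun n : ℕ => y + ((n : ℝ) + 1)⁻¹) Filter.atTop (nhds (y + 0)) :=
        tendsto_const_nhds.add (tendsto_nhdsWithin_iff.1 h2).1
      rw [add_zero] at h4
      exact h4 (isOpen_Ioo.mem_nhds hy)
    filter_upwards [h3] with n hn
    have hn' : (ξ, y + ((n : ℝ) + 1)⁻¹) ∈ (univ : Set Plane) ×ˢ Ioo a b := ⟨mem_univ _, hn⟩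
    simp only [Function.comp, hH, indicator_of_mem hz, indicator_of_mem hn', inv_inv]
  · have hz : (ξ, y) ∉ (univ : Set Plane) ×ˢ Ioo a b := fun h => hy h.2
    simp only [indicator_of_notMem hz]
    exact tendsto_const_nhds

theorem memLp_two_of_bounded_of_support {a b R C : ℝ} {F : Pt → ℂ}
    (hm : AEStronglyMeasurable F (volume.restrict (univ ×ˢ Ioo a b)))
    (hsupp : ∀ ξ : Plane, ∀ y ∈ Ioo a b, R < ‖ξ‖ → F (ξ, y) = 0)
    (hb : ∀ ξ : Plane, ∀ y ∈ Ioo a b, ‖F (ξ, y)‖ ≤ C) :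
    MemLp F 2 (volume.restrict (univ ×ˢ Ioo a b)) := by
  have hI : MeasurableSet ((univ : Set Plane) ×ˢ Ioo a b) :=
    MeasurableSet.univ.prod measurableSet_Ioo
  have hS : MeasurableSet (Metric.closedBall (0 : Plane) R ×ˢ Ioo a b) :=
    Metric.isClosed_closedBall.measurableSet.prod measurableSet_Ioo
  have hfin : volume (Metric.closedBall (0 : Plane) R ×ˢ Ioo a b) < ⊤ := by
    rw [Measure.volume_eq_prod, Measure.prod_prod]
    exact ENNReal.mul_lt_top measure_closedBall_lt_top (by simp)
  have h1 : MemLp ((Metric.closedBall (0 : Plane) R ×ˢ Ioo a b).indicator fun _ : Pt => C) 2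
      (volume.restrict (univ ×ˢ Ioo a b)) :=
    memLp_indicator_const 2 hS C
      (Or.inr ((Measure.restrict_le_self _).trans_lt hfin).ne)
  refine h1.of_le hm ?_
  filter_upwards [ae_restrict_mem hI] with z hz
  by_cases hR : ‖z.1‖ ≤ R
  · have : z ∈ Metric.closedBall (0 : Plane) R ×ˢ Ioo a b := ⟨by simpa using hR, hz.2⟩
    rw [indicator_of_mem this]
    exact (hb z.1 z.2 hz.2).trans (le_abs_self C)
  · rw [show F z = 0 from hsupp z.1 z.2 hz.2 (not_le.1 hR), norm_zero]
    exact norm_nonneg _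

end

/-! ### Fourier jets of functions given by a smooth transform -/

section

theorem memLp_of_bounded_of_support {R C : ℝ} (p : ℝ≥0∞) {G : Plane → ℂ} (hm : Measurable G)
    (hsupp : ∀ ζ, R < ‖ζ‖ → G ζ = 0) (hb : ∀ ζ, ‖G ζ‖ ≤ C) : MemLp G p volume := by
  have h1 : MemLp ((Metric.closedBall (0 : Plane) R).indicator fun _ : Plane => C) p volume :=
    memLp_indicator_const p Metric.isClosed_closedBall.measurableSet C
      (Or.inr measure_closedBall_lt_top.ne)
  refine h1.of_le hm.aestronglyMeasurable (Filter.Eventually.of_forall fun ζ => ?_)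
  by_cases hR : ‖ζ‖ ≤ R
  · rw [indicator_of_mem (by simpa using hR)]
    exact (hb ζ).trans (le_abs_self C)
  · rw [hsupp ζ (not_le.1 hR), norm_zero]
    exact norm_nonneg _

theorem lintegral_enorm_sq_le_of_bounded_of_support {R C : ℝ} {G : Plane → ℂ}
    (hsupp : ∀ ζ, R < ‖ζ‖ → G ζ = 0) (hb : ∀ ζ, ‖G ζ‖ ≤ C) :
    ∫⁻ ζ, ‖G ζ‖ₑ ^ 2 ≤ ENNReal.ofReal C ^ 2 * volume (Metric.closedBall (0 : Plane) R) := by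
  rw [← lintegral_indicator_const Metric.isClosed_closedBall.measurableSet]
  refine lintegral_mono fun ζ => ?_
  by_cases hR : ‖ζ‖ ≤ R
  · rw [indicator_of_mem (by simpa using hR), ← ofReal_norm]
    gcongr
    exact hb ζ
  · simp [hsupp ζ (not_le.1 hR)]

/-- The slices of the transform are bounded with compact support, hence integrable and square
integrable. So the pointwise inverse integral which defines `f` agrees with the Plancherel inverse,
and pointwise vertical derivatives are weak ones. -/
theorem isFourierJet_of_hasDerivAt {a b R : ℝ} {k : ℕ} {f : Pt → ℝ} {F : ℕ → Pt → ℂ}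
    (hm : Measurable ((univ ×ˢ Ioo a b).indicator (F 0)))
    (hsupp : ∀ j ≤ k, ∀ ξ : Plane, ∀ y ∈ Ioo a b, R < ‖ξ‖ → F j (ξ, y) = 0)
    (hb : ∀ j ≤ k, ∃ C : ℝ, ∀ ξ : Plane, ∀ y ∈ Ioo a b, ‖F j (ξ, y)‖ ≤ C)
    (hd : ∀ j < k, ∀ ξ, ∀ y ∈ Ioo a b, HasDerivAt (fun y => F j (ξ, y)) (F (j + 1) (ξ, y)) y)
    (hfm : Measurable f)
    (hf : ∀ x', ∀ y ∈ Ioo a b,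
      (f (x', y) : ℂ) = 𝓕⁻ (fun ζ : Plane => F 0 ((2 * Real.pi) • ζ, y)) x') :
    IsFourierJet (Ioo a b) k f F := by
  have hI : MeasurableSet ((univ : Set Plane) ×ˢ Ioo a b) :=
    MeasurableSet.univ.prod measurableSet_Ioo
  have hπ : 0 < 2 * Real.pi := by positivity
  have hmj : ∀ j ≤ k, Measurable ((univ ×ˢ Ioo a b).indicator (F j)) := by
    intro j
    induction j with
    | zero => intro _; exact hm
    | succ j ih => intro hj; exact measurable_indicator_of_hasDerivAt (ih (by omega)) (hd j (by omega))
  have hL : ∀ j ≤ k, MemLp (F j) 2 (volume.restrict (univ ×ˢ Ioo a b)) := by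
    intro j hj
    obtain ⟨C, hC⟩ := hb j hj
    refine memLp_two_of_bounded_of_support (R := R) (C := C) ?_ (hsupp j hj) hC
    exact (aestronglyMeasurable_indicator_iff hI).1 (hmj j hj).aestronglyMeasurable
  obtain ⟨C, hC⟩ := hb 0 (Nat.zero_le k)
  set G : ℝ → Plane → ℂ := fun y ζ => F 0 ((2 * Real.pi) • ζ, y) with hG
  have hGm : ∀ y ∈ Ioo a b, Measurable (G y) := fun y hy => by
    have : Measurable fun ζ : Plane =>
        (univ ×ˢ Ioo a b).indicator (F 0) ((2 * Real.pi) • ζ, y) := hm.comp (by fun_prop)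
    convert this using 1
    ext ζ
    exact (indicator_of_mem (show ((2 * Real.pi) • ζ, y) ∈ univ ×ˢ Ioo a b from ⟨mem_univ _, hy⟩) _).symm
  have hGs : ∀ y ∈ Ioo a b, ∀ ζ, R / (2 * Real.pi) < ‖ζ‖ → G y ζ = 0 := fun y hy ζ hζ => by
    refine hsupp 0 (Nat.zero_le k) _ y hy ?_
    rw [norm_smul, Real.norm_of_nonneg hπ.le]
    rwa [div_lt_iff₀' hπ] at hζ
  have hGb : ∀ y ∈ Ioo a b, ∀ ζ, ‖G y ζ‖ ≤ C := fun y hy ζ => hC _ y hy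
  have hG1 : ∀ y ∈ Ioo a b, Integrable (G y) := fun y hy =>
    memLp_one_iff_integrable.1 (memLp_of_bounded_of_support 1 (hGm y hy) (hGs y hy) (hGb y hy))
  have hG2 : ∀ y ∈ Ioo a b, MemLp (G y) 2 volume := fun y hy =>
    memLp_of_bounded_of_support 2 (hGm y hy) (hGs y hy) (hGb y hy)
  have hfs : ∀ y ∈ Ioo a b, (fun x' : Plane => (f (x', y) : ℂ)) = 𝓕⁻ (G y) := fun y hy => by
    ext x'; exact hf x' y hy
  refine ⟨?_, ?_, hL, fun j hj => ?_⟩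
  · refine ⟨hfm.aestronglyMeasurable, ?_⟩
    rw [eLpNorm_lt_top_iff_lintegral_rpow_enorm_lt_top (by norm_num) (by norm_num)]
    simp only [ENNReal.toReal_ofNat, ENNReal.rpow_ofNat]
    rw [volume_restrict_univ_prod, lintegral_prod_symm' _ (by fun_prop)]
    -- Plancherel on each slice bounds the norm of `f` there by that of its transform, uniformly in
    -- the height.
    have h1 : ∫⁻ y in Ioo a b, ∫⁻ x' : Plane, ‖f (x', y)‖ₑ ^ 2
        ≤ ∫⁻ _ in Ioo a b, ENNReal.ofReal C ^ 2
          * volume (Metric.closedBall (0 : Plane) (R / (2 * Real.pi))) := by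
      refine setLIntegral_mono' measurableSet_Ioo fun y hy => ?_
      have h2 : ∀ x' : Plane, ‖f (x', y)‖ₑ = ‖𝓕⁻ (G y) x'‖ₑ := fun x' => by
        rw [← hfs y hy, ← ofReal_norm, ← ofReal_norm, Complex.norm_real]
      simp_rw [h2]
      rw [lintegral_enorm_sq_fourierInv (hG1 y hy) (hG2 y hy)]
      exact lintegral_enorm_sq_le_of_bounded_of_support (hGs y hy) (hGb y hy)
    refine h1.trans_lt ?_
    rw [setLIntegral_const]
    exact ENNReal.mul_lt_top (ENNReal.mul_lt_top (by simp) measure_closedBall_lt_top) (by simp)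
  · refine (ae_restrict_iff' measurableSet_Ioo).2 (Filter.Eventually.of_forall fun y hy => ?_)
    have h1 := memLp_fourierInv (hG1 y hy) (hG2 y hy)
    have h2 : MemLp (fun x' : Plane => (f (x', y) : ℂ)) 2 volume := by rw [hfs y hy]; exact h1
    refine ⟨h2, ?_⟩
    have h3 : h2.toLp (fun x' : Plane => (f (x', y) : ℂ)) = h1.toLp (𝓕⁻ (G y)) :=
      MemLp.toLp_congr _ _ (by rw [hfs y hy])
    rw [h3, fourier_toLp_fourierInv (hG1 y hy) (hG2 y hy) h1]
    -- Dilations preserve null sets, so an identity for almost every frequency may be read at `ξ /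
    -- 2π`.
    have h4 : Filter.Tendsto (fun ξ : Plane => (2 * Real.pi)⁻¹ • ξ) (ae volume) (ae volume) := by
      refine Measure.QuasiMeasurePreserving.tendsto_ae ⟨by fun_prop, ?_⟩
      rw [Measure.map_addHaar_smul _ (inv_ne_zero hπ.ne')]
      exact Measure.smul_absolutelyContinuous
    filter_upwards [h4.eventually (hG2 y hy).coeFn_toLp] with ξ hξ
    rw [hξ, hG]
    simp only
    rw [smul_smul, mul_inv_cancel₀ hπ.ne', one_smul]
  · exact isWeakVerticalDeriv_of_hasDerivAt ((hL j (by omega)).locallyIntegrable (by norm_num))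
      ((hL (j + 1) (by omega)).locallyIntegrable (by norm_num)) (hd j hj)

end

section

/-! ### Superposition of growing plane waves -/

/-- The exponent `μ(ξ) t + i ξ·x'` of a plane wave, as a linear function of `(t, x)`. -/
def phase (μ : Plane → ℝ) (ξ : Plane) : ℝ × Pt →L[ℝ] ℂ :=
  (μ ξ : ℂ) • (Complex.ofRealCLM ∘L ContinuousLinearMap.fst ℝ ℝ Pt)
    + Complex.I • (Complex.ofRealCLM ∘L innerSL ℝ ξ ∘L ContinuousLinearMap.fst ℝ Plane ℝ
      ∘L ContinuousLinearMap.snd ℝ ℝ Pt)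

theorem phase_apply (μ : Plane → ℝ) (ξ : Plane) (z : ℝ × Pt) :
    phase μ ξ z = (μ ξ : ℂ) * (z.1 : ℂ) + Complex.I * ((inner ℝ ξ z.2.1 : ℝ) : ℂ) := rfl

theorem norm_cexp_phase (μ : Plane → ℝ) (ξ : Plane) (z : ℝ × Pt) :
    ‖Complex.exp (phase μ ξ z)‖ = Real.exp (μ ξ * z.1) := by
  rw [Complex.norm_exp, phase_apply]
  simp

theorem norm_phase_le (μ : Plane → ℝ) (ξ : Plane) : ‖phase μ ξ‖ ≤ |μ ξ| + ‖ξ‖ := by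
  refine ContinuousLinearMap.opNorm_le_bound _ (by positivity) fun z => ?_
  rw [phase_apply, add_mul]
  refine (norm_add_le _ _).trans (add_le_add ?_ ?_)
  · rw [norm_mul, Complex.norm_real, Complex.norm_real, Real.norm_eq_abs (μ ξ)]
    gcongr
    exact norm_fst_le z
  · rw [norm_mul, Complex.norm_I, one_mul, Complex.norm_real]
    refine (norm_inner_le_norm ξ z.2.1).trans ?_
    gcongr
    exact (norm_fst_le z.2).trans (norm_snd_le z)

theorem stronglyMeasurable_phase {μ : Plane → ℝ} (hμ : Measurable μ) :
    StronglyMeasurable (phase μ) := by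
  refine StronglyMeasurable.add ?_ ?_
  · exact (Complex.measurable_ofReal.comp hμ).stronglyMeasurable.smul stronglyMeasurable_const
  · refine Continuous.stronglyMeasurable ?_
    have h : Continuous fun ξ : Plane => innerSL ℝ ξ := (innerSL ℝ).continuous
    have h' := (continuous_const (y := Complex.ofRealCLM)).clm_comp (h.clm_comp
      (continuous_const (y := ContinuousLinearMap.fst ℝ Plane ℝ
        ∘L ContinuousLinearMap.snd ℝ ℝ Pt)))
    exact h'.const_smul Complex.I

/-- Admissible amplitudes: measurable in the frequency, with support in a fixed ball, and bounded
for bounded heights; continuous in the height. -/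
structure IsAmplitude (R : ℝ) (F : Plane → ℝ → ℂ) : Prop where
  measurable : ∀ y, Measurable fun ξ => F ξ y
  continuous : ∀ ξ, Continuous (F ξ)
  support : ∀ ξ y, R < ‖ξ‖ → F ξ y = 0
  bounded : ∀ Y : ℝ, ∃ C : ℝ, ∀ ξ y, |y| ≤ Y → ‖F ξ y‖ ≤ C

/-- The functional `f ↦ ∫ e ^ (μ(ξ) t + i ξ·x') f(ξ) dζ`, with `ξ = 2πζ`. -/
def superpose (μ : Plane → ℝ) (z : ℝ × Pt) (f : Plane → ℂ) : ℂ :=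
  ∫ ζ : Plane, Complex.exp (phase μ ((2 * Real.pi) • ζ) z) * f ((2 * Real.pi) • ζ)

/-- The superposition of the plane waves with amplitude `F`. -/
def wave (μ : Plane → ℝ) (F : Plane → ℝ → ℂ) (z : ℝ × Pt) : ℂ :=
  superpose μ z fun ξ => F ξ z.2.2

/-! ### Differentiation and symmetries of superpositions of plane waves. -/

section
variable {μ : Plane → ℝ} {M R : ℝ}

theorem norm_two_pi_smul (ζ : Plane) : ‖(2 * Real.pi) • ζ‖ = 2 * Real.pi * ‖ζ‖ := by
  rw [norm_smul, Real.norm_of_nonneg (by positivity)]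

theorem integrable_of_norm_le {E : Type*} [NormedAddCommGroup E] {f : Plane → E} {R C : ℝ}
    (hm : AEStronglyMeasurable f volume)
    (hs : ∀ ζ, R < ‖ζ‖ → f ζ = 0) (hb : ∀ ζ, ‖f ζ‖ ≤ C) : Integrable f := by
  have h1 : Integrable ((Metric.closedBall (0 : Plane) R).indicator fun _ : Plane => C) :=
    (integrable_indicator_iff Metric.isClosed_closedBall.measurableSet).2
      (integrableOn_const measure_closedBall_lt_top.ne)
  refine h1.mono' hm (Filter.Eventually.of_forall fun ζ => ?_)
  by_cases hR : ‖ζ‖ ≤ R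
  · rw [indicator_of_mem (by simpa using hR)]
    exact hb ζ
  · rw [hs ζ (not_le.1 hR), norm_zero, indicator_of_notMem (by simpa using not_le.1 hR)]

theorem measurable_cexp_phase (hμ : Measurable μ) (z : ℝ × Pt) :
    Measurable fun ξ => Complex.exp (phase μ ξ z) := by
  refine Complex.measurable_exp.comp ?_
  simp_rw [phase_apply]
  have h2 : Measurable fun ξ : Plane => inner ℝ ξ z.2.1 := by fun_prop
  fun_prop

theorem integrable_superpose (hμ : Measurable μ) (hM : ∀ ξ, |μ ξ| ≤ M) (z : ℝ × Pt)
    {f : Plane → ℂ} (hf : Measurable f) (hs : ∀ ξ, R < ‖ξ‖ → f ξ = 0) {C : ℝ}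
    (hb : ∀ ξ, ‖f ξ‖ ≤ C) :
    Integrable fun ζ : Plane =>
      Complex.exp (phase μ ((2 * Real.pi) • ζ) z) * f ((2 * Real.pi) • ζ) := by
  have hπ : 0 < 2 * Real.pi := by positivity
  have hm : Measurable fun ξ => Complex.exp (phase μ ξ z) * f ξ :=
    (measurable_cexp_phase hμ z).mul hf
  have hm' := hm.comp (measurable_const_smul (2 * Real.pi) : Measurable fun ζ : Plane => (2 * Real.pi) • ζ)
  refine integrable_of_norm_le (R := R / (2 * Real.pi)) (C := Real.exp (M * |z.1|) * C)
    hm'.aestronglyMeasurable (fun ζ hζ => ?_) fun ζ => ?_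
  · rw [hs _ (by rwa [norm_two_pi_smul, ← div_lt_iff₀' hπ]), mul_zero]
  · rw [norm_mul, norm_cexp_phase]
    have h1 : μ ((2 * Real.pi) • ζ) * z.1 ≤ M * |z.1| :=
      (le_abs_self _).trans (by rw [abs_mul]; gcongr; exact hM _)
    gcongr
    exact hb _

/-- A linear relation among amplitudes at each frequency passes to the integrals, and to the real
parts because its coefficients are real. In this way the continuity and momentum equations and the
interface and wall conditions reduce to algebra for a single mode. -/
theorem sum_superpose_eq_zero (hμ : Measurable μ) (hM : ∀ ξ, |μ ξ| ≤ M) (z : ℝ × Pt) {n : ℕ}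
    {f : Fin n → Plane → ℂ} (c : Fin n → ℝ) (hf : ∀ i, Measurable (f i))
    (hs : ∀ i ξ, R < ‖ξ‖ → f i ξ = 0) (hb : ∀ i, ∃ C : ℝ, ∀ ξ, ‖f i ξ‖ ≤ C)
    (h : ∀ ξ, ∑ i, (c i : ℂ) * f i ξ = 0) :
    ∑ i, c i * (superpose μ z (f i)).re = 0 := by
  have h1 : ∑ i, (c i : ℂ) * superpose μ z (f i) = 0 := by
    simp only [superpose, ← integral_const_mul]
    rw [← integral_finsetSum]
    · rw [← integral_zero Plane ℂ (μ := volume)]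
      congr 1
      ext ζ
      have := h ((2 * Real.pi) • ζ)
      calc _ = Complex.exp (phase μ ((2 * Real.pi) • ζ) z)
            * ∑ i, (c i : ℂ) * f i ((2 * Real.pi) • ζ) := by
            rw [Finset.mul_sum]; exact Finset.sum_congr rfl fun i _ => by ring
        _ = 0 := by rw [this, mul_zero]
    · intro i _
      obtain ⟨C, hC⟩ := hb i
      exact (integrable_superpose hμ hM z (hf i) (hs i) hC).const_mul _
  have h2 := congrArg Complex.re h1
  simpa [Complex.re_sum] using h2

/-- The derivative of the plane wave with amplitude `F`, whose vertical derivative is `F'`. -/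
def waveDeriv (μ : Plane → ℝ) (F F' : Plane → ℝ → ℂ) (z : ℝ × Pt) (ξ : Plane) : ℝ × Pt →L[ℝ] ℂ :=
  (Complex.exp (phase μ ξ z) * F ξ z.2.2) • phase μ ξ
    + (Complex.exp (phase μ ξ z) * F' ξ z.2.2) • (Complex.ofRealCLM
      ∘L ContinuousLinearMap.snd ℝ Plane ℝ ∘L ContinuousLinearMap.snd ℝ ℝ Pt)

variable {F F' : Plane → ℝ → ℂ}

theorem hasFDerivAt_planeWave (hd : ∀ ξ y, HasDerivAt (F ξ) (F' ξ y) y) (ξ : Plane) (z : ℝ × Pt) :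
    HasFDerivAt (fun z : ℝ × Pt => Complex.exp (phase μ ξ z) * F ξ z.2.2)
      (waveDeriv μ F F' z ξ) z := by
  have h1 : HasFDerivAt (fun z : ℝ × Pt => Complex.exp (phase μ ξ z))
      (Complex.exp (phase μ ξ z) • phase μ ξ) z := (phase μ ξ).hasFDerivAt.cexp
  have h2 : HasFDerivAt (fun z : ℝ × Pt => z.2.2)
      (ContinuousLinearMap.snd ℝ Plane ℝ ∘L ContinuousLinearMap.snd ℝ ℝ Pt) z :=
    (ContinuousLinearMap.snd ℝ Plane ℝ ∘L ContinuousLinearMap.snd ℝ ℝ Pt).hasFDerivAt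
  have h3 : HasFDerivAt (fun z : ℝ × Pt => F ξ z.2.2) _ z := (hd ξ z.2.2).hasFDerivAt.comp z h2
  refine (h1.mul h3).congr_fderiv ?_
  ext v
  · simp [waveDeriv]; ring
  · simp [waveDeriv]; ring
  · simp [waveDeriv]; ring

theorem norm_waveDeriv_le (hR0 : 0 ≤ R) (hM : ∀ ξ, |μ ξ| ≤ M) (hF : IsAmplitude R F)
    {τ C C' : ℝ} {z : ℝ × Pt} (hτ : |z.1| ≤ τ) (hC : ∀ ξ, ‖F ξ z.2.2‖ ≤ C)
    (hC' : ∀ ξ, ‖F' ξ z.2.2‖ ≤ C') (ξ : Plane) :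
    ‖waveDeriv μ F F' z ξ‖ ≤ Real.exp (M * τ) * C * (M + R) + Real.exp (M * τ) * C' := by
  have hM0 : 0 ≤ M := (abs_nonneg _).trans (hM 0)
  have hC0 : 0 ≤ C := (norm_nonneg _).trans (hC 0)
  have h1 : μ ξ * z.1 ≤ M * τ :=
    (le_abs_self _).trans (by rw [abs_mul]; gcongr; exact hM _)
  refine (norm_add_le _ _).trans (add_le_add ?_ ?_)
  · rw [norm_smul, norm_mul, norm_cexp_phase]
    by_cases hR : ‖ξ‖ ≤ R
    · gcongr
      · exact hC ξ
      · exact (norm_phase_le μ ξ).trans (add_le_add (hM ξ) hR)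
    · rw [hF.support ξ _ (not_le.1 hR)]
      simp only [norm_zero, mul_zero, zero_mul]
      positivity
  · rw [norm_smul, norm_mul, norm_cexp_phase]
    have h2 : ‖Complex.ofRealCLM
      ∘L ContinuousLinearMap.snd ℝ Plane ℝ ∘L ContinuousLinearMap.snd ℝ ℝ Pt‖ ≤ 1 := by
      refine ContinuousLinearMap.opNorm_le_bound _ zero_le_one fun w => ?_
      rw [one_mul]
      simp only [ContinuousLinearMap.comp_apply, Complex.ofRealCLM_apply, Complex.norm_real]
      exact (norm_snd_le w.2).trans (norm_snd_le w)
    have hC0' : 0 ≤ C' := (norm_nonneg _).trans (hC' 0)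
    calc _ ≤ Real.exp (M * τ) * C' * 1 := by gcongr; exact hC' ξ
      _ = _ := mul_one _

theorem stronglyMeasurable_waveDeriv (hμ : Measurable μ) (hF : IsAmplitude R F)
    (hF' : IsAmplitude R F') (z : ℝ × Pt) : StronglyMeasurable (waveDeriv μ F F' z) :=
  ((((measurable_cexp_phase hμ z).mul (hF.measurable z.2.2)).stronglyMeasurable).smul
    (stronglyMeasurable_phase hμ)).add
    ((((measurable_cexp_phase hμ z).mul (hF'.measurable z.2.2)).stronglyMeasurable).smul
      stronglyMeasurable_const)

theorem continuous_waveDeriv (hF : IsAmplitude R F) (hF' : IsAmplitude R F') (ξ : Plane) :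
    Continuous fun z => waveDeriv μ F F' z ξ := by
  have h1 := hF.continuous ξ
  have h2 := hF'.continuous ξ
  unfold waveDeriv
  fun_prop

theorem waveDeriv_eq_zero (hF : IsAmplitude R F) (hF' : IsAmplitude R F') (z : ℝ × Pt)
    {ξ : Plane} (hξ : R < ‖ξ‖) : waveDeriv μ F F' z ξ = 0 := by
  ext v <;> simp [waveDeriv, hF.support ξ _ hξ, hF'.support ξ _ hξ]

/-- A uniform bound for the derivatives of the plane waves near a point. -/
theorem exists_integrable_bound (hR0 : 0 ≤ R) (hM : ∀ ξ, |μ ξ| ≤ M) (hF : IsAmplitude R F)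
    (hF' : IsAmplitude R F') (z₀ : ℝ × Pt) :
    ∃ bound : Plane → ℝ, Integrable bound ∧ ∀ ζ, ∀ z ∈ Metric.ball z₀ 1,
      ‖waveDeriv μ F F' z ((2 * Real.pi) • ζ)‖ ≤ bound ζ := by
  have hπ : 0 < 2 * Real.pi := by positivity
  obtain ⟨C, hC⟩ := hF.bounded (‖z₀‖ + 1)
  obtain ⟨C', hC'⟩ := hF'.bounded (‖z₀‖ + 1)
  set c := Real.exp (M * (‖z₀‖ + 1)) * C * (M + R) + Real.exp (M * (‖z₀‖ + 1)) * C' with hc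
  refine ⟨(Metric.closedBall (0 : Plane) (R / (2 * Real.pi))).indicator fun _ => c,
    (integrable_indicator_iff Metric.isClosed_closedBall.measurableSet).2
      (integrableOn_const measure_closedBall_lt_top.ne), fun ζ z hz => ?_⟩
  by_cases hR : ‖ζ‖ ≤ R / (2 * Real.pi)
  · rw [indicator_of_mem (by simpa using hR)]
    have hz' : ‖z‖ ≤ ‖z₀‖ + 1 := by
      have h1 : ‖z - z₀‖ < 1 := by simpa [dist_eq_norm] using hz
      have h2 : ‖z‖ ≤ ‖z₀‖ + ‖z - z₀‖ := by simpa using norm_add_le z₀ (z - z₀)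
      linarith
    exact norm_waveDeriv_le hR0 hM hF ((norm_fst_le z).trans hz')
      (fun ξ => hC ξ _ (((norm_snd_le z.2).trans (norm_snd_le z)).trans hz'))
      (fun ξ => hC' ξ _ (((norm_snd_le z.2).trans (norm_snd_le z)).trans hz')) _
  · rw [indicator_of_notMem (by simpa using not_le.1 hR), waveDeriv_eq_zero hF hF', norm_zero]
    rw [norm_two_pi_smul, ← div_lt_iff₀' hπ]
    exact not_le.1 hR

theorem integrable_wave (hμ : Measurable μ) (hM : ∀ ξ, |μ ξ| ≤ M) (hF : IsAmplitude R F)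
    (z : ℝ × Pt) : Integrable fun ζ : Plane =>
      Complex.exp (phase μ ((2 * Real.pi) • ζ) z) * F ((2 * Real.pi) • ζ) z.2.2 := by
  obtain ⟨C, hC⟩ := hF.bounded |z.2.2|
  exact integrable_superpose hμ hM z (hF.measurable _) (fun ξ => hF.support ξ _)
    fun ξ => hC ξ _ le_rfl

theorem hasFDerivAt_wave (hR0 : 0 ≤ R) (hμ : Measurable μ) (hM : ∀ ξ, |μ ξ| ≤ M)
    (hF : IsAmplitude R F) (hF' : IsAmplitude R F') (hd : ∀ ξ y, HasDerivAt (F ξ) (F' ξ y) y)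
    (z : ℝ × Pt) :
    Integrable (fun ζ : Plane => waveDeriv μ F F' z ((2 * Real.pi) • ζ)) ∧
    HasFDerivAt (wave μ F) (∫ ζ : Plane, waveDeriv μ F F' z ((2 * Real.pi) • ζ)) z := by
  obtain ⟨bound, hb, hle⟩ := exists_integrable_bound hR0 hM hF hF' z
  have hm : AEStronglyMeasurable (fun ζ : Plane => waveDeriv μ F F' z ((2 * Real.pi) • ζ)) volume :=
    ((stronglyMeasurable_waveDeriv hμ hF hF' z).comp_measurable
      (measurable_const_smul (2 * Real.pi))).aestronglyMeasurable
  refine ⟨hb.mono' hm (Filter.Eventually.of_forall fun ζ =>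
    hle ζ z (Metric.mem_ball_self one_pos)), ?_⟩
  exact hasFDerivAt_integral_of_dominated_of_fderiv_le (Metric.ball_mem_nhds z one_pos)
    (Filter.Eventually.of_forall fun z => (integrable_wave hμ hM hF z).aestronglyMeasurable)
    (integrable_wave hμ hM hF z) hm (Filter.Eventually.of_forall hle) hb
    (Filter.Eventually.of_forall fun ζ z _ => hasFDerivAt_planeWave hd _ z)

theorem contDiff_wave (hR0 : 0 ≤ R) (hμ : Measurable μ) (hM : ∀ ξ, |μ ξ| ≤ M)
    (hF : IsAmplitude R F) (hF' : IsAmplitude R F') (hd : ∀ ξ y, HasDerivAt (F ξ) (F' ξ y) y) :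
    ContDiff ℝ 1 (wave μ F) := by
  rw [contDiff_one_iff_fderiv]
  refine ⟨fun z => (hasFDerivAt_wave hR0 hμ hM hF hF' hd z).2.differentiableAt, ?_⟩
  have : fderiv ℝ (wave μ F) = fun z => ∫ ζ : Plane, waveDeriv μ F F' z ((2 * Real.pi) • ζ) :=
    funext fun z => (hasFDerivAt_wave hR0 hμ hM hF hF' hd z).2.fderiv
  rw [this, continuous_iff_continuousAt]
  intro z
  obtain ⟨bound, hb, hle⟩ := exists_integrable_bound hR0 hM hF hF' z
  refine continuousAt_of_dominated (bound := bound) (Filter.Eventually.of_forall fun z =>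
    (hasFDerivAt_wave hR0 hμ hM hF hF' hd z).1.aestronglyMeasurable) ?_ hb
    (Filter.Eventually.of_forall fun ζ => (continuous_waveDeriv hF hF' _).continuousAt)
  filter_upwards [Metric.ball_mem_nhds z one_pos] with z' hz'
  exact Filter.Eventually.of_forall fun ζ => hle ζ z' hz'

theorem hasFDerivAt_re_wave_apply (hR0 : 0 ≤ R) (hμ : Measurable μ) (hM : ∀ ξ, |μ ξ| ≤ M)
    (hF : IsAmplitude R F) (hF' : IsAmplitude R F') (hd : ∀ ξ y, HasDerivAt (F ξ) (F' ξ y) y)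
    (z : ℝ × Pt) : ∃ T : ℝ × Pt →L[ℝ] ℝ, HasFDerivAt (fun z => (wave μ F z).re) T z ∧
      ∀ v, T v = (∫ ζ : Plane, waveDeriv μ F F' z ((2 * Real.pi) • ζ) v).re := by
  obtain ⟨hi, h⟩ := hasFDerivAt_wave hR0 hμ hM hF hF' hd z
  refine ⟨_, Complex.reCLM.hasFDerivAt.comp z h, fun v => ?_⟩
  rw [ContinuousLinearMap.comp_apply, ContinuousLinearMap.integral_apply hi]
  rfl

theorem hasDerivAt_re_wave_time (hR0 : 0 ≤ R) (hμ : Measurable μ) (hM : ∀ ξ, |μ ξ| ≤ M)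
    (hF : IsAmplitude R F) (hF' : IsAmplitude R F') (hd : ∀ ξ y, HasDerivAt (F ξ) (F' ξ y) y)
    (t : ℝ) (x : Pt) :
    HasDerivAt (fun τ => (wave μ F (τ, x)).re) (wave μ (fun ξ y => μ ξ * F ξ y) (t, x)).re t := by
  obtain ⟨T, hT, hv⟩ := hasFDerivAt_re_wave_apply hR0 hμ hM hF hF' hd (t, x)
  have h2 : HasDerivAt (fun τ : ℝ => (τ, x)) ((1 : ℝ), (0 : Pt)) t :=
    (hasDerivAt_id _).prodMk (hasDerivAt_const _ _)
  refine (hT.comp_hasDerivAt t h2).congr_deriv ?_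
  rw [hv]
  simp only [wave, superpose]
  congr 2
  ext ζ
  simp [waveDeriv, phase_apply]
  ring

theorem hasFDerivAt_re_wave_space (hR0 : 0 ≤ R) (hμ : Measurable μ) (hM : ∀ ξ, |μ ξ| ≤ M)
    (hF : IsAmplitude R F) (hF' : IsAmplitude R F') (hd : ∀ ξ y, HasDerivAt (F ξ) (F' ξ y) y)
    (t : ℝ) (x : Pt) : ∃ T : Pt →L[ℝ] ℝ, HasFDerivAt (fun x => (wave μ F (t, x)).re) T x ∧
      T (dir 0) = (wave μ (fun ξ y => Complex.I * ξ 0 * F ξ y) (t, x)).re ∧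
      T (dir 1) = (wave μ (fun ξ y => Complex.I * ξ 1 * F ξ y) (t, x)).re ∧
      T (dir 2) = (wave μ F' (t, x)).re := by
  obtain ⟨T, hT, hv⟩ := hasFDerivAt_re_wave_apply hR0 hμ hM hF hF' hd (t, x)
  have h2 : HasFDerivAt (fun x : Pt => (t, x)) (ContinuousLinearMap.inr ℝ ℝ Pt) x :=
    hasFDerivAt_prodMk_right t x
  refine ⟨_, hT.comp x h2, ?_, ?_, ?_⟩
  all_goals
    rw [ContinuousLinearMap.comp_apply, hv]
    simp only [wave, superpose]
    congr 2
    ext ζ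
    simp [waveDeriv, phase_apply, dir, EuclideanSpace.inner_single_right]
  all_goals ring

theorem pd_re_wave (hR0 : 0 ≤ R) (hμ : Measurable μ) (hM : ∀ ξ, |μ ξ| ≤ M)
    (hF : IsAmplitude R F) (hF' : IsAmplitude R F') (hd : ∀ ξ y, HasDerivAt (F ξ) (F' ξ y) y)
    (t : ℝ) (x : Pt) :
    pd 0 (fun x => (wave μ F (t, x)).re) x
        = (wave μ (fun ξ y => Complex.I * ξ 0 * F ξ y) (t, x)).re ∧
      pd 1 (fun x => (wave μ F (t, x)).re) x
        = (wave μ (fun ξ y => Complex.I * ξ 1 * F ξ y) (t, x)).re ∧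
      pd 2 (fun x => (wave μ F (t, x)).re) x = (wave μ F' (t, x)).re := by
  obtain ⟨T, hT, h0, h1, h2⟩ := hasFDerivAt_re_wave_space hR0 hμ hM hF hF' hd t x
  simp only [pd, hT.fderiv]
  exact ⟨h0, h1, h2⟩

/-- With `ξ = 2πζ` the phase `ξ·x'` becomes `2π ζ·x'`, the kernel of `𝓕⁻`. Integrating in `ζ` rather
than in `ξ` is what keeps normalizing constants away. -/
theorem wave_eq_fourierInv (μ : Plane → ℝ) (F : Plane → ℝ → ℂ) (t : ℝ) (x' : Plane) (y : ℝ) :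
    wave μ F (t, (x', y)) = 𝓕⁻ (fun ζ : Plane =>
      Complex.exp (μ ((2 * Real.pi) • ζ) * t) * F ((2 * Real.pi) • ζ) y) x' := by
  rw [Real.fourierInv_eq', wave, superpose]
  congr 1
  ext ζ
  rw [phase_apply, Complex.exp_add, smul_eq_mul]
  have h : inner ℝ ((2 * Real.pi) • ζ) x' = 2 * Real.pi * inner ℝ ζ x' := by
    rw [real_inner_smul_left]
  simp only [h]
  rw [mul_comm Complex.I]
  ring

/-- The substitution `ζ ↦ -ζ` turns the integral into its own conjugate. Taking the real part in the
definition of the unknowns thus loses nothing, and their Fourier transform is the amplitude itself.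
-/
theorem ofReal_re_wave {μ : Plane → ℝ} {F : Plane → ℝ → ℂ} (hμ : ∀ ξ, μ (-ξ) = μ ξ)
    (hF : ∀ ξ y, F (-ξ) y = starRingEnd ℂ (F ξ y)) (z : ℝ × Pt) :
    ((wave μ F z).re : ℂ) = wave μ F z := by
  rw [← Complex.conj_eq_iff_re, wave, superpose, ← integral_conj,
    ← integral_neg_eq_self (μ := (volume : Measure Plane))]
  congr 1
  ext ζ
  simp only [smul_neg, map_mul, ← Complex.exp_conj, hF, Complex.conj_conj, phase_apply, hμ,
    map_add, Complex.conj_ofReal, Complex.conj_I, inner_neg_left]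
  congr 2
  push_cast
  ring

end

end

section

/-! ### Linear differential equations depending on a parameter -/

section LinearODE
variable {K E : Type*} [TopologicalSpace K] [NormedAddCommGroup E] [NormedSpace ℝ E]
  {d : ℝ} {A : K → ℝ → E →L[ℝ] E}

theorem continuous_picard (hd : 0 ≤ d) (hA : Continuous (Function.uncurry A)) (u₀ : E)
    (v : C(K × Icc 0 d, E)) : Continuous fun p : K × ℝ =>
      u₀ + ∫ s in (0 : ℝ)..p.2, A p.1 s (v (p.1, projIcc 0 d hd s)) := by
  refine continuous_const.add ?_
  refine intervalIntegral.continuous_parametric_intervalIntegral_of_continuous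
    (f := fun (p : K × ℝ) s => A p.1 s (v (p.1, projIcc 0 d hd s))) ?_ continuous_snd
  have h1 : Continuous fun q : (K × ℝ) × ℝ => A q.1.1 q.2 :=
    hA.comp (by fun_prop : Continuous fun q : (K × ℝ) × ℝ => (q.1.1, q.2))
  have h2 : Continuous fun q : (K × ℝ) × ℝ => v (q.1.1, projIcc 0 d hd q.2) := by
    have := continuous_projIcc (h := hd)
    fun_prop
  exact h1.clm_apply h2

/-- The Picard operator on a bounded time interval. -/
def picard (hd : 0 ≤ d) (hA : Continuous (Function.uncurry A)) (u₀ : E)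
    (v : C(K × Icc 0 d, E)) : C(K × Icc 0 d, E) :=
  ⟨fun p => u₀ + ∫ s in (0 : ℝ)..p.2, A p.1 s (v (p.1, projIcc 0 d hd s)),
    (continuous_picard hd hA u₀ v).comp
      (by fun_prop : Continuous fun p : K × Icc 0 d => (p.1, (p.2 : ℝ)))⟩

variable [CompactSpace K]

/-- Each further integration from `0` gains a factor `M τ / (n + 1)`. The factorial makes a high
iterate contract on an interval of any length, uniformly in the parameter. -/
theorem norm_picard_iterate_sub_le (hd : 0 ≤ d) (hA : Continuous (Function.uncurry A)) (u₀ : E)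
    {M : ℝ} (hM0 : 0 ≤ M) (hM : ∀ k, ∀ s ∈ Icc 0 d, ‖A k s‖ ≤ M) (v w : C(K × Icc 0 d, E)) (n : ℕ)
    (p : K × Icc 0 d) :
    ‖(picard hd hA u₀)^[n] v p - (picard hd hA u₀)^[n] w p‖
      ≤ (M * p.2) ^ n / n.factorial * dist v w := by
  induction n generalizing p with
  | zero => simpa [dist_eq_norm] using ContinuousMap.dist_apply_le_dist (f := v) (g := w) p
  | succ n ih =>
    obtain ⟨k, τ, hτ⟩ := p
    rw [Function.iterate_succ_apply', Function.iterate_succ_apply']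
    set v' := (picard hd hA u₀)^[n] v
    set w' := (picard hd hA u₀)^[n] w
    have hint : ∀ u : C(K × Icc 0 d, E), IntervalIntegrable
        (fun s => A k s (u (k, projIcc 0 d hd s))) volume 0 τ := by
      intro u
      refine Continuous.intervalIntegrable ?_ _ _
      have h1 : Continuous fun s : ℝ => A k s :=
        hA.comp (by fun_prop : Continuous fun s : ℝ => (k, s))
      have h2 : Continuous fun s : ℝ => u (k, projIcc 0 d hd s) := by
        have := continuous_projIcc (h := hd)
        fun_prop
      exact h1.clm_apply h2
    have e : picard hd hA u₀ v' (k, ⟨τ, hτ⟩) - picard hd hA u₀ w' (k, ⟨τ, hτ⟩)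
        = ∫ s in (0 : ℝ)..τ, A k s (v' (k, projIcc 0 d hd s) - w' (k, projIcc 0 d hd s)) := by
      simp only [picard, ContinuousMap.coe_mk, map_sub]
      rw [intervalIntegral.integral_sub (hint v') (hint w')]
      abel
    rw [e]
    have hpt : ∀ s ∈ Ioc 0 τ, ‖A k s (v' (k, projIcc 0 d hd s) - w' (k, projIcc 0 d hd s))‖
        ≤ M * ((M * s) ^ n / n.factorial * dist v w) := by
      intro s hs
      have hs' : s ∈ Icc 0 d := ⟨hs.1.le, hs.2.trans hτ.2⟩
      refine (ContinuousLinearMap.le_opNorm _ _).trans ?_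
      refine mul_le_mul (hM k s hs') ?_ (norm_nonneg _) hM0
      have := ih (k, projIcc 0 d hd s)
      rwa [projIcc_of_mem hd hs'] at this ⊢
    refine (intervalIntegral.norm_integral_le_of_norm_le hτ.1
      (Filter.Eventually.of_forall fun s hs => hpt s hs)
      (Continuous.intervalIntegrable (by fun_prop) _ _)).trans (le_of_eq ?_)
    have : ∀ s : ℝ, M * ((M * s) ^ n / n.factorial * dist v w)
        = (M ^ (n + 1) / n.factorial * dist v w) * s ^ n := fun s => by ring
    simp_rw [this]
    rw [intervalIntegral.integral_const_mul, integral_pow, Nat.factorial_succ]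
    have : (n.factorial : ℝ) ≠ 0 := by positivity
    push_cast
    field_simp
    ring

variable [CompleteSpace E]

/-- The fixed point of a contracting iterate is fixed by the operator itself. Working in the space
of continuous functions on `K × [0, d]` yields joint continuity in time and parameter at once. -/
theorem exists_picard_fixedPoint (hd : 0 ≤ d) (hA : Continuous (Function.uncurry A)) (u₀ : E) :
    ∃ v : C(K × Icc 0 d, E), picard hd hA u₀ v = v := by
  obtain ⟨M, hM⟩ := (isCompact_univ.prod isCompact_Icc : IsCompact ((univ : Set K) ×ˢ Icc 0 d))
    |>.exists_bound_of_continuousOn hA.continuousOn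
  have hM' : ∀ k, ∀ s ∈ Icc 0 d, ‖A k s‖ ≤ max M 0 := fun k s hs =>
    (hM (k, s) ⟨mem_univ _, hs⟩).trans (le_max_left _ _)
  have hM0 : 0 ≤ max M 0 := le_max_right _ _
  obtain ⟨n, hn⟩ : ∃ n : ℕ, (max M 0 * d) ^ n / n.factorial < 1 / 2 :=
    ((FloorSemiring.tendsto_pow_div_factorial_atTop (max M 0 * d)).eventually
      (gt_mem_nhds (by norm_num))).exists
  have hc : ContractingWith (1 / 2) (picard hd hA u₀)^[n] := by
    refine ⟨by rw [← NNReal.coe_lt_coe]; norm_num, LipschitzWith.of_dist_le_mul fun v w => ?_⟩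
    rw [ContinuousMap.dist_le (by positivity)]
    intro p
    rw [dist_eq_norm]
    refine (norm_picard_iterate_sub_le hd hA u₀ hM0 hM' v w n p).trans ?_
    refine mul_le_mul_of_nonneg_right ?_ dist_nonneg
    have : (max M 0 * p.2) ^ n ≤ (max M 0 * d) ^ n := by
      have := p.2.2.1
      gcongr
      exact p.2.2.2
    have h2 : (max M 0 * p.2) ^ n / n.factorial ≤ (max M 0 * d) ^ n / n.factorial := by gcongr
    simpa using h2.trans hn.le
  exact ⟨_, hc.isFixedPt_fixedPoint_iterate⟩

/-- Outside `[0, d]` the argument of the fixed point is clamped to the nearest end point. This gives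
a `C¹` extension to the whole line, on which the differential equation is not claimed. -/
theorem exists_linear_ode_solution (hd : 0 ≤ d) (hA : Continuous (Function.uncurry A)) (u₀ : E) :
    ∃ u u' : K → ℝ → E, Continuous (Function.uncurry u) ∧ Continuous (Function.uncurry u') ∧
      (∀ k τ, HasDerivAt (u k) (u' k τ) τ) ∧ (∀ k, u k 0 = u₀) ∧
      ∀ k, ∀ τ ∈ Icc 0 d, u' k τ = A k τ (u k τ) := by
  obtain ⟨v, hv⟩ := exists_picard_fixedPoint hd hA u₀
  have hc : Continuous fun p : K × ℝ => A p.1 p.2 (v (p.1, projIcc 0 d hd p.2)) := by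
    have h2 : Continuous fun p : K × ℝ => v (p.1, projIcc 0 d hd p.2) := by
      have := continuous_projIcc (h := hd)
      fun_prop
    exact hA.clm_apply h2
  refine ⟨fun k τ => u₀ + ∫ s in (0 : ℝ)..τ, A k s (v (k, projIcc 0 d hd s)),
    fun k τ => A k τ (v (k, projIcc 0 d hd τ)), continuous_picard hd hA u₀ v, hc,
    fun k τ => ?_, fun k => by simp, fun k τ hτ => ?_⟩
  · have hk : Continuous fun s : ℝ => A k s (v (k, projIcc 0 d hd s)) :=
      hc.comp (by fun_prop : Continuous fun s : ℝ => (k, s))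
    exact (intervalIntegral.integral_hasDerivAt_right (hk.intervalIntegrable _ _)
      (hk.stronglyMeasurableAtFilter _ _) hk.continuousAt).const_add u₀
  · simp only
    congr 1
    have h := congrArg (fun f : C(K × Icc 0 d, E) => f (k, ⟨τ, hτ⟩)) hv
    simp only [picard, ContinuousMap.coe_mk] at h
    rw [projIcc_of_mem hd hτ]
    exact h.symm

/-- The system for `(φ, φ')` as a first order equation. The derivative `φ'` and the second unknown
`ψ` are kept apart because they need agree only on `[0, d]`. -/
theorem exists_second_order_solution (hd : 0 ≤ d) {a : ℝ → ℝ} {Q : K → ℝ → ℝ} (ha : Continuous a)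
    (hQ : Continuous (Function.uncurry Q)) :
    ∃ φ φ' ψ ψ' : K → ℝ → ℝ, Continuous (Function.uncurry φ) ∧ Continuous (Function.uncurry φ') ∧
      Continuous (Function.uncurry ψ) ∧ Continuous (Function.uncurry ψ') ∧
      (∀ k τ, HasDerivAt (φ k) (φ' k τ) τ) ∧ (∀ k τ, HasDerivAt (ψ k) (ψ' k τ) τ) ∧
      (∀ k, φ k 0 = 1) ∧ (∀ k, ψ k 0 = 0) ∧
      (∀ k, ∀ τ ∈ Icc 0 d, φ' k τ = ψ k τ) ∧
      ∀ k, ∀ τ ∈ Icc 0 d, ψ' k τ = a τ * ψ k τ + Q k τ * φ k τ := by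
  set F := ContinuousLinearMap.fst ℝ ℝ ℝ
  set S := ContinuousLinearMap.snd ℝ ℝ ℝ
  have hA : Continuous (Function.uncurry fun (k : K) (τ : ℝ) =>
      S.prod (a τ • S + Q k τ • F)) := by
    have h1 : Continuous fun p : K × ℝ => a p.2 • S + Q p.1 p.2 • F :=
      ((ha.comp continuous_snd).smul continuous_const).add (hQ.smul continuous_const)
    have h2 : ∀ p : K × ℝ, S.prod (a p.2 • S + Q p.1 p.2 • F)
        = ContinuousLinearMap.inl ℝ ℝ ℝ ∘L S
          + ContinuousLinearMap.inr ℝ ℝ ℝ ∘L (a p.2 • S + Q p.1 p.2 • F) := fun p => by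
      ext <;> simp
    have h3 : (Function.uncurry fun (k : K) (τ : ℝ) => S.prod (a τ • S + Q k τ • F))
        = fun p : K × ℝ => ContinuousLinearMap.inl ℝ ℝ ℝ ∘L S
          + ContinuousLinearMap.inr ℝ ℝ ℝ ∘L (a p.2 • S + Q p.1 p.2 • F) := funext h2
    rw [h3]
    exact continuous_const.add (continuous_const.clm_comp h1)
  obtain ⟨u, u', hu, hu', hd', h0, hode⟩ := exists_linear_ode_solution hd hA ((1 : ℝ), (0 : ℝ))
  refine ⟨fun k τ => (u k τ).1, fun k τ => (u' k τ).1, fun k τ => (u k τ).2, fun k τ => (u' k τ).2,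
    continuous_fst.comp hu, continuous_fst.comp hu', continuous_snd.comp hu,
    continuous_snd.comp hu', fun k τ => F.hasFDerivAt.comp_hasDerivAt τ (hd' k τ),
    fun k τ => S.hasFDerivAt.comp_hasDerivAt τ (hd' k τ), fun k => by simp [h0],
    fun k => by simp [h0], fun k τ hτ => ?_, fun k τ hτ => ?_⟩
  · exact congrArg Prod.fst (hode k τ hτ)
  · exact congrArg Prod.snd (hode k τ hτ)

end LinearODE

end

section

/-! ### Functions on a compact interval, smooth up to the end points -/

section Interval
variable {E : Type*} [NormedAddCommGroup E] [NormedSpace ℝ E] {a b : ℝ}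

/-- On the closed interval `f` is `f a` plus the integral of the continuous function `f'`, and that
integral is differentiable also at the end points. -/
theorem hasDerivWithinAt_Icc_of_Ioo [CompleteSpace E] (hab : a ≤ b) {f f' : ℝ → E}
    (hf : ContinuousOn f (Icc a b))
    (hf' : ContinuousOn f' (Icc a b)) (h : ∀ y ∈ Ioo a b, HasDerivAt f (f' y) y) :
    ∀ y ∈ Icc a b, HasDerivWithinAt f (f' y) (Icc a b) y := by
  set G' : ℝ → E := fun y => f' (projIcc a b hab y) with hG'
  have hG'c : Continuous G' :=
    hf'.comp_continuous (continuous_subtype_val.comp continuous_projIcc) fun y => (projIcc a b hab y).2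
  have hG'e : ∀ y ∈ Icc a b, G' y = f' y := fun y hy => by simp [hG', projIcc_of_mem hab hy]
  have hG : ∀ y, HasDerivAt (fun y => f a + ∫ s in a..y, G' s) (G' y) y := fun y =>
    (intervalIntegral.integral_hasDerivAt_right (hG'c.intervalIntegrable _ _)
      (hG'c.stronglyMeasurableAtFilter _ _) hG'c.continuousAt).const_add _
  have he : ∀ y ∈ Icc a b, f y = f a + ∫ s in a..y, G' s := fun y hy => by
    rw [intervalIntegral.integral_eq_sub_of_hasDerivAt_of_le hy.1
      (hf.mono (Icc_subset_Icc_right hy.2)) (fun x hx => ?_) (hG'c.intervalIntegrable _ _)]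
    · abel
    · have hx' : x ∈ Ioo a b := ⟨hx.1, hx.2.trans_le hy.2⟩
      rw [hG'e x (Ioo_subset_Icc_self hx')]
      exact h x hx'
  intro y hy
  rw [← hG'e y hy]
  exact (hG y).hasDerivWithinAt.congr he (he y hy)

/-- If `f'` is as smooth as `f`, then `f` has one more derivative than `f`; induct. In the
applications `f'` is a smooth expression in `f`. -/
theorem contDiffOn_infty_of_bootstrap (hab : a < b) {f f' : ℝ → E}
    (h : ∀ y ∈ Icc a b, HasDerivWithinAt f (f' y) (Icc a b) y)
    (hb : ∀ n : ℕ, ContDiffOn ℝ n f (Icc a b) → ContDiffOn ℝ n f' (Icc a b)) :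
    ContDiffOn ℝ ∞ f (Icc a b) := by
  have hu := uniqueDiffOn_Icc hab
  have hd : ∀ y ∈ Icc a b, derivWithin f (Icc a b) y = f' y := fun y hy =>
    (h y hy).derivWithin (hu y hy)
  refine contDiffOn_infty.2 fun n => ?_
  induction n with
  | zero =>
    exact contDiffOn_zero.2 fun y hy => (h y hy).continuousWithinAt
  | succ n ih =>
    push_cast
    rw [contDiffOn_succ_iff_derivWithin hu]
    refine ⟨fun y hy => (h y hy).differentiableWithinAt, by simp, ?_⟩
    exact (hb n ih).congr hd

theorem iteratedDerivWithin_succ_eq (hab : a < b) {f f' : ℝ → E}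
    (h : ∀ y ∈ Icc a b, HasDerivWithinAt f (f' y) (Icc a b) y) (n : ℕ) {y : ℝ} (hy : y ∈ Icc a b) :
    iteratedDerivWithin (n + 1) f (Icc a b) y = iteratedDerivWithin n f' (Icc a b) y := by
  rw [iteratedDerivWithin_succ']
  exact iteratedDerivWithin_congr (fun y hy => (h y hy).derivWithin (uniqueDiffOn_Icc hab y hy)) hy

theorem hasDerivAt_iteratedDerivWithin {f : ℝ → E} (hab : a < b)
    (hf : ContDiffOn ℝ ∞ f (Icc a b)) (n : ℕ) {y : ℝ} (hy : y ∈ Ioo a b) :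
    HasDerivAt (iteratedDerivWithin n f (Icc a b)) (iteratedDerivWithin (n + 1) f (Icc a b) y) y := by
  have h1 := hf.differentiableOn_iteratedDerivWithin (m := n) (by exact_mod_cast ENat.natCast_lt_top n)
    (uniqueDiffOn_Icc hab)
  have h2 := ((h1 y (Ioo_subset_Icc_self hy)).hasDerivWithinAt).hasDerivAt (Icc_mem_nhds hy.1 hy.2)
  rwa [← iteratedDerivWithin_succ] at h2

theorem exists_bound_iteratedDerivWithin (hab : a < b) {f : ℝ → ℝ}
    (hf : ContDiffOn ℝ ∞ f (Icc a b)) (n : ℕ) :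
    ∃ C : ℝ, 0 ≤ C ∧ ∀ i ≤ n, ∀ y ∈ Icc a b, |iteratedDerivWithin i f (Icc a b) y| ≤ C := by
  induction n with
  | zero =>
    obtain ⟨C, hC⟩ := isCompact_Icc.exists_bound_of_continuousOn
      (hf.continuousOn_iteratedDerivWithin (m := 0) (by simp) (uniqueDiffOn_Icc hab))
    refine ⟨max C 0, le_max_right _ _, fun i hi y hy => ?_⟩
    obtain rfl := Nat.le_zero.1 hi
    exact (hC y hy).trans (le_max_left _ _)
  | succ n ih =>
    obtain ⟨C', hC0', hC'⟩ := ih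
    obtain ⟨C, hC⟩ := isCompact_Icc.exists_bound_of_continuousOn
      (hf.continuousOn_iteratedDerivWithin (m := (n + 1 : ℕ)) (by exact_mod_cast le_top)
        (uniqueDiffOn_Icc hab))
    refine ⟨max C C', hC0'.trans (le_max_right _ _), fun i hi y hy => ?_⟩
    rcases Nat.le_succ_iff.1 hi with h | rfl
    · exact (hC' i h y hy).trans (le_max_right _ _)
    · exact (hC y hy).trans (le_max_left _ _)

/-- Leibniz' rule; the binomial coefficients sum to `2 ^ n`. -/
theorem abs_iteratedDerivWithin_mul_le (hab : a < b) {f g : ℝ → ℝ}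
    (hf : ContDiffOn ℝ ∞ f (Icc a b)) (hg : ContDiffOn ℝ ∞ g (Icc a b)) {n : ℕ} {y X Y : ℝ}
    (hy : y ∈ Icc a b) (hX : ∀ i ≤ n, |iteratedDerivWithin i f (Icc a b) y| ≤ X)
    (hY : ∀ i ≤ n, |iteratedDerivWithin i g (Icc a b) y| ≤ Y) :
    |iteratedDerivWithin n (fun y => f y * g y) (Icc a b) y| ≤ 2 ^ n * (X * Y) := by
  have hle : (n : ℕ∞ω) ≤ (∞ : ℕ∞ω) := by exact_mod_cast le_top
  have h := iteratedDerivWithin_mul (n := n) hy (uniqueDiffOn_Icc hab) ((hf y hy).of_le hle)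
    ((hg y hy).of_le hle)
  rw [show (fun y => f y * g y) = f * g from rfl, h]
  refine (Finset.abs_sum_le_sum_abs _ _).trans ?_
  have h2 : ∀ i ∈ Finset.range (n + 1), |(n.choose i : ℝ) * iteratedDerivWithin i f (Icc a b) y
      * iteratedDerivWithin (n - i) g (Icc a b) y| ≤ n.choose i * (X * Y) := by
    intro i hi
    rw [abs_mul, abs_mul, Nat.abs_cast, mul_assoc]
    have h3 := hX i (Nat.lt_succ_iff.1 (Finset.mem_range.1 hi))
    have h4 := hY (n - i) (Nat.sub_le _ _)
    have := (abs_nonneg _).trans h3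
    gcongr
  refine (Finset.sum_le_sum h2).trans (le_of_eq ?_)
  rw [← Finset.sum_mul]
  congr 1
  exact_mod_cast Nat.sum_range_choose n

/-- The solutions of `Φ' = Ψ`, `Ψ' = α Ψ + (s β + ν) Φ` are smooth up to the end points. -/
theorem contDiffOn_of_system (hab : a < b) {α β : ℝ → ℝ} (hα : ContDiffOn ℝ ∞ α (Icc a b))
    (hβ : ContDiffOn ℝ ∞ β (Icc a b)) {s ν : ℝ} {Φ Ψ : ℝ → ℝ}
    (h1 : ∀ y ∈ Icc a b, HasDerivWithinAt Φ (Ψ y) (Icc a b) y)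
    (h2 : ∀ y ∈ Icc a b, HasDerivWithinAt Ψ (α y * Ψ y + (s * β y + ν) * Φ y) (Icc a b) y) :
    ContDiffOn ℝ ∞ Φ (Icc a b) ∧ ContDiffOn ℝ ∞ Ψ (Icc a b) := by
  have h : ContDiffOn ℝ ∞ (fun y => (Φ y, Ψ y)) (Icc a b) := by
    -- The pair is bootstrapped as one function, since each component is the source of regularity
    -- for the other.
    refine contDiffOn_infty_of_bootstrap hab (fun y hy => (h1 y hy).prodMk (h2 y hy)) fun n hn => ?_
    have hΦ : ContDiffOn ℝ n Φ (Icc a b) := hn.fst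
    have hΨ : ContDiffOn ℝ n Ψ (Icc a b) := hn.snd
    have hle : (n : ℕ∞ω) ≤ (∞ : ℕ∞ω) := by exact_mod_cast le_top
    have hα' := hα.of_le hle
    have hβ' := hβ.of_le hle
    exact hΨ.prodMk ((hα'.mul hΨ).add (((contDiffOn_const.mul hβ').add contDiffOn_const).mul hΦ))
  exact ⟨h.fst, h.snd⟩

/-- The derivatives of the solutions grow polynomially in the parameters. -/
theorem exists_bound_of_system (hab : a < b) {α β : ℝ → ℝ} (hα : ContDiffOn ℝ ∞ α (Icc a b))
    (hβ : ContDiffOn ℝ ∞ β (Icc a b)) (n : ℕ) :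
    ∃ C : ℝ, 0 ≤ C ∧ ∀ B : ℝ, 1 ≤ B → ∀ s ν : ℝ, |s| ≤ B → |ν| ≤ B → ∀ Φ Ψ : ℝ → ℝ,
      (∀ y ∈ Icc a b, HasDerivWithinAt Φ (Ψ y) (Icc a b) y) →
      (∀ y ∈ Icc a b, HasDerivWithinAt Ψ (α y * Ψ y + (s * β y + ν) * Φ y) (Icc a b) y) →
      ∀ i ≤ n, ∀ y ∈ Icc a b,
        |iteratedDerivWithin i Φ (Icc a b) y| ≤ C * B ^ n * (|Φ y| + |Ψ y|) ∧
        |iteratedDerivWithin i Ψ (Icc a b) y| ≤ C * B ^ n * (|Φ y| + |Ψ y|) := by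
  induction n with
  | zero =>
    refine ⟨1, zero_le_one, fun B hB s ν _ _ Φ Ψ _ _ i hi y _ => ?_⟩
    obtain rfl := Nat.le_zero.1 hi
    simp
  | succ n ih =>
    obtain ⟨C, hC0, hC⟩ := ih
    obtain ⟨A, hA0, hA⟩ := exists_bound_iteratedDerivWithin hab hα n
    obtain ⟨A', hA0', hA'⟩ := exists_bound_iteratedDerivWithin hab hβ n
    -- The summands come from the terms `ν Φ`, `α Ψ` and `s β Φ` of `Ψ'`. A parameter `s` or `ν`
    -- costs one further power of `B`, and Leibniz' rule the factor `2 ^ n`. The values of `Φ`, `Ψ`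
    -- on the right remain those at the same height `y`.
    refine ⟨C + 2 ^ n * A * C + 2 ^ n * A' * C, by positivity,
      fun B hB s ν hs hν Φ Ψ h1 h2 i hi y hy => ?_⟩
    have hB0 : 0 ≤ B := zero_le_one.trans hB
    have hC' := hC B hB s ν hs hν Φ Ψ h1 h2
    obtain ⟨hΦ, hΨ⟩ := contDiffOn_of_system hab hα hβ h1 h2
    set S := |Φ y| + |Ψ y| with hS
    have hS0 : 0 ≤ S := by positivity
    have hBn : C * B ^ n * S ≤ C * B ^ (n + 1) * S := by
      gcongr
      exact Nat.le_succ n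
    have hbig : C * B ^ (n + 1) * S
        ≤ (C + 2 ^ n * A * C + 2 ^ n * A' * C) * B ^ (n + 1) * S := by
      gcongr
      have : 0 ≤ 2 ^ n * A * C + 2 ^ n * A' * C := by positivity
      linarith
    rcases Nat.le_succ_iff.1 hi with h | rfl
    · obtain ⟨e1, e2⟩ := hC' i h y hy
      exact ⟨(e1.trans hBn).trans hbig, (e2.trans hBn).trans hbig⟩
    · rw [iteratedDerivWithin_succ_eq hab h1 n hy, iteratedDerivWithin_succ_eq hab h2 n hy]
      refine ⟨((hC' n le_rfl y hy).2.trans hBn).trans hbig, ?_⟩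
      have hle : (n : ℕ∞ω) ≤ (∞ : ℕ∞ω) := by exact_mod_cast le_top
      have hu := uniqueDiffOn_Icc hab
      have c1 : ContDiffWithinAt ℝ n (fun y => α y * Ψ y) (Icc a b) y :=
        ((hα.mul hΨ).of_le hle) y hy
      have c2 : ContDiffWithinAt ℝ n (fun y => β y * Φ y) (Icc a b) y :=
        ((hβ.mul hΦ).of_le hle) y hy
      have c3 : ContDiffWithinAt ℝ n Φ (Icc a b) y := (hΦ.of_le hle) y hy
      have e : (fun y => α y * Ψ y + (s * β y + ν) * Φ y)
          = fun y => α y * Ψ y + (s * (β y * Φ y) + ν * Φ y) := by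
        ext y; ring
      rw [e, iteratedDerivWithin_fun_add hy hu c1 ((contDiffWithinAt_const.mul c2).add
        (contDiffWithinAt_const.mul c3)), iteratedDerivWithin_fun_add hy hu
        (contDiffWithinAt_const.mul c2) (contDiffWithinAt_const.mul c3),
        iteratedDerivWithin_const_mul hy hu _ c2, iteratedDerivWithin_const_mul hy hu _ c3]
      have b1 := abs_iteratedDerivWithin_mul_le hab hα hΨ hy (fun i hi => hA i hi y hy)
        fun i hi => (hC' i hi y hy).2
      have b2 := abs_iteratedDerivWithin_mul_le hab hβ hΦ hy (fun i hi => hA' i hi y hy)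
        fun i hi => (hC' i hi y hy).1
      have b3 := (hC' n le_rfl y hy).1
      have t1 : 2 ^ n * (A * (C * B ^ n * S)) ≤ 2 ^ n * (A * (C * B ^ (n + 1) * S)) := by gcongr
      have t2 : |s| * |iteratedDerivWithin n (fun y => β y * Φ y) (Icc a b) y|
          ≤ B * (2 ^ n * (A' * (C * B ^ n * S))) := by gcongr
      have t3 : |ν| * |iteratedDerivWithin n Φ (Icc a b) y| ≤ B * (C * B ^ n * S) := by gcongr
      have t := abs_add_three (iteratedDerivWithin n (fun y => α y * Ψ y) (Icc a b) y)
        (s * iteratedDerivWithin n (fun y => β y * Φ y) (Icc a b) y)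
        (ν * iteratedDerivWithin n Φ (Icc a b) y)
      rw [abs_mul s, abs_mul ν] at t
      rw [← add_assoc]
      calc _ ≤ _ := t
        _ ≤ 2 ^ n * (A * (C * B ^ (n + 1) * S)) + B * (2 ^ n * (A' * (C * B ^ n * S)))
            + B * (C * B ^ n * S) := add_le_add (add_le_add (b1.trans t1) t2) t3
        _ = _ := by ring

end Interval

end

section

/-! ### Growth of the solutions away from the wall -/

theorem monotoneOn_Icc_of_hasDerivAt {a b : ℝ} {f f' : ℝ → ℝ} (hf : ContinuousOn f (Icc a b))
    (h : ∀ y ∈ Ioo a b, HasDerivAt f (f' y) y) (h0 : ∀ y ∈ Ioo a b, 0 ≤ f' y) :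
    MonotoneOn f (Icc a b) := by
  refine monotoneOn_of_deriv_nonneg (convex_Icc a b) hf ?_ ?_
  · rw [interior_Icc]
    exact fun y hy => (h y hy).differentiableAt.differentiableWithinAt
  · rw [interior_Icc]
    intro y hy
    rw [(h y hy).deriv]
    exact h0 y hy

/-- The data of one layer, as functions of the distance `τ` to the wall: a density `ρ` with
`ρ' = -a ρ`, and the solution of `φ'' = a φ' + Q φ` with `φ = 1`, `φ' = 0` at the wall. -/
structure LayerSolution (d r₁ r₂ : ℝ) (ρ a Q φ ψ : ℝ → ℝ) : Prop where
  depth_pos : 0 < d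
  density_pos : 0 < r₁
  density_continuous : ContinuousOn ρ (Icc 0 d)
  density_deriv : ∀ τ ∈ Ioo 0 d, HasDerivAt ρ (-(a τ * ρ τ)) τ
  density_bounds : ∀ τ ∈ Icc 0 d, r₁ ≤ ρ τ ∧ ρ τ ≤ r₂
  continuous_φ : ContinuousOn φ (Icc 0 d)
  continuous_ψ : ContinuousOn ψ (Icc 0 d)
  deriv_φ : ∀ τ ∈ Ioo 0 d, HasDerivAt φ (ψ τ) τ
  deriv_ψ : ∀ τ ∈ Ioo 0 d, HasDerivAt ψ (a τ * ψ τ + Q τ * φ τ) τ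
  φ_wall : φ 0 = 1
  ψ_wall : ψ 0 = 0
  Q_nonneg : ∀ τ ∈ Icc 0 d, 0 ≤ Q τ

namespace LayerSolution
variable {d r₁ r₂ : ℝ} {ρ a Q φ ψ : ℝ → ℝ}

theorem flux_deriv (h : LayerSolution d r₁ r₂ ρ a Q φ ψ) :
    ∀ τ ∈ Ioo 0 d, HasDerivAt (fun τ => ρ τ * ψ τ) (ρ τ * Q τ * φ τ) τ := fun τ hτ =>
  ((h.density_deriv τ hτ).mul (h.deriv_ψ τ hτ)).congr_deriv (by ring)

/-- The function `φ ρ ψ` vanishes at the wall and has the derivative `ρ (ψ² + Q φ²) ≥ 0`. -/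
theorem mul_nonneg (h : LayerSolution d r₁ r₂ ρ a Q φ ψ) : ∀ τ ∈ Icc 0 d, 0 ≤ φ τ * ψ τ := by
  have hm : MonotoneOn (fun τ => φ τ * (ρ τ * ψ τ)) (Icc 0 d) := by
    refine monotoneOn_Icc_of_hasDerivAt
      (h.continuous_φ.mul (h.density_continuous.mul h.continuous_ψ))
      (fun τ hτ => (h.deriv_φ τ hτ).mul (h.flux_deriv τ hτ)) fun τ hτ => ?_
    have hτ' := Ioo_subset_Icc_self hτ
    have h1 := h.density_pos.trans_le (h.density_bounds τ hτ').1
    have h2 := h.Q_nonneg τ hτ'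
    have e : ψ τ * (ρ τ * ψ τ) + φ τ * (ρ τ * Q τ * φ τ)
        = ρ τ * (ψ τ ^ 2 + Q τ * φ τ ^ 2) := by ring
    rw [e]
    positivity
  intro τ hτ
  have h0 := hm (left_mem_Icc.2 h.depth_pos.le) hτ hτ.1
  simp only [h.ψ_wall, mul_zero] at h0
  have h1 := h.density_pos.trans_le (h.density_bounds τ hτ).1
  have e : φ τ * (ρ τ * ψ τ) = ρ τ * (φ τ * ψ τ) := by ring
  rw [e] at h0
  exact nonneg_of_mul_nonneg_right h0 h1

/-- Since `(φ²)' = 2 φ ψ ≥ 0`, the square stays at least `1`; a change of sign would force a zero of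
`φ`. -/
theorem one_le_φ (h : LayerSolution d r₁ r₂ ρ a Q φ ψ) : ∀ τ ∈ Icc 0 d, 1 ≤ φ τ := by
  have hm : MonotoneOn (fun τ => φ τ * φ τ) (Icc 0 d) := by
    refine monotoneOn_Icc_of_hasDerivAt (h.continuous_φ.mul h.continuous_φ)
      (fun τ hτ => (h.deriv_φ τ hτ).mul (h.deriv_φ τ hτ)) fun τ hτ => ?_
    have := h.mul_nonneg τ (Ioo_subset_Icc_self hτ)
    linarith [mul_comm (φ τ) (ψ τ)]
  have hsq : ∀ τ ∈ Icc 0 d, 1 ≤ φ τ * φ τ := fun τ hτ => by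
    simpa [h.φ_wall] using hm (left_mem_Icc.2 h.depth_pos.le) hτ hτ.1
  intro τ hτ
  by_contra! hlt
  have hneg : φ τ ≤ 0 := by
    by_contra! hpos
    nlinarith [hsq τ hτ]
  obtain ⟨s, hs, hs0⟩ := intermediate_value_Icc' hτ.1
    (h.continuous_φ.mono (Icc_subset_Icc_right hτ.2))
    (show (0 : ℝ) ∈ Icc (φ τ) (φ 0) from ⟨hneg, by rw [h.φ_wall]; exact zero_le_one⟩)
  have := hsq s ⟨hs.1, hs.2.trans hτ.2⟩
  rw [hs0] at this
  norm_num at this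

theorem ψ_nonneg (h : LayerSolution d r₁ r₂ ρ a Q φ ψ) : ∀ τ ∈ Icc 0 d, 0 ≤ ψ τ := fun τ hτ =>
  nonneg_of_mul_nonneg_right (h.mul_nonneg τ hτ) (zero_lt_one.trans_le (h.one_le_φ τ hτ))

/-- The derivative of `(ρψ)² - c φ²` is `2 φ ψ (ρ² Q - c)`, whose sign is that of `ρ² Q - c`. The
factor `σ = ±1` serves both directions; this replaces an explicit exponential solution. -/
theorem sq_flux_sub_monotoneOn (h : LayerSolution d r₁ r₂ ρ a Q φ ψ) {c : ℝ} (σ : ℝ)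
    (hc : ∀ τ ∈ Ioo 0 d, 0 ≤ σ * (ρ τ ^ 2 * Q τ - c)) :
    MonotoneOn (fun τ => σ * ((ρ τ * ψ τ) * (ρ τ * ψ τ) - c * (φ τ * φ τ))) (Icc 0 d) := by
  have hP := h.density_continuous.mul h.continuous_ψ
  refine monotoneOn_Icc_of_hasDerivAt (continuousOn_const.mul
      ((hP.mul hP).sub (continuousOn_const.mul (h.continuous_φ.mul h.continuous_φ))))
    (fun τ hτ => (((h.flux_deriv τ hτ).mul (h.flux_deriv τ hτ)).sub
      (((h.deriv_φ τ hτ).mul (h.deriv_φ τ hτ)).const_mul c)).const_mul σ) fun τ hτ => ?_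
  have e : σ * (ρ τ * Q τ * φ τ * (ρ τ * ψ τ) + ρ τ * ψ τ * (ρ τ * Q τ * φ τ)
      - c * (ψ τ * φ τ + φ τ * ψ τ)) = 2 * (φ τ * ψ τ) * (σ * (ρ τ ^ 2 * Q τ - c)) := by ring
  rw [e]
  have := h.mul_nonneg τ (Ioo_subset_Icc_self hτ)
  have := hc τ hτ
  positivity

/-- With `c = r₂² q ≥ ρ² Q`, the quantity `(ρψ)² - c φ²` decreases from `-c`. -/
theorem sq_ψ_le (h : LayerSolution d r₁ r₂ ρ a Q φ ψ) {q : ℝ} (hq : ∀ τ ∈ Icc 0 d, Q τ ≤ q) :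
    r₁ ^ 2 * ψ d ^ 2 ≤ r₂ ^ 2 * q * φ d ^ 2 := by
  have hd := right_mem_Icc.2 h.depth_pos.le
  have hq0 : 0 ≤ q := (h.Q_nonneg d hd).trans (hq d hd)
  have hm := h.sq_flux_sub_monotoneOn (c := r₂ ^ 2 * q) (-1) fun τ hτ => by
    have hτ' := Ioo_subset_Icc_self hτ
    obtain ⟨h1, h2⟩ := h.density_bounds τ hτ'
    have h3 := h.density_pos
    have h4 : ρ τ ^ 2 * Q τ ≤ r₂ ^ 2 * q :=
      mul_le_mul (pow_le_pow_left₀ (by linarith) h2 2) (hq τ hτ') (h.Q_nonneg τ hτ') (by positivity)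
    linarith
  have h1 := hm (left_mem_Icc.2 h.depth_pos.le) hd h.depth_pos.le
  simp only [h.ψ_wall, h.φ_wall, mul_zero, mul_one] at h1
  have h2 : r₁ ^ 2 * ψ d ^ 2 ≤ (ρ d * ψ d) * (ρ d * ψ d) := by
    have := pow_le_pow_left₀ h.density_pos.le (h.density_bounds d hd).1 2
    nlinarith [sq_nonneg (ψ d)]
  have h3 : 0 ≤ r₂ ^ 2 * q := by positivity
  nlinarith

/-- With `c = r₁² ν ≤ ρ² Q` one gets `(ρψ)² ≥ c (φ² - 1)`. The `1` is absorbed once `φ` has reached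
`2` at the interface, which `hlarge` guarantees: the layer is thick compared with the vertical scale
`ν^(-1/2)`. -/
theorem le_sq_ψ (h : LayerSolution d r₁ r₂ ρ a Q φ ψ) {ν : ℝ} (hν : 0 ≤ ν)
    (hq : ∀ τ ∈ Icc 0 d, ν ≤ Q τ) (hlarge : 2 * r₂ ≤ r₁ * ν * d ^ 2) :
    r₁ ^ 2 * ν * φ d ^ 2 ≤ 2 * r₂ ^ 2 * ψ d ^ 2 := by
  have hd := right_mem_Icc.2 h.depth_pos.le
  have h0 := left_mem_Icc.2 h.depth_pos.le
  have hr1 := h.density_pos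
  have hr2 : 0 < r₂ := (hr1.trans_le (h.density_bounds d hd).1).trans_le (h.density_bounds d hd).2
  have hψ : ∀ τ ∈ Icc 0 d, r₁ * ν * τ ≤ r₂ * ψ τ := by
    have hm : MonotoneOn (fun τ => ρ τ * ψ τ - r₁ * ν * τ) (Icc 0 d) := by
      refine monotoneOn_Icc_of_hasDerivAt ((h.density_continuous.mul h.continuous_ψ).sub
        (by fun_prop)) (fun τ hτ => (h.flux_deriv τ hτ).sub
          ((hasDerivAt_id τ).const_mul (r₁ * ν))) fun τ hτ => ?_
      have hτ' := Ioo_subset_Icc_self hτ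
      have h1 := (h.density_bounds τ hτ').1
      have h2 : r₁ * ν ≤ ρ τ * Q τ := mul_le_mul h1 (hq τ hτ') hν (by linarith)
      have h3 : r₁ * ν * 1 ≤ ρ τ * Q τ * φ τ :=
        mul_le_mul h2 (h.one_le_φ τ hτ') zero_le_one (by nlinarith [h.Q_nonneg τ hτ'])
      linarith
    intro τ hτ
    have h1 := hm h0 hτ hτ.1
    simp only [h.ψ_wall, mul_zero, sub_zero] at h1
    have h2 := mul_le_mul_of_nonneg_right (h.density_bounds τ hτ).2 (h.ψ_nonneg τ hτ)
    linarith
  -- Integrating `r₂ ψ ≥ r₁ ν τ` once more gives `r₂ φ(d) ≥ r₂ + r₁ ν d² / 2`, and the last term is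
  -- at least `r₂`.
  have hφ : 2 ≤ φ d := by
    have hm : MonotoneOn (fun τ => r₂ * φ τ - r₁ * ν / 2 * τ ^ 2) (Icc 0 d) := by
      refine monotoneOn_Icc_of_hasDerivAt ((continuousOn_const.mul h.continuous_φ).sub
        (by fun_prop)) (fun τ hτ => ((h.deriv_φ τ hτ).const_mul r₂).sub
          ((hasDerivAt_pow 2 τ).const_mul (r₁ * ν / 2))) fun τ hτ => ?_
      have := hψ τ (Ioo_subset_Icc_self hτ)
      norm_num
      linarith
    have h1 := hm h0 hd h.depth_pos.le
    simp only [h.φ_wall] at h1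
    nlinarith
  have hm := h.sq_flux_sub_monotoneOn (c := r₁ ^ 2 * ν) 1 fun τ hτ => by
    have hτ' := Ioo_subset_Icc_self hτ
    have h1 := (h.density_bounds τ hτ').1
    have h4 : r₁ ^ 2 * ν ≤ ρ τ ^ 2 * Q τ :=
      mul_le_mul (pow_le_pow_left₀ hr1.le h1 2) (hq τ hτ') hν (by positivity)
    linarith
  have h1 := hm h0 hd h.depth_pos.le
  simp only [h.ψ_wall, h.φ_wall, mul_zero, mul_one, one_mul] at h1
  have h2 : (ρ d * ψ d) * (ρ d * ψ d) ≤ r₂ ^ 2 * ψ d ^ 2 := by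
    have h3 := h.density_bounds d hd
    have := pow_le_pow_left₀ (hr1.le.trans h3.1) h3.2 2
    nlinarith [sq_nonneg (ψ d)]
  have h3 : 0 ≤ r₁ ^ 2 * ν * (φ d ^ 2 - 2) := by
    have : 0 ≤ φ d ^ 2 - 2 := by nlinarith
    positivity
  nlinarith

end LayerSolution

/-! ### Measurable choice of a zero -/

/-- A continuous function which changes sign on an interval, for every value of a parameter, has a
zero depending measurably on the parameter. -/
theorem exists_measurable_zero {X : Type*} [TopologicalSpace X] [MeasurableSpace X]
    [OpensMeasurableSpace X] {D : X → ℝ → ℝ} (hD : Continuous (Function.uncurry D)) {A B : ℝ}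
    (hAB : A ≤ B) (hA : ∀ x, D x A < 0) (hB : ∀ x, 0 < D x B) :
    ∃ lam : X → ℝ, Measurable lam ∧ ∀ x, lam x ∈ Icc A B ∧ D x (lam x) = 0 := by
  -- The zero is the infimum of the places where `D` is positive. That it lies below `c` is
  -- witnessed by a rational number, so its sublevel sets are countable unions of open sets.
  set S : X → Set ℝ := fun x => {s | A ≤ s ∧ 0 < D x s} with hS
  have hne : ∀ x, (S x).Nonempty := fun x => ⟨B, hAB, hB x⟩
  have hbd : ∀ x, BddBelow (S x) := fun x => ⟨A, fun s hs => hs.1⟩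
  have hDx : ∀ x, Continuous (D x) := fun x => hD.comp (Continuous.prodMk_right x)
  refine ⟨fun x => sInf (S x), measurable_of_Iio fun c => ?_, fun x => ?_⟩
  · have e : (fun x => sInf (S x)) ⁻¹' Iio c
        = ⋃ q : ℚ, if A ≤ q ∧ (q : ℝ) < c then {x | 0 < D x q} else ∅ := by
      ext x
      simp only [mem_preimage, mem_Iio, mem_iUnion]
      constructor
      · intro h
        obtain ⟨s, hs, hsc⟩ := exists_lt_of_csInf_lt (hne x) h
        have hev : ∀ᶠ s' in nhds s, 0 < D x s' ∧ s' < c :=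
          ((hDx x).continuousAt.eventually (lt_mem_nhds hs.2)).and (gt_mem_nhds hsc)
        obtain ⟨u, hu, hsu⟩ := exists_Ico_subset_of_mem_nhds hev ⟨s + 1, by linarith⟩
        obtain ⟨q, hq1, hq2⟩ := exists_rat_btwn hu
        have hq := hsu ⟨hq1.le, hq2⟩
        refine ⟨q, ?_⟩
        rw [if_pos ⟨hs.1.trans hq1.le, hq.2⟩]
        exact hq.1
      · rintro ⟨q, hq⟩
        split_ifs at hq with hc
        · exact (csInf_le (hbd x) ⟨hc.1, hq⟩).trans_lt hc.2
        · exact hq.elim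
    rw [e]
    refine MeasurableSet.iUnion fun q => ?_
    split_ifs
    · exact (isOpen_lt continuous_const (hD.comp (Continuous.prodMk_left (q : ℝ)))).measurableSet
    · exact MeasurableSet.empty
  · have hmem : sInf (S x) ∈ Icc A B :=
      ⟨le_csInf (hne x) fun s hs => hs.1, csInf_le (hbd x) ⟨hAB, hB x⟩⟩
    refine ⟨hmem, le_antisymm ?_ ?_⟩
    -- Were `D` positive at the infimum, it would be positive slightly below it; the infimum is not
    -- `A`, where `D` is negative.
    · by_contra! hpos
      have hgt : A < sInf (S x) := lt_of_le_of_ne hmem.1 fun h => by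
        have := hA x
        rw [h] at this
        linarith
      have hev : ∀ᶠ s in nhds (sInf (S x)), 0 < D x s ∧ A < s :=
        ((hDx x).continuousAt.eventually (lt_mem_nhds hpos)).and (lt_mem_nhds hgt)
      obtain ⟨u, hu, hsu⟩ := exists_Ioc_subset_of_mem_nhds hev ⟨sInf (S x) - 1, by linarith⟩
      obtain ⟨v, hv1, hv2⟩ := exists_between hu
      have hv := hsu ⟨hv1, hv2.le⟩
      exact absurd (csInf_le (hbd x) ⟨hv.2.le, hv.1⟩) (not_le.2 hv2)
    · have hcl : sInf (S x) ∈ closure (S x) := csInf_mem_closure (hne x) (hbd x)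
      have hsub : closure (S x) ⊆ {s | 0 ≤ D x s} :=
        closure_minimal (fun s hs => hs.2.le) (isClosed_le continuous_const (hDx x))
      exact hsub hcl

end

section

/-! ### The steady state up to the boundary of the layers -/

/-- Monotonicity gives `p' ≥ 0`, and the bound on `1 / p'`, used on the degenerate interval `[z,
z]`, excludes zero. -/
theorem IsPressureLaw.deriv_pos {p : ℝ → ℝ} (hp : IsPressureLaw p) {z : ℝ} (hz : 0 < z) :
    0 < deriv p z := by
  obtain ⟨C, hC⟩ := hp.inv_deriv_locally_bounded z z hz le_rfl
  have h1 := hC z ⟨le_rfl, le_rfl⟩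
  have h2 : 0 ≤ deriv p z := by
    have h3 : 0 ≤ derivWithin p (Ioi 0) z := hp.strictMono.monotoneOn.derivWithin_nonneg
    rwa [derivWithin_of_isOpen isOpen_Ioi hz] at h3
  refine lt_of_le_of_ne h2 fun h => ?_
  rw [← h] at h1
  norm_num at h1

theorem IsPressureLaw.contDiffOn_deriv {p : ℝ → ℝ} (hp : IsPressureLaw p) :
    ContDiffOn ℝ ∞ (deriv p) (Ioi 0) :=
  ((contDiffOn_infty_iff_deriv_of_isOpen isOpen_Ioi).1 hp.smooth).2

/-- The square of the speed of sound, `p'(ρ₀)`. -/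
def soundSq (p ρ₀ : Layer → ℝ → ℝ) (s : Layer) (y : ℝ) : ℝ := deriv (p s) (ρ₀ s y)

/-- The height of the wall of a layer. -/
def Layer.wall (m l : ℝ) : Layer → ℝ
  | .lower => -m
  | .upper => l

/-- The vertical direction from the wall to the interface. -/
def Layer.sgn : Layer → ℝ
  | .lower => 1
  | .upper => -1

/-- The thickness of a layer. -/
def Layer.depth (m l : ℝ) : Layer → ℝ
  | .lower => m
  | .upper => l

namespace Layer
variable {m l : ℝ}

theorem sgn_mul_sgn (s : Layer) : s.sgn * s.sgn = 1 := by cases s <;> simp [sgn]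

theorem depth_pos (hm : 0 < m) (hl : 0 < l) (s : Layer) : 0 < s.depth m l := by
  cases s <;> simpa [depth]

theorem bot_lt_top (hm : 0 < m) (hl : 0 < l) (s : Layer) : s.bot m < s.top l := by
  cases s <;> simpa [bot, top]

theorem height_mem_closedInterval (s : Layer) {τ : ℝ} (hτ : τ ∈ Icc 0 (s.depth m l)) :
    s.wall m l + s.sgn * τ ∈ s.closedInterval m l := by
  cases s <;> simp [wall, sgn, depth, closedInterval, bot, top] at * <;> constructor <;> linarith

theorem height_mem_interval (s : Layer) {τ : ℝ} (hτ : τ ∈ Ioo 0 (s.depth m l)) :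
    s.wall m l + s.sgn * τ ∈ s.interval m l := by
  cases s <;> simp [wall, sgn, depth, interval, bot, top] at * <;> constructor <;> linarith

theorem distance_mem (s : Layer) {y : ℝ} (hy : y ∈ s.closedInterval m l) :
    s.sgn * (y - s.wall m l) ∈ Icc 0 (s.depth m l) := by
  cases s <;> simp [wall, sgn, depth, closedInterval, bot, top] at * <;> constructor <;> linarith

theorem wall_add_distance (s : Layer) (y : ℝ) :
    s.wall m l + s.sgn * (s.sgn * (y - s.wall m l)) = y := by
  rw [← mul_assoc, sgn_mul_sgn]; ring

theorem zero_mem_closedInterval (hm : 0 < m) (hl : 0 < l) (s : Layer) :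
    (0 : ℝ) ∈ s.closedInterval m l := by
  cases s <;> simp [closedInterval, bot, top, hm.le, hl.le]

end Layer

/-! ### Regularity of the steady density up to the walls and the interface. -/

namespace IsSteadyState
variable {g m l : ℝ} {p ρ₀ : Layer → ℝ → ℝ}

theorem pos (h : IsSteadyState g m l p ρ₀) (s : Layer) {y : ℝ} (hy : y ∈ s.closedInterval m l) :
    0 < ρ₀ s y := by
  obtain ⟨c, C, hc, hb⟩ := h.bounds
  exact hc.trans_le (hb s y hy).1

theorem soundSq_pos (h : IsSteadyState g m l p ρ₀) (hp : ∀ s, IsPressureLaw (p s)) (s : Layer)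
    {y : ℝ} (hy : y ∈ s.closedInterval m l) : 0 < soundSq p ρ₀ s y :=
  (hp s).deriv_pos (h.pos s hy)

theorem contDiffOn_soundSq_of (h : IsSteadyState g m l p ρ₀) (hp : ∀ s, IsPressureLaw (p s))
    (s : Layer) {n : ℕ∞} (hn : ContDiffOn ℝ n (ρ₀ s) (s.closedInterval m l)) :
    ContDiffOn ℝ n (soundSq p ρ₀ s) (s.closedInterval m l) :=
  ((hp s).contDiffOn_deriv.of_le (by exact_mod_cast le_top)).comp hn fun _ hy => h.pos s hy

/-- The chain rule in the hydrostatic equation, divided by `p'(ρ₀) > 0`. -/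
theorem hasDerivAt (h : IsSteadyState g m l p ρ₀) (hp : ∀ s, IsPressureLaw (p s)) (s : Layer)
    {y : ℝ} (hy : y ∈ s.interval m l) :
    HasDerivAt (ρ₀ s) (-(g / soundSq p ρ₀ s y * ρ₀ s y)) y := by
  have hy' : y ∈ s.closedInterval m l := Ioo_subset_Icc_self hy
  have h1 : HasDerivAt (ρ₀ s) (deriv (ρ₀ s) y) y :=
    (((h.smooth s).contDiffAt (isOpen_Ioo.mem_nhds hy)).differentiableAt (by simp)).hasDerivAt
  have h2 : HasDerivAt (p s) (deriv (p s) (ρ₀ s y)) (ρ₀ s y) :=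
    (((hp s).smooth.contDiffAt (isOpen_Ioi.mem_nhds (h.pos s hy'))).differentiableAt
      (by simp)).hasDerivAt
  have h3 := (h2.comp y h1).deriv
  have h4 := h.hydrostatic s y hy
  have h5 : deriv (p s ∘ ρ₀ s) y = -g * ρ₀ s y := h4
  have hc := h.soundSq_pos hp s hy'
  rw [h5] at h3
  have h6 : deriv (ρ₀ s) y = -(g / soundSq p ρ₀ s y * ρ₀ s y) := by
    have h7 : -g * ρ₀ s y = soundSq p ρ₀ s y * deriv (ρ₀ s) y := h3
    field_simp
    linarith
  rwa [h6] at h1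

theorem hasDerivWithinAt (h : IsSteadyState g m l p ρ₀) (hp : ∀ s, IsPressureLaw (p s))
    (hm : 0 < m) (hl : 0 < l) (s : Layer) {y : ℝ} (hy : y ∈ s.closedInterval m l) :
    HasDerivWithinAt (ρ₀ s) (-(g / soundSq p ρ₀ s y * ρ₀ s y)) (s.closedInterval m l) y := by
  have h0 : ContinuousOn (soundSq p ρ₀ s) (s.closedInterval m l) :=
    contDiffOn_zero.1 (h.contDiffOn_soundSq_of hp s (n := 0) (contDiffOn_zero.2 (h.continuousOn s)))
  exact hasDerivWithinAt_Icc_of_Ioo (s.bot_lt_top hm hl).le (h.continuousOn s)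
    (((continuousOn_const.div h0 fun y hy => (h.soundSq_pos hp s hy).ne').mul
      (h.continuousOn s)).neg) (fun y hy => h.hasDerivAt hp s hy) y hy

/-- The equation `ρ₀' = -g ρ₀ / p'(ρ₀)` has a right-hand side smooth in `ρ₀`. Hence mere continuity
at the end points improves to smoothness up to them. -/
theorem contDiffOn (h : IsSteadyState g m l p ρ₀) (hp : ∀ s, IsPressureLaw (p s))
    (hm : 0 < m) (hl : 0 < l) (s : Layer) : ContDiffOn ℝ ∞ (ρ₀ s) (s.closedInterval m l) := by
  refine contDiffOn_infty_of_bootstrap (s.bot_lt_top hm hl)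
    (fun y hy => h.hasDerivWithinAt hp hm hl s hy) fun n hn => ?_
  have h1 := h.contDiffOn_soundSq_of hp s (n := n) hn
  exact ((contDiffOn_const.div h1 fun y hy => (h.soundSq_pos hp s hy).ne').mul hn).neg

theorem contDiffOn_soundSq (h : IsSteadyState g m l p ρ₀) (hp : ∀ s, IsPressureLaw (p s))
    (hm : 0 < m) (hl : 0 < l) (s : Layer) :
    ContDiffOn ℝ ∞ (soundSq p ρ₀ s) (s.closedInterval m l) :=
  h.contDiffOn_soundSq_of hp s (n := ⊤) (h.contDiffOn hp hm hl s)

theorem exists_inv_soundSq_le (h : IsSteadyState g m l p ρ₀) (hp : ∀ s, IsPressureLaw (p s))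
    (hm : 0 < m) (hl : 0 < l) :
    ∃ b : ℝ, 0 < b ∧ ∀ s, ∀ y ∈ s.closedInterval m l, 1 / soundSq p ρ₀ s y ≤ b := by
  have h1 : ∀ s : Layer, ∃ C : ℝ, ∀ y ∈ s.closedInterval m l, ‖1 / soundSq p ρ₀ s y‖ ≤ C := fun s =>
    isCompact_Icc.exists_bound_of_continuousOn (continuousOn_const.div
      (h.contDiffOn_soundSq hp hm hl s).continuousOn fun y hy => (h.soundSq_pos hp s hy).ne')
  choose C hC using h1
  refine ⟨max 1 (max (C .lower) (C .upper)), lt_max_of_lt_left one_pos, fun s y hy => ?_⟩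
  refine ((le_abs_self _).trans (hC s y hy)).trans (le_max_of_le_right ?_)
  cases s
  · exact le_max_left _ _
  · exact le_max_right _ _

end IsSteadyState

end

section

/-! ### The dispersion relation -/

/-- The dispersion function of two layers with interface densities `ρ₊, ρ₋` and interface values
`φ±, ψ±` of the solutions issuing from the walls. -/
def dispersion (g ρp ρm lam φp ψp φm ψm : ℝ) : ℝ :=
  lam ^ 2 * (ρp * ψm * φp + ρm * ψp * φm) - g * (ρp - ρm) * (ψp * ψm)

/-- Replacing each `s φ` by the larger `ψ` gives `s D ≤ (λ² (ρ₊ + ρ₋) - g (ρ₊ - ρ₋) s) ψ₊ ψ₋`: for a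
slow rate the buoyancy term dominates. -/
theorem dispersion_neg {g ρp ρm lam φp ψp φm ψm s : ℝ} (hρp : 0 < ρp) (hρm : 0 < ρm)
    (hs : 0 < s) (hφp : 1 ≤ φp) (hφm : 1 ≤ φm) (hp : s * φp ≤ ψp) (hm : s * φm ≤ ψm)
    (h : lam ^ 2 * (ρp + ρm) < g * (ρp - ρm) * s) : dispersion g ρp ρm lam φp ψp φm ψm < 0 := by
  have hψp : 0 < ψp := by nlinarith
  have hψm : 0 < ψm := by nlinarith
  have h1 : ρp * ψm * (s * φp) ≤ ρp * ψm * ψp := by gcongr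
  have h2 : ρm * ψp * (s * φm) ≤ ρm * ψp * ψm := by gcongr
  have h3 : s * dispersion g ρp ρm lam φp ψp φm ψm
      = lam ^ 2 * (ρp * ψm * (s * φp) + ρm * ψp * (s * φm)) - g * (ρp - ρm) * s * (ψp * ψm) := by
    rw [dispersion]; ring
  have h4 : lam ^ 2 * (ρp * ψm * (s * φp) + ρm * ψp * (s * φm))
      ≤ lam ^ 2 * (ρp * ψm * ψp + ρm * ψp * ψm) := by gcongr
  have h5 := mul_lt_mul_of_pos_right h (mul_pos hψp hψm)
  have h6 : s * dispersion g ρp ρm lam φp ψp φm ψm < 0 := by rw [h3]; nlinarith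
  exact neg_of_mul_neg_right h6 hs.le

/-- The term with `ρ₋` is nonnegative and is dropped; what remains is `ψ₋ (λ² ρ₊ φ₊ - g (ρ₊ - ρ₋)
ψ₊)`. -/
theorem dispersion_pos {g ρp ρm lam φp ψp φm ψm c : ℝ} (hρm : 0 < ρm)
    (hg : 0 ≤ g * (ρp - ρm)) (hφp : 1 ≤ φp) (hφm : 1 ≤ φm) (hψp : 0 ≤ ψp) (hψm : 0 < ψm)
    (hc : ψp ≤ c * φp) (h : g * (ρp - ρm) * c < lam ^ 2 * ρp) :
    0 < dispersion g ρp ρm lam φp ψp φm ψm := by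
  have h1 : 0 ≤ lam ^ 2 * (ρm * ψp * φm) := by positivity
  have h2 : g * (ρp - ρm) * ψp ≤ g * (ρp - ρm) * (c * φp) := by gcongr
  have h3 : g * (ρp - ρm) * c * φp < lam ^ 2 * ρp * φp := by
    have : 0 < φp := by linarith
    gcongr
  have h4 : 0 < ψm * (lam ^ 2 * ρp * φp - g * (ρp - ρm) * ψp) := mul_pos hψm (by linarith)
  rw [dispersion]
  nlinarith

/-- The effective squared wave number `λ² r² / (λ² + 4 Ω²)` of a rotating fluid. -/
def waveNumberSq (Ω r lam : ℝ) : ℝ := lam ^ 2 * r ^ 2 / (lam ^ 2 + 4 * Ω ^ 2)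

theorem waveNumberSq_nonneg (Ω r lam : ℝ) : 0 ≤ waveNumberSq Ω r lam := by
  unfold waveNumberSq; positivity

theorem waveNumberSq_le {Ω r lam : ℝ} (h : 0 < lam) : waveNumberSq Ω r lam ≤ r ^ 2 := by
  unfold waveNumberSq
  rw [div_le_iff₀ (by positivity)]
  nlinarith [mul_nonneg (sq_nonneg r) (sq_nonneg Ω)]

/-- For rates above `2|Ω|` the rotation reduces the squared wave number by at most one half, so it
cannot suppress the instability of fast modes. -/
theorem le_waveNumberSq {Ω r lam : ℝ} (h0 : 0 < lam) (h : 4 * Ω ^ 2 ≤ lam ^ 2) :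
    r ^ 2 / 2 ≤ waveNumberSq Ω r lam := by
  unfold waveNumberSq
  rw [le_div_iff₀ (by positivity)]
  nlinarith [mul_le_mul_of_nonneg_left h (sq_nonneg r)]

theorem exists_continuous_extension {a b : ℝ} (hab : a ≤ b) {f : ℝ → ℝ}
    (hf : ContinuousOn f (Icc a b)) : ∃ f' : ℝ → ℝ, Continuous f' ∧ ∀ y ∈ Icc a b, f' y = f y :=
  ⟨fun y => f (projIcc a b hab y), hf.comp_continuous
    (continuous_subtype_val.comp continuous_projIcc) fun y => (projIcc a b hab y).2,
    fun y hy => by simp [projIcc_of_mem hab hy]⟩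

/-! ### Solutions issuing from the walls, and families of normal modes. -/

variable {g m l : ℝ} {p ρ₀ : Layer → ℝ → ℝ}

/-- Both layers are treated alike through the distance `τ` to the wall. Reversing the vertical
direction changes only the sign of the first order coefficient, which is the factor `s.sgn`. -/
theorem IsSteadyState.exists_layerSolution (h : IsSteadyState g m l p ρ₀)
    (hp : ∀ s, IsPressureLaw (p s)) (hm : 0 < m) (hl : 0 < l) {K : Type*} [TopologicalSpace K]
    [CompactSpace K] (s : Layer) {S N : K → ℝ} (hS : Continuous S) (hN : Continuous N)
    (hS0 : ∀ k, 0 ≤ S k) (hN0 : ∀ k, 0 ≤ N k) {r₁ r₂ : ℝ} (hr₁ : 0 < r₁)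
    (hb : ∀ y ∈ s.closedInterval m l, r₁ ≤ ρ₀ s y ∧ ρ₀ s y ≤ r₂) :
    ∃ φ φ' ψ ψ' : K → ℝ → ℝ, Continuous (Function.uncurry φ) ∧ Continuous (Function.uncurry φ') ∧
      Continuous (Function.uncurry ψ) ∧ Continuous (Function.uncurry ψ') ∧
      (∀ k τ, HasDerivAt (φ k) (φ' k τ) τ) ∧ (∀ k τ, HasDerivAt (ψ k) (ψ' k τ) τ) ∧
      (∀ k, ∀ τ ∈ Icc 0 (s.depth m l), φ' k τ = ψ k τ) ∧
      (∀ k, ∀ τ ∈ Icc 0 (s.depth m l), ψ' k τ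
        = s.sgn * (g / soundSq p ρ₀ s (s.wall m l + s.sgn * τ)) * ψ k τ
          + (S k * (1 / soundSq p ρ₀ s (s.wall m l + s.sgn * τ)) + N k) * φ k τ) ∧
      ∀ k, LayerSolution (s.depth m l) r₁ r₂ (fun τ => ρ₀ s (s.wall m l + s.sgn * τ))
        (fun τ => s.sgn * (g / soundSq p ρ₀ s (s.wall m l + s.sgn * τ)))
        (fun τ => S k * (1 / soundSq p ρ₀ s (s.wall m l + s.sgn * τ)) + N k) (φ k) (ψ k) := by
  have hc : ContinuousOn (fun y => 1 / soundSq p ρ₀ s y) (s.closedInterval m l) :=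
    continuousOn_const.div (h.contDiffOn_soundSq hp hm hl s).continuousOn
      fun y hy => (h.soundSq_pos hp s hy).ne'
  obtain ⟨κ, hκ, hκe⟩ := exists_continuous_extension (s.bot_lt_top hm hl).le hc
  have hκh : Continuous fun τ : ℝ => κ (s.wall m l + s.sgn * τ) := hκ.comp (by fun_prop)
  have hQ : Continuous (Function.uncurry fun (k : K) (τ : ℝ) =>
      S k * κ (s.wall m l + s.sgn * τ) + N k) := by
    have h1 : Continuous fun q : K × ℝ => κ (s.wall m l + s.sgn * q.2) := hκh.comp continuous_snd
    exact ((hS.comp continuous_fst).mul h1).add (hN.comp continuous_fst)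
  have hd := s.depth_pos hm hl
  obtain ⟨φ, φ', ψ, ψ', c1, c2, c3, c4, d1, d2, i1, i2, e1, e2⟩ :=
    exists_second_order_solution hd.le
      (a := fun τ => s.sgn * (g * κ (s.wall m l + s.sgn * τ))) (by fun_prop) hQ
  have hκ' : ∀ τ ∈ Icc 0 (s.depth m l), κ (s.wall m l + s.sgn * τ)
      = 1 / soundSq p ρ₀ s (s.wall m l + s.sgn * τ) := fun τ hτ =>
    hκe _ (s.height_mem_closedInterval hτ)
  have e2' : ∀ k, ∀ τ ∈ Icc 0 (s.depth m l), ψ' k τ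
        = s.sgn * (g / soundSq p ρ₀ s (s.wall m l + s.sgn * τ)) * ψ k τ
          + (S k * (1 / soundSq p ρ₀ s (s.wall m l + s.sgn * τ)) + N k) * φ k τ := fun k τ hτ => by
    rw [e2 k τ hτ, hκ' τ hτ]; ring
  refine ⟨φ, φ', ψ, ψ', c1, c2, c3, c4, d1, d2, e1, e2', fun k => ?_⟩
  constructor
  · exact hd
  · exact hr₁
  · exact (h.continuousOn s).comp (by fun_prop) fun τ hτ => s.height_mem_closedInterval hτ
  · intro τ hτ
    have h1 := h.hasDerivAt hp s (s.height_mem_interval hτ)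
    have h2 : HasDerivAt (fun τ : ℝ => s.wall m l + s.sgn * τ) s.sgn τ := by
      simpa using ((hasDerivAt_id τ).const_mul s.sgn).const_add (s.wall m l)
    exact (h1.comp τ h2).congr_deriv (by ring)
  · exact fun τ hτ => hb _ (s.height_mem_closedInterval hτ)
  · exact fun τ _ => (d1 k τ).continuousAt.continuousWithinAt
  · exact fun τ _ => (d2 k τ).continuousAt.continuousWithinAt
  · intro τ hτ
    rw [← e1 k τ (Ioo_subset_Icc_self hτ)]
    exact d1 k τ
  · intro τ hτ
    rw [← e2' k τ (Ioo_subset_Icc_self hτ)]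
    exact d2 k τ
  · exact i1 k
  · exact i2 k
  · intro τ hτ
    have := h.soundSq_pos hp s (s.height_mem_closedInterval hτ)
    have := hS0 k
    have := hN0 k
    positivity

/-- Functions of the wave number and the height which are measurable, continuous in the height, and
bounded for bounded heights. -/
structure IsProfile (f : ℝ → ℝ → ℝ) : Prop where
  measurable : Measurable (Function.uncurry f)
  continuous : ∀ r, Continuous (f r)
  bounded : ∀ Y : ℝ, ∃ C : ℝ, ∀ r y, |y| ≤ Y → |f r y| ≤ C

/-- A family of normal modes: for the wave numbers `r ∈ [R, R + 1]`, the growth rate is `lam r`,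
the potential is `Φ` and its vertical derivative is `Ψ`. Both are extended in a `C¹` manner to all
heights. -/
structure ModeFamily (g Ω m l : ℝ) (p ρ₀ : Layer → ℝ → ℝ) (L R : ℝ) (lam : ℝ → ℝ)
    (Φ Φ' Ψ Ψ' : Layer → ℝ → ℝ → ℝ) : Prop where
  measurable_lam : Measurable lam
  lam_mem : ∀ r, lam r ∈ Icc L (R + 1)
  profile_Φ : ∀ s, IsProfile (Φ s)
  profile_Φ' : ∀ s, IsProfile (Φ' s)
  profile_Ψ : ∀ s, IsProfile (Ψ s)
  profile_Ψ' : ∀ s, IsProfile (Ψ' s)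
  deriv_Φ : ∀ s r y, HasDerivAt (Φ s r) (Φ' s r y) y
  deriv_Ψ : ∀ s r y, HasDerivAt (Ψ s r) (Ψ' s r y) y
  Φ'_eq : ∀ s, ∀ r ∈ Icc R (R + 1), ∀ y ∈ s.closedInterval m l, Φ' s r y = Ψ s r y
  Ψ'_eq : ∀ s, ∀ r ∈ Icc R (R + 1), ∀ y ∈ s.closedInterval m l, Ψ' s r y
    = g / soundSq p ρ₀ s y * Ψ s r y
      + (lam r ^ 2 * (1 / soundSq p ρ₀ s y) + waveNumberSq Ω r (lam r)) * Φ s r y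
  wall : ∀ s, ∀ r ∈ Icc R (R + 1), Ψ s r (s.wall m l) = 0
  jump_Ψ : ∀ r ∈ Icc R (R + 1), Ψ .upper r 0 = Ψ .lower r 0
  jump_Φ : ∀ r ∈ Icc R (R + 1),
    ρ₀ .upper 0 * (Φ .upper r 0 + g / lam r ^ 2 * Ψ .upper r 0)
      = ρ₀ .lower 0 * (Φ .lower r 0 + g / lam r ^ 2 * Ψ .lower r 0)
  nontrivial : ∀ r ∈ Icc R (R + 1), 0 < Φ .lower r (-m)

/-- Compactness of `K × [-Y, Y]` supplies bounds uniform in the wave number, which enters only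
through the measurable map `k`. -/
theorem isProfile_of_continuous {K : Type*} [TopologicalSpace K] [CompactSpace K]
    [MeasurableSpace K] [BorelSpace K] [SecondCountableTopology K] {f : K → ℝ → ℝ}
    (hf : Continuous (Function.uncurry f)) {k : ℝ → K} (hk : Measurable k) :
    IsProfile fun r y => f (k r) y := by
  refine ⟨?_, fun r => hf.comp (Continuous.prodMk_right (k r)), fun Y => ?_⟩
  · exact hf.measurable.comp ((hk.comp measurable_fst).prodMk measurable_snd)
  · obtain ⟨C, hC⟩ := (isCompact_univ.prod isCompact_Icc : IsCompact ((univ : Set K) ×ˢ Icc (-Y) Y))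
      |>.exists_bound_of_continuousOn hf.continuousOn
    exact ⟨C, fun r y hy => hC (k r, y) ⟨mem_univ _, abs_le.1 hy⟩⟩

end

/-! ### Existence of growing normal modes -/

section

variable {g Ω m l : ℝ} {p ρ₀ : Layer → ℝ → ℝ}

/-- The square root of `le_sq_ψ` with `ν = R² / 2`, the lower bound for `Q` which survives the
rotation. -/
theorem LayerSolution.mul_φ_le_ψ {d r₁ r₂ : ℝ} {ρ a Q φ ψ : ℝ → ℝ}
    (h : LayerSolution d r₁ r₂ ρ a Q φ ψ) {R : ℝ}
    (hQ : ∀ τ ∈ Icc 0 d, R ^ 2 / 2 ≤ Q τ) (hlarge : 4 * r₂ ≤ r₁ * R ^ 2 * d ^ 2) :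
    r₁ * R / (2 * r₂) * φ d ≤ ψ d := by
  have hd := right_mem_Icc.2 h.depth_pos.le
  have hr1 := h.density_pos
  have hr2 : 0 < r₂ := (hr1.trans_le (h.density_bounds d hd).1).trans_le (h.density_bounds d hd).2
  have h1 := h.le_sq_ψ (ν := R ^ 2 / 2) (by positivity) hQ (by linarith)
  refine (le_abs_self _).trans (abs_le_of_sq_le_sq ?_ (h.ψ_nonneg d hd))
  have e : (r₁ * R / (2 * r₂) * φ d) ^ 2 = r₁ ^ 2 * (R ^ 2 / 2) * φ d ^ 2 / (2 * r₂ ^ 2) := by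
    field_simp
  rw [e, div_le_iff₀ (by positivity)]
  linarith

theorem LayerSolution.ψ_le_mul_φ {d r₁ r₂ : ℝ} {ρ a Q φ ψ : ℝ → ℝ}
    (h : LayerSolution d r₁ r₂ ρ a Q φ ψ) {c B : ℝ} (hc : 0 ≤ c) (hB : 0 ≤ B)
    (hQ : ∀ τ ∈ Icc 0 d, Q τ ≤ c ^ 2 * B ^ 2) : ψ d ≤ r₂ * c * B / r₁ * φ d := by
  have hd := right_mem_Icc.2 h.depth_pos.le
  have hr1 := h.density_pos
  have hr2 : 0 < r₂ := (hr1.trans_le (h.density_bounds d hd).1).trans_le (h.density_bounds d hd).2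
  have h1 := h.sq_ψ_le hQ
  have hφ := h.one_le_φ d hd
  refine (le_abs_self _).trans (abs_le_of_sq_le_sq ?_ (by positivity))
  have e : (r₂ * c * B / r₁ * φ d) ^ 2 = r₂ ^ 2 * (c ^ 2 * B ^ 2) * φ d ^ 2 / r₁ ^ 2 := by
    field_simp
  rw [e, le_div_iff₀ (by positivity)]
  linarith

/-- At `λ = L` the ratio `ψ / φ` is at least a multiple of `R = γ L²` and beats `L²`. At `λ = R + 1`
it is at most a multiple of `R + 1` and loses against `(R + 1)²`. The dispersion function changes
sign between them, so some rate in between gives matching wall solutions. -/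
theorem exists_modeFamily (hg : 0 < g) (hm : 0 < m) (hl : 0 < l)
    (hp : ∀ s, IsPressureLaw (p s)) (h : IsSteadyState g m l p ρ₀) (Ω : ℝ) :
    ∃ γ : ℝ, 1 ≤ γ ∧ ∀ᶠ L : ℝ in Filter.atTop, ∃ (lam : ℝ → ℝ) (Φ Φ' Ψ Ψ' : Layer → ℝ → ℝ → ℝ),
      ModeFamily g Ω m l p ρ₀ L (γ * L ^ 2) lam Φ Φ' Ψ Ψ' := by
  obtain ⟨r₁, r₂, hr₁, hb⟩ := h.bounds
  obtain ⟨b, hb0, hbc⟩ := h.exists_inv_soundSq_le hp hm hl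
  set ρp := ρ₀ .upper 0 with hρp
  set ρm := ρ₀ .lower 0 with hρm
  have hρp0 : 0 < ρp := h.pos _ (Layer.zero_mem_closedInterval hm hl _)
  have hρm0 : 0 < ρm := h.pos _ (Layer.zero_mem_closedInterval hm hl _)
  have hr₂ : 0 < r₂ := hρp0.trans_le (hb _ _ (Layer.zero_mem_closedInterval hm hl .upper)).2
  have hΔ : 0 < g * (ρp - ρm) := mul_pos hg h.density_jump
  -- Chosen so that `s = r₁ R / (2 r₂)` with `R = γ L²` satisfies `g (ρ₊ - ρ₋) s > L² (ρ₊ + ρ₋)`, as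
  -- `dispersion_neg` requires at `λ = L`. The summand `1` makes this strict.
  set γ := 1 + 2 * r₂ * (ρp + ρm) / (g * (ρp - ρm) * r₁) with hγ
  have hγ1 : 1 ≤ γ := by
    rw [hγ]
    have : 0 < 2 * r₂ * (ρp + ρm) / (g * (ρp - ρm) * r₁) := by positivity
    linarith
  refine ⟨γ, hγ1, ?_⟩
  -- On the parameter range `Q ≤ b B² + B² ≤ c² B²` with `B = R + 1`; the square is what
  -- `ψ_le_mul_φ` expects.
  set c := b + 1 with hc
  have hcc : ∀ {B : ℝ}, b * B ^ 2 + B ^ 2 ≤ c ^ 2 * B ^ 2 := by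
    intro B
    have : b + 1 ≤ c ^ 2 := by rw [hc]; nlinarith
    nlinarith [mul_le_mul_of_nonneg_right this (sq_nonneg B)]
  -- In order: `L ≥ 1` and `L ≥ 4Ω²` give `4Ω² ≤ L² ≤ λ²`; the next two make both layers thick
  -- enough for the lower bound on `ψ`; the last gives positivity of the dispersion function at `λ =
  -- R + 1`.
  filter_upwards [Filter.eventually_ge_atTop 1, Filter.eventually_ge_atTop (4 * Ω ^ 2),
    Filter.eventually_ge_atTop (4 * r₂ / (r₁ * m ^ 2)),
    Filter.eventually_ge_atTop (4 * r₂ / (r₁ * l ^ 2)),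
    Filter.eventually_gt_atTop (g * (ρp - ρm) * (r₂ * c / r₁) / ρp)] with L hL1 hLΩ hLm hLl hLc
  have hL0 : 0 < L := by linarith
  set R := γ * L ^ 2 with hR
  have hRL : L ≤ R := by rw [hR]; nlinarith
  have hR0 : 0 < R := by linarith
  have hRR : R ≤ R + 1 := by linarith
  have hLB : L ≤ R + 1 := by linarith
  let K := Icc R (R + 1) × Icc L (R + 1)
  have hk1 : ∀ k : K, R ≤ k.1 ∧ (k.1 : ℝ) ≤ R + 1 := fun k => k.1.2
  have hk2 : ∀ k : K, L ≤ k.2 ∧ (k.2 : ℝ) ≤ R + 1 := fun k => k.2.2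
  let S : K → ℝ := fun k => (k.2 : ℝ) ^ 2
  let N : K → ℝ := fun k => waveNumberSq Ω k.1 k.2
  have hv1 : Continuous fun k : K => (k.1 : ℝ) := continuous_subtype_val.comp continuous_fst
  have hv2 : Continuous fun k : K => (k.2 : ℝ) := continuous_subtype_val.comp continuous_snd
  have hS : Continuous S := hv2.pow 2
  have hN : Continuous N := by
    refine ((hv2.pow 2).mul (hv1.pow 2)).div ((hv2.pow 2).add continuous_const) fun k => ?_
    have := (hk2 k).1
    have : 0 < (k.2 : ℝ) := by linarith
    positivity
  have hS0 : ∀ k, 0 ≤ S k := fun k => sq_nonneg _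
  have hN0 : ∀ k, 0 ≤ N k := fun k => waveNumberSq_nonneg _ _ _
  have hex := fun s => h.exists_layerSolution hp hm hl s hS hN hS0 hN0 hr₁ (hb s)
  choose φ φ' ψ ψ' c1 c2 c3 c4 d1 d2 e1 e2 hsol using hex
  have hdepth : ∀ s : Layer, 4 * r₂ ≤ r₁ * R ^ 2 * s.depth m l ^ 2 := by
    intro s
    have h1 : ∀ d : ℝ, 0 < d → 4 * r₂ / (r₁ * d ^ 2) ≤ L → 4 * r₂ ≤ r₁ * R ^ 2 * d ^ 2 := by
      intro d hd hLd
      rw [div_le_iff₀ (by positivity)] at hLd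
      have h2 : L ≤ R ^ 2 := by nlinarith
      have h3 : L * (r₁ * d ^ 2) ≤ R ^ 2 * (r₁ * d ^ 2) := by gcongr
      linarith
    cases s
    · exact h1 m hm hLm
    · exact h1 l hl hLl
  have hQlow : ∀ s (k : K), ∀ τ ∈ Icc 0 (s.depth m l),
      R ^ 2 / 2 ≤ S k * (1 / soundSq p ρ₀ s (s.wall m l + s.sgn * τ)) + N k := by
    intro s k τ hτ
    have h0 := h.soundSq_pos hp s (s.height_mem_closedInterval hτ)
    have h1 : 0 ≤ S k * (1 / soundSq p ρ₀ s (s.wall m l + s.sgn * τ)) := by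
      have := hS0 k
      positivity
    have h2 : 4 * Ω ^ 2 ≤ (k.2 : ℝ) ^ 2 := by nlinarith [(hk2 k).1]
    have h3 := le_waveNumberSq (r := k.1) (lt_of_lt_of_le hL0 (hk2 k).1) h2
    have h4 : R ^ 2 ≤ (k.1 : ℝ) ^ 2 := pow_le_pow_left₀ hR0.le (hk1 k).1 2
    have h5 : waveNumberSq Ω k.1 k.2 = N k := rfl
    linarith
  have hlow : ∀ s (k : K), r₁ * R / (2 * r₂) * φ s k (s.depth m l) ≤ ψ s k (s.depth m l) :=
    fun s k => (hsol s k).mul_φ_le_ψ (hQlow s k) (hdepth s)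
  have hdm : ∀ s : Layer, s.depth m l ∈ Icc 0 (s.depth m l) := fun s =>
    right_mem_Icc.2 (s.depth_pos hm hl).le
  have hφ1 : ∀ s (k : K), 1 ≤ φ s k (s.depth m l) := fun s k => (hsol s k).one_le_φ _ (hdm s)
  have hψ0 : ∀ s (k : K), 0 < ψ s k (s.depth m l) := fun s k => by
    have h1 : 0 < r₁ * R / (2 * r₂) * φ s k (s.depth m l) :=
      mul_pos (by positivity) (zero_lt_one.trans_le (hφ1 s k))
    exact h1.trans_le (hlow s k)
  -- Clamping the rate to `[L, R + 1]` keeps the parameter in the compact set `K`, yet makes `D`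
  -- continuous on the whole line.
  let D : Icc R (R + 1) → ℝ → ℝ := fun x lam =>
    dispersion g ρp ρm (projIcc L (R + 1) hLB lam)
      (φ .upper (x, projIcc L (R + 1) hLB lam) (Layer.upper.depth m l))
      (ψ .upper (x, projIcc L (R + 1) hLB lam) (Layer.upper.depth m l))
      (φ .lower (x, projIcc L (R + 1) hLB lam) (Layer.lower.depth m l))
      (ψ .lower (x, projIcc L (R + 1) hLB lam) (Layer.lower.depth m l))
  have hcv : ∀ (f : K → ℝ → ℝ) (d : ℝ), Continuous (Function.uncurry f) →
      Continuous fun k => f k d := fun f d hf => hf.comp (Continuous.prodMk_left d)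
  have hDc : Continuous (Function.uncurry D) := by
    have hkc : Continuous fun q : Icc R (R + 1) × ℝ => ((q.1, projIcc L (R + 1) hLB q.2) : K) :=
      continuous_fst.prodMk (continuous_projIcc.comp continuous_snd)
    have h1 := (hcv _ (Layer.upper.depth m l) (c1 .upper)).comp hkc
    have h2 := (hcv _ (Layer.upper.depth m l) (c3 .upper)).comp hkc
    have h3 := (hcv _ (Layer.lower.depth m l) (c1 .lower)).comp hkc
    have h4 := (hcv _ (Layer.lower.depth m l) (c3 .lower)).comp hkc
    have h5 : Continuous fun q : Icc R (R + 1) × ℝ => ((projIcc L (R + 1) hLB q.2 : ℝ)) :=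
      continuous_subtype_val.comp (continuous_projIcc.comp continuous_snd)
    exact ((h5.pow 2).mul (((continuous_const.mul h4).mul h1).add
      ((continuous_const.mul h2).mul h3))).sub (continuous_const.mul (h2.mul h4))
  have hneg : ∀ x, D x L < 0 := fun x => by
    refine dispersion_neg (s := r₁ * R / (2 * r₂)) hρp0 hρm0 (by positivity) (hφ1 _ _) (hφ1 _ _)
      (hlow _ _) (hlow _ _) ?_
    rw [projIcc_left]
    have e : g * (ρp - ρm) * (r₁ * R / (2 * r₂))
        = L ^ 2 * (g * (ρp - ρm) * r₁ / (2 * r₂) + (ρp + ρm)) := by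
      rw [hR, hγ]
      have : g * (ρp - ρm) * r₁ ≠ 0 := by positivity
      have h2 : g ≠ 0 := hg.ne'
      have h3 : ρp - ρm ≠ 0 := h.density_jump.ne'
      field_simp
    rw [e]
    have : 0 < g * (ρp - ρm) * r₁ / (2 * r₂) := by positivity
    exact mul_lt_mul_of_pos_left (by linarith) (by positivity)
  have hpos : ∀ x, 0 < D x (R + 1) := fun x => by
    set k : K := (x, projIcc L (R + 1) hLB (R + 1)) with hk
    have hkB : (k.2 : ℝ) = R + 1 := by simp [hk]
    refine dispersion_pos (c := r₂ * c * (R + 1) / r₁) hρm0 hΔ.le (hφ1 _ _) (hφ1 _ _)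
      (hψ0 _ _).le (hψ0 _ _) ((hsol .upper k).ψ_le_mul_φ (by positivity) (by positivity) ?_) ?_
    · intro τ hτ
      have h0 := hbc .upper _ (Layer.upper.height_mem_closedInterval hτ)
      have h1 : S k * (1 / soundSq p ρ₀ .upper (Layer.upper.wall m l + Layer.upper.sgn * τ))
          ≤ (R + 1) ^ 2 * b := by
        have : S k = (R + 1) ^ 2 := by simp only [S, hkB]
        rw [this]
        gcongr
      have h2 : N k ≤ (R + 1) ^ 2 :=
        (waveNumberSq_le (hL0.trans_le (hk2 k).1)).trans
          (pow_le_pow_left₀ (hR0.le.trans (hk1 k).1) (hk1 k).2 2)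
      have := hcc (B := R + 1)
      linarith
    · rw [projIcc_right]
      rw [div_lt_iff₀ hρp0] at hLc
      have h1 : L * ρp ≤ (R + 1) * ρp := by gcongr
      have h2 : g * (ρp - ρm) * (r₂ * c / r₁) * (R + 1) < (R + 1) * ρp * (R + 1) :=
        mul_lt_mul_of_pos_right (hLc.trans_le h1) (by linarith)
      calc g * (ρp - ρm) * (r₂ * c * (R + 1) / r₁)
          = g * (ρp - ρm) * (r₂ * c / r₁) * (R + 1) := by ring
        _ < (R + 1) * ρp * (R + 1) := h2
        _ = (R + 1) ^ 2 * ρp := by ring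
  obtain ⟨lam₀, hlm, hl0⟩ := exists_measurable_zero hDc hLB hneg hpos
  -- Extended to all wave numbers by clamping, so that `L ≤ lam r ≤ R + 1` holds without
  -- restriction.
  let lam : ℝ → ℝ := fun r => lam₀ (projIcc R (R + 1) hRR r)
  have hlamm : Measurable lam := hlm.comp continuous_projIcc.measurable
  have hlam : ∀ r, lam r ∈ Icc L (R + 1) := fun r => (hl0 _).1
  let k : ℝ → K := fun r => (projIcc R (R + 1) hRR r, projIcc L (R + 1) hLB (lam r))
  have hkm : Measurable k :=
    continuous_projIcc.measurable.prodMk (continuous_projIcc.measurable.comp hlamm)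
  have hk2' : ∀ r, ((k r).2 : ℝ) = lam r := fun r => by simp [k, projIcc_of_mem hLB (hlam r)]
  have hk1' : ∀ r ∈ Icc R (R + 1), ((k r).1 : ℝ) = r := fun r hr => by
    simp [k, projIcc_of_mem hRR hr]
  have hDk : ∀ r, dispersion g ρp ρm (lam r)
      (φ .upper (k r) (Layer.upper.depth m l)) (ψ .upper (k r) (Layer.upper.depth m l))
      (φ .lower (k r) (Layer.lower.depth m l)) (ψ .lower (k r) (Layer.lower.depth m l)) = 0 := by
    intro r
    have h1 := (hl0 (projIcc R (R + 1) hRR r)).2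
    rw [← hk2' r]
    exact h1
  -- Crosswise weights: both interface values of `Ψ` become `ψ₊ ψ₋`, so the velocity condition is
  -- automatic, and the pressure condition becomes the vanishing of the dispersion function up to
  -- the factor `-λ⁻²`.
  let A : Layer → K → ℝ := fun s k => match s with
    | .lower => ψ .upper k (Layer.upper.depth m l)
    | .upper => -ψ .lower k (Layer.lower.depth m l)
  have hA : ∀ s, Continuous (A s) := fun s => by
    cases s
    · exact hcv _ _ (c3 .upper)
    · exact (hcv _ _ (c3 .lower)).neg
  let τ : Layer → ℝ → ℝ := fun s y => s.sgn * (y - s.wall m l)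
  have hτc : ∀ s, Continuous (τ s) := fun s => by fun_prop
  have hτd : ∀ s y, HasDerivAt (τ s) s.sgn y := fun s y => by
    simpa using ((hasDerivAt_id y).sub_const (s.wall m l)).const_mul s.sgn
  have hprof : ∀ s (a : ℝ) (f : K → ℝ → ℝ), Continuous (Function.uncurry f) →
      IsProfile fun r y => A s (k r) * (a * f (k r) (τ s y)) := by
    intro s a f hf
    refine isProfile_of_continuous (f := fun k y => A s k * (a * f k (τ s y))) ?_ hkm
    have h1 : Continuous fun q : K × ℝ => f q.1 (τ s q.2) :=
      hf.comp (continuous_fst.prodMk ((hτc s).comp continuous_snd))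
    exact ((hA s).comp continuous_fst).mul (continuous_const.mul h1)
  have hτ0 : ∀ s : Layer, τ s 0 = s.depth m l := fun s => by
    cases s <;> simp [τ, Layer.sgn, Layer.wall, Layer.depth]
  refine ⟨lam, fun s r y => A s (k r) * (1 * φ s (k r) (τ s y)),
    fun s r y => A s (k r) * (s.sgn * φ' s (k r) (τ s y)),
    fun s r y => A s (k r) * (s.sgn * ψ s (k r) (τ s y)),
    fun s r y => A s (k r) * (1 * ψ' s (k r) (τ s y)), ?_⟩
  constructor
  · exact hlamm
  · exact hlam
  · exact fun s => hprof s 1 _ (c1 s)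
  · exact fun s => hprof s _ _ (c2 s)
  · exact fun s => hprof s _ _ (c3 s)
  · exact fun s => hprof s 1 _ (c4 s)
  · intro s r y
    have h1 := ((d1 s (k r) (τ s y)).comp y (hτd s y)).const_mul (A s (k r))
    refine (h1.congr_of_eventuallyEq (Filter.Eventually.of_forall fun y => ?_)).congr_deriv (by ring)
    simp
  · intro s r y
    have h1 := (((d2 s (k r) (τ s y)).comp y (hτd s y)).const_mul s.sgn).const_mul (A s (k r))
    refine h1.congr_deriv ?_
    have := s.sgn_mul_sgn
    linear_combination A s (k r) * ψ' s (k r) (τ s y) * this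
  · intro s r hr y hy
    rw [e1 s (k r) (τ s y) (s.distance_mem hy)]
  · intro s r hr y hy
    rw [e2 s (k r) (τ s y) (s.distance_mem hy)]
    have h1 : s.wall m l + s.sgn * τ s y = y := s.wall_add_distance y
    have h2 : S (k r) = lam r ^ 2 := by simp only [S, hk2']
    have h3 : N (k r) = waveNumberSq Ω r (lam r) := by simp only [N, hk2', hk1' r hr]
    rw [h1, h2, h3]
    ring
  · intro s r hr
    have h1 : τ s (s.wall m l) = 0 := by simp [τ]
    simp only [h1, (hsol s (k r)).ψ_wall, mul_zero]
  · intro r hr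
    simp only [hτ0, A, Layer.sgn]
    ring
  · intro r hr
    have h1 := hDk r
    have h2 : lam r ≠ 0 := (hL0.trans_le (hlam r).1).ne'
    simp only [hτ0, A, Layer.sgn]
    rw [dispersion] at h1
    rw [← hρp, ← hρm]
    field_simp
    linear_combination -h1
  · intro r hr
    have h1 : τ .lower (-m) = 0 := by simp [τ, Layer.wall]
    simp only [h1, (hsol .lower (k r)).φ_wall, A]
    have := hψ0 .upper (k r)
    linarith

end

section

/-! ### Amplitudes of the normal modes -/

/-- Measurable bounded functions of the horizontal frequency, with support in a ball. -/
structure IsCoefficient (R : ℝ) (z : Plane → ℂ) : Prop where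
  measurable : Measurable z
  support : ∀ ξ, R < ‖ξ‖ → z ξ = 0
  bounded : ∃ C : ℝ, ∀ ξ, ‖z ξ‖ ≤ C

theorem IsCoefficient.isAmplitude {R : ℝ} {z : Plane → ℂ} (hz : IsCoefficient R z)
    {h : ℝ → ℝ → ℝ} (hh : IsProfile h) : IsAmplitude R fun ξ y => z ξ * (h ‖ξ‖ y : ℂ) := by
  refine ⟨fun y => ?_, fun ξ => ?_, fun ξ y hξ => by rw [hz.support ξ hξ, zero_mul], fun Y => ?_⟩
  · have h1 : Measurable fun ξ : Plane => h ‖ξ‖ y :=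
      hh.measurable.comp (measurable_norm.prodMk measurable_const)
    exact hz.measurable.mul (Complex.measurable_ofReal.comp h1)
  · exact continuous_const.mul (Complex.continuous_ofReal.comp (hh.continuous _))
  · obtain ⟨C, hC⟩ := hz.bounded
    obtain ⟨C', hC'⟩ := hh.bounded Y
    refine ⟨C * C', fun ξ y hy => ?_⟩
    have h0 : 0 ≤ C := (norm_nonneg _).trans (hC ξ)
    rw [norm_mul, Complex.norm_real]
    exact mul_le_mul (hC ξ) (hC' _ _ hy) (norm_nonneg _) h0

theorem hasDerivAt_amplitude {z : ℂ} {h : ℝ → ℝ} {h' y : ℝ} (hd : HasDerivAt h h' y) :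
    HasDerivAt (fun y => z * (h y : ℂ)) (z * (h' : ℂ)) y :=
  (hd.ofReal_comp).const_mul z

/-- The cut-off to the annulus `R ≤ |ξ| ≤ R + 1`, with height `ε`. -/
def bump (R ε : ℝ) (ξ : Plane) : ℝ := indicator (Icc R (R + 1)) (fun _ => ε) ‖ξ‖

theorem bump_eq {R ε : ℝ} {ξ : Plane} (h : ‖ξ‖ ∈ Icc R (R + 1)) : bump R ε ξ = ε :=
  indicator_of_mem h _

theorem bump_eq_zero {R ε : ℝ} {ξ : Plane} (h : ‖ξ‖ ∉ Icc R (R + 1)) : bump R ε ξ = 0 :=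
  indicator_of_notMem h _

theorem bump_nonneg {R ε : ℝ} (hε : 0 ≤ ε) (ξ : Plane) : 0 ≤ bump R ε ξ :=
  indicator_nonneg (fun _ _ => hε) _

theorem measurable_bump (R ε : ℝ) : Measurable (bump R ε) :=
  (measurable_const.indicator measurableSet_Icc).comp measurable_norm

/-- The coefficients of the displacement. -/
def etaCoef (Ω R ε : ℝ) (lam : ℝ → ℝ) : Fin 3 → Plane → ℂ :=
  ![fun ξ => -Complex.I * ((bump R ε ξ * ((lam ‖ξ‖ * ξ 0 + 2 * Ω * ξ 1) * (lam ‖ξ‖ ^ 2)⁻¹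
      * (lam ‖ξ‖ ^ 2 + 4 * Ω ^ 2)⁻¹) : ℝ) : ℂ),
    fun ξ => -Complex.I * ((bump R ε ξ * ((lam ‖ξ‖ * ξ 1 - 2 * Ω * ξ 0) * (lam ‖ξ‖ ^ 2)⁻¹
      * (lam ‖ξ‖ ^ 2 + 4 * Ω ^ 2)⁻¹) : ℝ) : ℂ),
    fun ξ => -((bump R ε ξ * (lam ‖ξ‖ ^ 3)⁻¹ : ℝ) : ℂ)]

/-- The coefficients of the velocity. -/
def velCoef (Ω R ε : ℝ) (lam : ℝ → ℝ) (i : Fin 3) (ξ : Plane) : ℂ :=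
  (lam ‖ξ‖ : ℂ) * etaCoef Ω R ε lam i ξ

/-- The coefficient of the density perturbation. -/
def presCoef (R ε : ℝ) (lam : ℝ → ℝ) (ξ : Plane) : ℂ := ((bump R ε ξ * (lam ‖ξ‖)⁻¹ : ℝ) : ℂ)

/-- The vertical profiles of the components of the displacement. -/
def etaPot (Φ Ψ : ℝ → ℝ → ℝ) : Fin 3 → ℝ → ℝ → ℝ := ![Φ, Φ, Ψ]

/-- The vertical profile of the pressure perturbation. -/
def presPot (g : ℝ) (lam : ℝ → ℝ) (Φ Ψ : ℝ → ℝ → ℝ) (r y : ℝ) : ℝ :=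
  Φ r y + g * (lam r ^ 2)⁻¹ * Ψ r y

section
variable {g Ω R ε L : ℝ} {lam : ℝ → ℝ}

theorem abs_apply_le_norm (ξ : Plane) (i : Fin 2) : |ξ i| ≤ ‖ξ‖ := by
  simpa using PiLp.norm_apply_le ξ i

theorem norm_neg_I_mul_ofReal (x : ℝ) : ‖-Complex.I * (x : ℂ)‖ = |x| := by simp

theorem norm_etaCoef_le (hε : 0 ≤ ε) (hL : 1 ≤ L) (hlam : ∀ r, lam r ∈ Icc L (R + 1))
    (i : Fin 3) (ξ : Plane) :
    ‖etaCoef Ω R ε lam i ξ‖ ≤ (1 + 2 * |Ω|) * (R + 1) * bump R ε ξ := by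
  have h1 : 1 ≤ lam ‖ξ‖ := hL.trans (hlam _).1
  have hR1 : 1 ≤ R + 1 := h1.trans (hlam _).2
  by_cases hξ : ‖ξ‖ ∈ Icc R (R + 1)
  swap
  · rw [bump_eq_zero hξ, mul_zero]
    fin_cases i <;> simp [etaCoef, bump_eq_zero hξ]
  have hb := bump_nonneg hε ξ (R := R)
  have key : ∀ u w : ℝ, |u| ≤ R + 1 → |w| ≤ R + 1 →
      |(lam ‖ξ‖ * u + 2 * Ω * w) * (lam ‖ξ‖ ^ 2)⁻¹ * (lam ‖ξ‖ ^ 2 + 4 * Ω ^ 2)⁻¹|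
        ≤ (1 + 2 * |Ω|) * (R + 1) := by
    intro u w hu hw
    have h2 : 1 ≤ lam ‖ξ‖ ^ 2 := one_le_pow₀ h1
    have h3 : 1 ≤ lam ‖ξ‖ ^ 2 + 4 * Ω ^ 2 := by nlinarith [sq_nonneg Ω]
    have h4 : lam ‖ξ‖ ≤ lam ‖ξ‖ ^ 2 := by nlinarith
    rw [mul_assoc, ← mul_inv, ← div_eq_mul_inv, abs_div,
      abs_of_pos (by positivity : 0 < lam ‖ξ‖ ^ 2 * (lam ‖ξ‖ ^ 2 + 4 * Ω ^ 2)),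
      div_le_iff₀ (by positivity)]
    have h5 : |lam ‖ξ‖ * u + 2 * Ω * w| ≤ lam ‖ξ‖ * (R + 1) + 2 * |Ω| * (R + 1) := by
      refine (abs_add_le _ _).trans (add_le_add ?_ ?_)
      · rw [abs_mul, abs_of_pos (by linarith : 0 < lam ‖ξ‖)]
        gcongr
      · rw [abs_mul, abs_mul, abs_of_pos (by norm_num : (0 : ℝ) < 2)]
        gcongr
    have h6 : lam ‖ξ‖ * (R + 1) + 2 * |Ω| * (R + 1)
        ≤ (1 + 2 * |Ω|) * (R + 1) * (lam ‖ξ‖ ^ 2 * 1) := by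
      have : 2 * |Ω| * (R + 1) * 1 ≤ 2 * |Ω| * (R + 1) * lam ‖ξ‖ ^ 2 := by gcongr
      have : lam ‖ξ‖ * (R + 1) ≤ lam ‖ξ‖ ^ 2 * (R + 1) := by gcongr
      linarith
    refine (h5.trans h6).trans ?_
    gcongr
  have hi : ∀ i, |ξ i| ≤ R + 1 := fun i => (abs_apply_le_norm ξ i).trans hξ.2
  fin_cases i
  · change ‖-Complex.I * ((_ : ℝ) : ℂ)‖ ≤ _
    rw [norm_neg_I_mul_ofReal, abs_mul, abs_of_nonneg hb, mul_comm]
    exact mul_le_mul_of_nonneg_right (key _ _ (hi 0) (hi 1)) hb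
  · change ‖-Complex.I * ((_ : ℝ) : ℂ)‖ ≤ _
    rw [norm_neg_I_mul_ofReal, abs_mul, abs_of_nonneg hb, mul_comm]
    refine mul_le_mul_of_nonneg_right ?_ hb
    have := key (ξ 1) (-ξ 0) (hi 1) (by rw [abs_neg]; exact hi 0)
    rwa [mul_neg, ← sub_eq_add_neg] at this
  · change ‖-((_ : ℝ) : ℂ)‖ ≤ _
    rw [norm_neg, Complex.norm_real, Real.norm_eq_abs, abs_mul, abs_of_nonneg hb, mul_comm]
    refine mul_le_mul_of_nonneg_right ?_ hb
    have h2 : 1 ≤ lam ‖ξ‖ ^ 3 := one_le_pow₀ h1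
    rw [abs_of_pos (by positivity)]
    refine (inv_le_one_of_one_le₀ h2).trans ?_
    nlinarith [abs_nonneg Ω]

theorem measurable_etaCoef (hm : Measurable lam) (i : Fin 3) :
    Measurable (etaCoef Ω R ε lam i) := by
  have hl : Measurable fun ξ : Plane => lam ‖ξ‖ := hm.comp measurable_norm
  have hb := measurable_bump R ε
  have h0 : Measurable fun ξ : Plane => ξ 0 := by fun_prop
  have h1 : Measurable fun ξ : Plane => ξ 1 := by fun_prop
  fin_cases i
  · change Measurable fun ξ : Plane => -Complex.I * ((_ : ℝ) : ℂ)
    fun_prop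
  · change Measurable fun ξ : Plane => -Complex.I * ((_ : ℝ) : ℂ)
    fun_prop
  · change Measurable fun ξ : Plane => -((_ : ℝ) : ℂ)
    fun_prop

theorem isCoefficient_etaCoef (hε : 0 ≤ ε) (hL : 1 ≤ L) (hm : Measurable lam)
    (hlam : ∀ r, lam r ∈ Icc L (R + 1)) (i : Fin 3) :
    IsCoefficient (R + 1) (etaCoef Ω R ε lam i) := by
  refine ⟨measurable_etaCoef hm i, fun ξ hξ => ?_, (1 + 2 * |Ω|) * (R + 1) * ε, fun ξ => ?_⟩
  · have h := norm_etaCoef_le (Ω := Ω) hε hL hlam i ξ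
    rw [bump_eq_zero fun h => absurd h.2 (not_le.2 hξ), mul_zero] at h
    exact norm_le_zero_iff.1 h
  · refine (norm_etaCoef_le hε hL hlam i ξ).trans ?_
    have hR1 : 0 ≤ R + 1 := by linarith [(hlam 0).1, (hlam 0).2]
    gcongr
    exact indicator_le_self' (fun _ _ => hε) _

theorem IsCoefficient.mul_bounded {z w : Plane → ℂ} (hz : IsCoefficient R z) (hw : Measurable w)
    {C : ℝ} (hb : ∀ ξ, ‖ξ‖ ≤ R → ‖w ξ‖ ≤ C) : IsCoefficient R fun ξ => w ξ * z ξ := by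
  obtain ⟨C', hC'⟩ := hz.bounded
  refine ⟨hw.mul hz.measurable, fun ξ hξ => by rw [hz.support ξ hξ, mul_zero], |C| * C', fun ξ => ?_⟩
  by_cases hξ : ‖ξ‖ ≤ R
  · rw [norm_mul]
    have := (hb ξ hξ).trans (le_abs_self C)
    gcongr
    exact hC' ξ
  · rw [hz.support ξ (not_le.1 hξ), mul_zero, norm_zero]
    exact mul_nonneg (abs_nonneg _) ((norm_nonneg _).trans (hC' ξ))

theorem norm_presCoef_le (hε : 0 ≤ ε) (hL : 1 ≤ L) (hlam : ∀ r, lam r ∈ Icc L (R + 1))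
    (ξ : Plane) : ‖presCoef R ε lam ξ‖ ≤ bump R ε ξ := by
  have h1 : 1 ≤ lam ‖ξ‖ := hL.trans (hlam _).1
  have hb := bump_nonneg hε ξ (R := R)
  rw [presCoef, Complex.norm_real, Real.norm_eq_abs, abs_mul, abs_of_nonneg hb,
    abs_of_pos (by positivity)]
  exact mul_le_of_le_one_right hb (inv_le_one_of_one_le₀ h1)

theorem isCoefficient_presCoef (hε : 0 ≤ ε) (hL : 1 ≤ L) (hm : Measurable lam)
    (hlam : ∀ r, lam r ∈ Icc L (R + 1)) : IsCoefficient (R + 1) (presCoef R ε lam) := by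
  refine ⟨?_, fun ξ hξ => ?_, ε, fun ξ =>
    (norm_presCoef_le hε hL hlam ξ).trans (indicator_le_self' (fun _ _ => hε) _)⟩
  · have hl : Measurable fun ξ : Plane => lam ‖ξ‖ := hm.comp measurable_norm
    have hb := measurable_bump R ε
    change Measurable fun ξ : Plane => ((_ : ℝ) : ℂ)
    fun_prop
  · rw [presCoef, bump_eq_zero fun h => absurd h.2 (not_le.2 hξ), zero_mul, Complex.ofReal_zero]

theorem bump_neg (R ε : ℝ) (ξ : Plane) : bump R ε (-ξ) = bump R ε ξ := by simp [bump]

/-- The horizontal coefficients are `i` times a real odd function, the vertical one is real and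
even. This symmetry makes the superpositions real. -/
theorem etaCoef_neg (i : Fin 3) (ξ : Plane) :
    etaCoef Ω R ε lam i (-ξ) = starRingEnd ℂ (etaCoef Ω R ε lam i ξ) := by
  fin_cases i
  · change -Complex.I * ((_ : ℝ) : ℂ) = starRingEnd ℂ (-Complex.I * ((_ : ℝ) : ℂ))
    simp only [map_mul, map_neg, Complex.conj_I, Complex.conj_ofReal, bump_neg, norm_neg,
      PiLp.neg_apply]
    push_cast
    ring
  · change -Complex.I * ((_ : ℝ) : ℂ) = starRingEnd ℂ (-Complex.I * ((_ : ℝ) : ℂ))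
    simp only [map_mul, map_neg, Complex.conj_I, Complex.conj_ofReal, bump_neg, norm_neg,
      PiLp.neg_apply]
    push_cast
    ring
  · change -((_ : ℝ) : ℂ) = starRingEnd ℂ (-((_ : ℝ) : ℂ))
    simp only [map_neg, Complex.conj_ofReal, bump_neg, norm_neg]

theorem velCoef_neg (i : Fin 3) (ξ : Plane) :
    velCoef Ω R ε lam i (-ξ) = starRingEnd ℂ (velCoef Ω R ε lam i ξ) := by
  rw [velCoef, velCoef, etaCoef_neg, map_mul, Complex.conj_ofReal, norm_neg]

theorem presCoef_neg (ξ : Plane) :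
    presCoef R ε lam (-ξ) = starRingEnd ℂ (presCoef R ε lam ξ) := by
  rw [presCoef, presCoef, Complex.conj_ofReal, bump_neg, norm_neg]

end

end

section

/-! ### The superpositions of normal modes solve the linearized problem -/

/-- The amplitude with coefficient `z` and vertical profile `h`. -/
def amplitude (z : Plane → ℂ) (h : ℝ → ℝ → ℝ) (ξ : Plane) (y : ℝ) : ℂ := z ξ * (h ‖ξ‖ y : ℂ)

/-- The growth rate, as a function of the horizontal frequency. -/
def rate (lam : ℝ → ℝ) (ξ : Plane) : ℝ := lam ‖ξ‖

/-- The superposition of the normal modes with frequencies in the annulus `R ≤ |ξ| ≤ R + 1`. -/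
def modeUnknowns (g Ω R ε : ℝ) (lam : ℝ → ℝ) (Φ Ψ : Layer → ℝ → ℝ → ℝ) (κ : Layer → ℝ → ℝ) :
    Unknowns where
  η s t x i := (wave (rate lam) (amplitude (etaCoef Ω R ε lam i) (etaPot (Φ s) (Ψ s) i)) (t, x)).re
  v s t x i := (wave (rate lam) (amplitude (velCoef Ω R ε lam i) (etaPot (Φ s) (Ψ s) i)) (t, x)).re
  q s t x := κ s x.2
    * (wave (rate lam) (amplitude (presCoef R ε lam) (presPot g lam (Φ s) (Ψ s))) (t, x)).re

theorem sum_wave_eq_zero {μ : Plane → ℝ} {M R : ℝ} (hμ : Measurable μ) (hM : ∀ ξ, |μ ξ| ≤ M)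
    (z : ℝ × Pt) {n : ℕ} {F : Fin n → Plane → ℝ → ℂ} (c : Fin n → ℝ)
    (hF : ∀ i, IsAmplitude R (F i)) (h : ∀ ξ, ∑ i, (c i : ℂ) * F i ξ z.2.2 = 0) :
    ∑ i, c i * (wave μ (F i) z).re = 0 := by
  refine sum_superpose_eq_zero hμ hM z c (fun i => (hF i).measurable _)
    (fun i ξ => (hF i).support ξ _) (fun i => ?_) h
  obtain ⟨C, hC⟩ := (hF i).bounded |z.2.2|
  exact ⟨C, fun ξ => hC ξ _ le_rfl⟩

theorem IsCoefficient.amplitude {R : ℝ} {z : Plane → ℂ} (hz : IsCoefficient R z)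
    {h : ℝ → ℝ → ℝ} (hh : IsProfile h) : IsAmplitude R (amplitude z h) := hz.isAmplitude hh

theorem mul_amplitude (w z : Plane → ℂ) (h : ℝ → ℝ → ℝ) :
    (fun ξ y => w ξ * amplitude z h ξ y) = amplitude (fun ξ => w ξ * z ξ) h := by
  ext ξ y
  simp only [amplitude, mul_assoc]

variable {g Ω m l R ε L : ℝ} {p ρ₀ : Layer → ℝ → ℝ} {lam : ℝ → ℝ}
  {Φ Φ' Ψ Ψ' : Layer → ℝ → ℝ → ℝ}

theorem isProfile_presPot (hm : Measurable lam) (hL : 1 ≤ L) (hlam : ∀ r, lam r ∈ Icc L (R + 1))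
    {Φ Ψ : ℝ → ℝ → ℝ} (hΦ : IsProfile Φ) (hΨ : IsProfile Ψ) :
    IsProfile (presPot g lam Φ Ψ) := by
  refine ⟨?_, fun r => ?_, fun Y => ?_⟩
  · have h1 := hΦ.measurable
    have h2 := hΨ.measurable
    have h3 : Measurable fun q : ℝ × ℝ => lam q.1 := hm.comp measurable_fst
    exact h1.add ((measurable_const.mul (h3.pow_const 2).inv).mul h2)
  · exact (hΦ.continuous r).add (continuous_const.mul (hΨ.continuous r))
  · obtain ⟨C, hC⟩ := hΦ.bounded Y
    obtain ⟨C', hC'⟩ := hΨ.bounded Y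
    refine ⟨C + |g| * C', fun r y hy => (abs_add_le _ _).trans (add_le_add (hC r y hy) ?_)⟩
    have h1 : 1 ≤ lam r ^ 2 := one_le_pow₀ (hL.trans (hlam r).1)
    rw [abs_mul, abs_mul, abs_of_pos (by positivity : 0 < (lam r ^ 2)⁻¹)]
    refine mul_le_mul ?_ (hC' r y hy) (abs_nonneg _) (abs_nonneg _)
    exact mul_le_of_le_one_right (abs_nonneg _) (inv_le_one_of_one_le₀ h1)

/-! ### Admissibility of the amplitudes, and the equations for a single mode. -/

namespace ModeFamily

theorem profile_etaPot (h : ModeFamily g Ω m l p ρ₀ L R lam Φ Φ' Ψ Ψ') (s : Layer) (i : Fin 3) :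
    IsProfile (etaPot (Φ s) (Ψ s) i) := by
  fin_cases i
  exacts [h.profile_Φ s, h.profile_Φ s, h.profile_Ψ s]

theorem profile_etaPot' (h : ModeFamily g Ω m l p ρ₀ L R lam Φ Φ' Ψ Ψ') (s : Layer) (i : Fin 3) :
    IsProfile (etaPot (Φ' s) (Ψ' s) i) := by
  fin_cases i
  exacts [h.profile_Φ' s, h.profile_Φ' s, h.profile_Ψ' s]

theorem deriv_etaPot (h : ModeFamily g Ω m l p ρ₀ L R lam Φ Φ' Ψ Ψ') (s : Layer) (i : Fin 3)
    (r y : ℝ) : HasDerivAt (etaPot (Φ s) (Ψ s) i r) (etaPot (Φ' s) (Ψ' s) i r y) y := by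
  fin_cases i
  exacts [h.deriv_Φ s r y, h.deriv_Φ s r y, h.deriv_Ψ s r y]

theorem deriv_presPot (h : ModeFamily g Ω m l p ρ₀ L R lam Φ Φ' Ψ Ψ') (s : Layer) (r y : ℝ) :
    HasDerivAt (presPot g lam (Φ s) (Ψ s) r) (presPot g lam (Φ' s) (Ψ' s) r y) y :=
  (h.deriv_Φ s r y).add ((h.deriv_Ψ s r y).const_mul _)

theorem measurable_rate (h : ModeFamily g Ω m l p ρ₀ L R lam Φ Φ' Ψ Ψ') :
    Measurable (rate lam) := h.measurable_lam.comp measurable_norm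

theorem abs_rate_le (h : ModeFamily g Ω m l p ρ₀ L R lam Φ Φ' Ψ Ψ') (hL : 1 ≤ L) (ξ : Plane) :
    |rate lam ξ| ≤ R + 1 := by
  have h1 := h.lam_mem ‖ξ‖
  rw [rate, abs_of_nonneg (by linarith [h1.1])]
  exact h1.2

theorem coef_rate_mul (h : ModeFamily g Ω m l p ρ₀ L R lam Φ Φ' Ψ Ψ') (hL : 1 ≤ L)
    {z : Plane → ℂ} (hz : IsCoefficient (R + 1) z) :
    IsCoefficient (R + 1) fun ξ => (rate lam ξ : ℂ) * z ξ :=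
  hz.mul_bounded (Complex.measurable_ofReal.comp h.measurable_rate) fun ξ _ => by
    rw [Complex.norm_real]; exact h.abs_rate_le hL ξ

theorem _root_.RotatingRT.IsCoefficient.I_mul {z : Plane → ℂ} (hz : IsCoefficient R z)
    (i : Fin 2) : IsCoefficient R fun ξ => Complex.I * (ξ i : ℂ) * z ξ :=
  hz.mul_bounded (by fun_prop) (C := R) fun ξ hξ => by
    rw [norm_mul, Complex.norm_I, one_mul, Complex.norm_real]
    exact (abs_apply_le_norm ξ i).trans hξ

theorem coef_vel (h : ModeFamily g Ω m l p ρ₀ L R lam Φ Φ' Ψ Ψ') (hL : 1 ≤ L) (hε : 0 ≤ ε)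
    (i : Fin 3) : IsCoefficient (R + 1) (velCoef Ω R ε lam i) :=
  h.coef_rate_mul hL (isCoefficient_etaCoef hε hL h.measurable_lam h.lam_mem i)

/-- The identities between amplitudes which express the equation of continuity and the momentum
equations. -/
theorem continuity_identity (h : ModeFamily g Ω m l p ρ₀ L R lam Φ Φ' Ψ Ψ') (hL : 1 ≤ L)
    {s : Layer} {y : ℝ} (hy : y ∈ s.closedInterval m l) (ξ : Plane) :
    ((ρ₀ s y / soundSq p ρ₀ s y : ℝ) : ℂ)
        * ((rate lam ξ : ℂ) * amplitude (presCoef R ε lam) (presPot g lam (Φ s) (Ψ s)) ξ y)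
      + (ρ₀ s y : ℂ) * (Complex.I * (ξ 0 : ℂ) * amplitude (velCoef Ω R ε lam 0) (Φ s) ξ y)
      + (ρ₀ s y : ℂ) * (Complex.I * (ξ 1 : ℂ) * amplitude (velCoef Ω R ε lam 1) (Φ s) ξ y)
      + (ρ₀ s y : ℂ) * amplitude (velCoef Ω R ε lam 2) (Ψ' s) ξ y = 0 := by
  by_cases hξ : ‖ξ‖ ∈ Icc R (R + 1)
  swap
  · simp [amplitude, presCoef, velCoef, etaCoef, bump_eq_zero hξ]
  have h1 : (lam ‖ξ‖ : ℂ) ≠ 0 := by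
    have : 0 < lam ‖ξ‖ := by linarith [(h.lam_mem ‖ξ‖).1]
    exact_mod_cast this.ne'
  have h3 : (‖ξ‖ : ℂ) ^ 2 = (ξ 0 : ℂ) ^ 2 + (ξ 1 : ℂ) ^ 2 := by
    have := EuclideanSpace.real_norm_sq_eq ξ
    rw [Fin.sum_univ_two] at this
    exact_mod_cast this
  simp only [amplitude, presCoef, velCoef, etaCoef, Matrix.cons_val, presPot, rate,
    h.Ψ'_eq s ‖ξ‖ hξ y hy, waveNumberSq]
  push_cast
  rw [h3]
  generalize (soundSq p ρ₀ s y : ℂ) = c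
  -- The inverse of `λ² + 4Ω²` is kept as an atom: it occurs in the same way in the horizontal
  -- divergence and in `Ψ'`, so only `|ξ|² = ξ₀² + ξ₁²` and `i² = -1` are needed.
  generalize hb : ((lam ‖ξ‖ : ℂ) ^ 2 + 4 * (Ω : ℂ) ^ 2)⁻¹ = b
  rw [div_eq_mul_inv _ c, div_eq_mul_inv _ c, one_div, div_eq_mul_inv _ (_ + _), hb]
  field_simp
  linear_combination (-(ρ₀ s y : ℂ) * bump R ε ξ * Φ s ‖ξ‖ y * lam ‖ξ‖ ^ 2
    * (ξ 0 ^ 2 + ξ 1 ^ 2) * b) * Complex.I_sq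

/-- The `Ψ` parts of the pressure and of `g η₃` cancel, leaving `λ⁻¹ Φ`. The horizontal coefficients
solve the remaining 2×2 Coriolis system, of determinant `λ² + 4Ω²`. -/
theorem momentum_identity_zero (h : ModeFamily g Ω m l p ρ₀ L R lam Φ Φ' Ψ Ψ') (hL : 1 ≤ L)
    (s : Layer) (y : ℝ) (ξ : Plane) :
    (rate lam ξ : ℂ) * amplitude (velCoef Ω R ε lam 0) (Φ s) ξ y
      + Complex.I * (ξ 0 : ℂ) * amplitude (presCoef R ε lam) (presPot g lam (Φ s) (Ψ s)) ξ y
      + g * (Complex.I * (ξ 0 : ℂ) * amplitude (etaCoef Ω R ε lam 2) (Ψ s) ξ y)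
      - 2 * Ω * amplitude (velCoef Ω R ε lam 1) (Φ s) ξ y = 0 := by
  have h1 : (lam ‖ξ‖ : ℂ) ≠ 0 := by
    have : 0 < lam ‖ξ‖ := by linarith [(h.lam_mem ‖ξ‖).1]
    exact_mod_cast this.ne'
  have h2 : (lam ‖ξ‖ : ℂ) ^ 2 + 4 * (Ω : ℂ) ^ 2 ≠ 0 := by
    have : 0 < lam ‖ξ‖ := by linarith [(h.lam_mem ‖ξ‖).1]
    have : 0 < lam ‖ξ‖ ^ 2 + 4 * Ω ^ 2 := by positivity
    exact_mod_cast this.ne'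
  simp only [amplitude, presCoef, velCoef, etaCoef, Matrix.cons_val, presPot, rate]
  push_cast
  have hb := inv_mul_cancel₀ h2
  generalize ((lam ‖ξ‖ : ℂ) ^ 2 + 4 * (Ω : ℂ) ^ 2)⁻¹ = b at hb ⊢
  field_simp
  linear_combination (-Complex.I * bump R ε ξ * lam ‖ξ‖ ^ 2 * ξ 0 * Φ s ‖ξ‖ y) * hb

theorem momentum_identity_one (h : ModeFamily g Ω m l p ρ₀ L R lam Φ Φ' Ψ Ψ') (hL : 1 ≤ L)
    (s : Layer) (y : ℝ) (ξ : Plane) :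
    (rate lam ξ : ℂ) * amplitude (velCoef Ω R ε lam 1) (Φ s) ξ y
      + Complex.I * (ξ 1 : ℂ) * amplitude (presCoef R ε lam) (presPot g lam (Φ s) (Ψ s)) ξ y
      + g * (Complex.I * (ξ 1 : ℂ) * amplitude (etaCoef Ω R ε lam 2) (Ψ s) ξ y)
      + 2 * Ω * amplitude (velCoef Ω R ε lam 0) (Φ s) ξ y = 0 := by
  have h1 : (lam ‖ξ‖ : ℂ) ≠ 0 := by
    have : 0 < lam ‖ξ‖ := by linarith [(h.lam_mem ‖ξ‖).1]
    exact_mod_cast this.ne'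
  have h2 : (lam ‖ξ‖ : ℂ) ^ 2 + 4 * (Ω : ℂ) ^ 2 ≠ 0 := by
    have : 0 < lam ‖ξ‖ := by linarith [(h.lam_mem ‖ξ‖).1]
    have : 0 < lam ‖ξ‖ ^ 2 + 4 * Ω ^ 2 := by positivity
    exact_mod_cast this.ne'
  simp only [amplitude, presCoef, velCoef, etaCoef, Matrix.cons_val, presPot, rate]
  push_cast
  have hb := inv_mul_cancel₀ h2
  generalize ((lam ‖ξ‖ : ℂ) ^ 2 + 4 * (Ω : ℂ) ^ 2)⁻¹ = b at hb ⊢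
  field_simp
  linear_combination (-Complex.I * bump R ε ξ * lam ‖ξ‖ ^ 2 * ξ 1 * Φ s ‖ξ‖ y) * hb

/-- After the same cancellation, now of the `Ψ'` terms, the vertical equation is `Φ' = Ψ`. -/
theorem momentum_identity_two (h : ModeFamily g Ω m l p ρ₀ L R lam Φ Φ' Ψ Ψ') (hL : 1 ≤ L)
    {s : Layer} {y : ℝ} (hy : y ∈ s.closedInterval m l) (ξ : Plane) :
    (rate lam ξ : ℂ) * amplitude (velCoef Ω R ε lam 2) (Ψ s) ξ y
      + amplitude (presCoef R ε lam) (presPot g lam (Φ' s) (Ψ' s)) ξ y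
      + g * amplitude (etaCoef Ω R ε lam 2) (Ψ' s) ξ y = 0 := by
  by_cases hξ : ‖ξ‖ ∈ Icc R (R + 1)
  swap
  · simp [amplitude, presCoef, velCoef, etaCoef, bump_eq_zero hξ]
  have h1 : (lam ‖ξ‖ : ℂ) ≠ 0 := by
    have : 0 < lam ‖ξ‖ := by linarith [(h.lam_mem ‖ξ‖).1]
    exact_mod_cast this.ne'
  simp only [amplitude, presCoef, velCoef, etaCoef, Matrix.cons_val, presPot, rate,
    h.Φ'_eq s ‖ξ‖ hξ y hy]
  push_cast
  field_simp
  ring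

end ModeFamily

end

/-! ### Superpositions of modes are solutions -/

section

variable {g Ω m l R ε L : ℝ} {p ρ₀ : Layer → ℝ → ℝ} {lam : ℝ → ℝ}
  {Φ Φ' Ψ Ψ' : Layer → ℝ → ℝ → ℝ} {κ : Layer → ℝ → ℝ}

theorem hasDerivAt_amplitude_profile {z : Plane → ℂ} {h h' : ℝ → ℝ → ℝ}
    (hd : ∀ r y, HasDerivAt (h r) (h' r y) y) (ξ : Plane) (y : ℝ) :
    HasDerivAt (amplitude z h ξ) (amplitude z h' ξ y) y :=
  hasDerivAt_amplitude (hd ‖ξ‖ y)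

theorem hasFDerivAt_mul_snd {f : ℝ → ℝ} {f' : ℝ} {G : Pt → ℝ} {T : Pt →L[ℝ] ℝ} {x : Pt}
    (hf : HasDerivAt f f' x.2) (hG : HasFDerivAt G T x) :
    HasFDerivAt (fun x : Pt => f x.2 * G x)
      (f x.2 • T + G x • (f' • ContinuousLinearMap.snd ℝ Plane ℝ)) x := by
  have h1 : HasFDerivAt (fun x : Pt => f x.2) (f' • ContinuousLinearMap.snd ℝ Plane ℝ) x :=
    hf.comp_hasFDerivAt x (ContinuousLinearMap.snd ℝ Plane ℝ).hasFDerivAt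
  exact h1.mul hG

namespace ModeFamily

/-- The factor `κ = ρ₀ / p'(ρ₀)` is made so that `p'(ρ₀) q` is `ρ₀` times a superposition. Every
equation is then `ρ₀`, or a constant, times an identity between amplitudes. The profiles satisfy
their equations only for frequencies in the annulus, outside of which the coefficients vanish. -/
theorem isSolution (h : ModeFamily g Ω m l p ρ₀ L R lam Φ Φ' Ψ Ψ')
    (hρ : IsSteadyState g m l p ρ₀) (hp : ∀ s, IsPressureLaw (p s)) (hm : 0 < m) (hl : 0 < l)
    (hL : 1 ≤ L) (hR : 0 ≤ R) (hε : 0 ≤ ε)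
    (hκ : ∀ s, ∀ y ∈ s.closedInterval m l, κ s y = ρ₀ s y / soundSq p ρ₀ s y) :
    IsSolution g Ω m l p ρ₀ (modeUnknowns g Ω R ε lam Φ Ψ κ) := by
  have hR1 : 0 ≤ R + 1 := by linarith
  have hμ := h.measurable_rate
  have hM := h.abs_rate_le hL
  have zη := isCoefficient_etaCoef (Ω := Ω) hε hL h.measurable_lam h.lam_mem
  have zv := h.coef_vel hL hε
  have zq := isCoefficient_presCoef hε hL h.measurable_lam h.lam_mem
  have hPot := fun s => isProfile_presPot (g := g) h.measurable_lam hL h.lam_mem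
    (h.profile_Φ s) (h.profile_Ψ s)
  have hPot' := fun s => isProfile_presPot (g := g) h.measurable_lam hL h.lam_mem
    (h.profile_Φ' s) (h.profile_Ψ' s)
  have aη := fun s i => (zη i).amplitude (h.profile_etaPot s i)
  have aη' := fun s i => (zη i).amplitude (h.profile_etaPot' s i)
  have av := fun s i => (zv i).amplitude (h.profile_etaPot s i)
  have av' := fun s i => (zv i).amplitude (h.profile_etaPot' s i)
  have aq := fun s => zq.amplitude (hPot s)
  have aq' := fun s => zq.amplitude (hPot' s)
  have dη := fun s i => hasDerivAt_amplitude_profile (z := etaCoef Ω R ε lam i) (h.deriv_etaPot s i)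
  have dv := fun s i => hasDerivAt_amplitude_profile (z := velCoef Ω R ε lam i) (h.deriv_etaPot s i)
  have dq := fun s => hasDerivAt_amplitude_profile (z := presCoef R ε lam) (h.deriv_presPot s)
  have hzero := fun s => Layer.zero_mem_closedInterval hm hl s
  have contDiff_re : ∀ {F : Plane → ℝ → ℂ}, ContDiff ℝ 1 (wave (rate lam) F) →
      ContDiff ℝ 1 fun z => (wave (rate lam) F z).re := fun hF =>
    Complex.reCLM.contDiff.comp hF
  constructor
  · exact fun s => contDiffOn_pi.2 fun i =>
      (contDiff_re (contDiff_wave hR1 hμ hM (aη s i) (aη' s i) (dη s i))).contDiffOn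
  · exact fun s => contDiffOn_pi.2 fun i =>
      (contDiff_re (contDiff_wave hR1 hμ hM (av s i) (av' s i) (dv s i))).contDiffOn
  · intro s
    have hle : (1 : ℕ∞ω) ≤ (∞ : ℕ∞ω) := by exact_mod_cast le_top
    have h1 : ContDiffOn ℝ 1 (fun y => ρ₀ s y / soundSq p ρ₀ s y) (s.closedInterval m l) :=
      ((hρ.contDiffOn hp hm hl s).of_le hle).div ((hρ.contDiffOn_soundSq hp hm hl s).of_le hle)
        fun y hy => (hρ.soundSq_pos hp s hy).ne'
    have h2 : ContDiffOn ℝ 1 (κ s) (s.closedInterval m l) := h1.congr fun y hy => hκ s y hy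
    have h3 : ContDiffOn ℝ 1 (fun z : ℝ × Pt => κ s z.2.2)
        (Ici 0 ×ˢ (univ ×ˢ s.closedInterval m l)) :=
      h2.comp (by fun_prop) fun z hz => hz.2.2
    exact h3.mul (contDiff_re (contDiff_wave hR1 hμ hM (aq s) (aq' s) (dq s))).contDiffOn
  · intro s t _ x _
    refine (hasDerivAt_pi.2 fun i => ?_).deriv
    have h1 := hasDerivAt_re_wave_time hR1 hμ hM (aη s i) (aη' s i) (dη s i) t x
    rw [mul_amplitude] at h1
    exact h1
  · intro s t _ x hx
    have hx' : x.2 ∈ s.closedInterval m l := Ioo_subset_Icc_self hx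
    have h1 := (hasDerivAt_re_wave_time hR1 hμ hM (aq s) (aq' s) (dq s) t x).const_mul (κ s x.2)
    have h2 : deriv (fun τ => (modeUnknowns g Ω R ε lam Φ Ψ κ).q s τ x) t = _ := h1.deriv
    have d0 := (pd_re_wave hR1 hμ hM (av s 0) (av' s 0) (dv s 0) t x).1
    have d1 := (pd_re_wave hR1 hμ hM (av s 1) (av' s 1) (dv s 1) t x).2.1
    have d2 := (pd_re_wave hR1 hμ hM (av s 2) (av' s 2) (dv s 2) t x).2.2
    rw [h2, divergence, Fin.sum_univ_three]
    simp only [modeUnknowns]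
    rw [d0, d1, d2, hκ s _ hx']
    have key := sum_wave_eq_zero (R := R + 1) hμ hM (t, x)
      (F := ![fun ξ y => (rate lam ξ : ℂ) * amplitude (presCoef R ε lam) (presPot g lam (Φ s) (Ψ s)) ξ y,
        fun ξ y => Complex.I * (ξ 0 : ℂ) * amplitude (velCoef Ω R ε lam 0) (Φ s) ξ y,
        fun ξ y => Complex.I * (ξ 1 : ℂ) * amplitude (velCoef Ω R ε lam 1) (Φ s) ξ y,
        amplitude (velCoef Ω R ε lam 2) (Ψ' s)])
      ![ρ₀ s x.2 / soundSq p ρ₀ s x.2, ρ₀ s x.2, ρ₀ s x.2, ρ₀ s x.2]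
      (fun i => by
        fin_cases i
        · change IsAmplitude (R + 1) fun ξ y => _ * amplitude _ _ ξ y
          rw [mul_amplitude]
          exact (h.coef_rate_mul hL zq).amplitude (hPot s)
        · change IsAmplitude (R + 1) fun ξ y => _ * amplitude _ _ ξ y
          rw [mul_amplitude]
          exact ((zv 0).I_mul 0).amplitude (h.profile_Φ s)
        · change IsAmplitude (R + 1) fun ξ y => _ * amplitude _ _ ξ y
          rw [mul_amplitude]
          exact ((zv 1).I_mul 1).amplitude (h.profile_Φ s)
        · exact (zv 2).amplitude (h.profile_Ψ' s))
      (fun ξ => by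
        rw [Fin.sum_univ_four]
        exact h.continuity_identity hL hx' ξ)
    rw [Fin.sum_univ_four] at key
    simp only [Matrix.cons_val] at key
    simp only [etaPot, Matrix.cons_val]
    linarith
  · intro s t _ x hx
    have hx' : x.2 ∈ s.closedInterval m l := Ioo_subset_Icc_self hx
    have hc := hρ.soundSq_pos hp s hx'
    have h1 : deriv (fun τ => (modeUnknowns g Ω R ε lam Φ Ψ κ).v s τ x) t = fun i =>
        (wave (rate lam) (fun ξ y => (rate lam ξ : ℂ)
          * amplitude (velCoef Ω R ε lam i) (etaPot (Φ s) (Ψ s) i) ξ y) (t, x)).re :=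
      (hasDerivAt_pi.2 fun i =>
        hasDerivAt_re_wave_time hR1 hμ hM (av s i) (av' s i) (dv s i) t x).deriv
    obtain ⟨T, hT, T0, T1, T2⟩ := hasFDerivAt_re_wave_space hR1 hμ hM (aq s) (aq' s) (dq s) t x
    -- Near `x` the function is `ρ₀` times a superposition, so the product rule brings in `ρ₀' = -g
    -- ρ₀ / p'(ρ₀)` in the vertical direction only.
    have hpres : HasFDerivAt
        (fun y : Pt => deriv (p s) (ρ₀ s y.2) * (modeUnknowns g Ω R ε lam Φ Ψ κ).q s t y) _ x :=
      (hasFDerivAt_mul_snd (hρ.hasDerivAt hp s hx) hT).congr_of_eventuallyEq (by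
        have hev : ∀ᶠ y : Pt in nhds x, y.2 ∈ s.interval m l :=
          continuous_snd.continuousAt.eventually (isOpen_Ioo.mem_nhds hx)
        filter_upwards [hev] with y hy
        have hy' : y.2 ∈ s.closedInterval m l := Ioo_subset_Icc_self hy
        have hcy : deriv (p s) (ρ₀ s y.2) ≠ 0 := (hρ.soundSq_pos hp s hy').ne'
        simp only [modeUnknowns]
        rw [hκ s _ hy', soundSq]
        field_simp)
    obtain ⟨e0, e1, e2⟩ := pd_re_wave hR1 hμ hM (aη s 2) (aη' s 2) (dη s 2) t x
    simp only [etaPot, Matrix.cons_val] at e0 e1 e2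
    rw [h1]
    have hgp : ∀ i, grad (fun y : Pt =>
        deriv (p s) (ρ₀ s y.2) * (modeUnknowns g Ω R ε lam Φ Ψ κ).q s t y) x i
          = ρ₀ s x.2 * T (dir i)
            + (wave (rate lam) (amplitude (presCoef R ε lam) (presPot g lam (Φ s) (Ψ s))) (t, x)).re
              * (-(g / soundSq p ρ₀ s x.2 * ρ₀ s x.2) * (dir i).2) := fun i => by
      rw [grad, pd, hpres.fderiv]
      simp
    have hge : ∀ i, grad (fun y : Pt => (modeUnknowns g Ω R ε lam Φ Ψ κ).η s t y 2) x i
        = pd i (fun y => (wave (rate lam) (amplitude (etaCoef Ω R ε lam 2)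
          (Ψ s)) (t, y)).re) x := fun i => rfl
    have dir0 : (dir 0).2 = 0 := rfl
    have dir1 : (dir 1).2 = 0 := rfl
    have dir2 : (dir 2).2 = 1 := rfl
    ext i
    simp only [Pi.add_apply, Pi.sub_apply, Pi.smul_apply, smul_eq_mul, hgp, hge]
    fin_cases i
    · have key := sum_wave_eq_zero (R := R + 1) hμ hM (t, x)
        (F := ![fun ξ y => (rate lam ξ : ℂ) * amplitude (velCoef Ω R ε lam 0) (Φ s) ξ y,
          fun ξ y => Complex.I * (ξ 0 : ℂ) * amplitude (presCoef R ε lam) (presPot g lam (Φ s) (Ψ s)) ξ y,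
          fun ξ y => Complex.I * (ξ 0 : ℂ) * amplitude (etaCoef Ω R ε lam 2) (Ψ s) ξ y,
          amplitude (velCoef Ω R ε lam 1) (Φ s)])
        ![1, 1, g, -2 * Ω]
        (fun i => by
          fin_cases i
          · change IsAmplitude (R + 1) fun ξ y => _ * amplitude _ _ ξ y
            rw [mul_amplitude]
            exact (h.coef_rate_mul hL (zv 0)).amplitude (h.profile_Φ s)
          · change IsAmplitude (R + 1) fun ξ y => _ * amplitude _ _ ξ y
            rw [mul_amplitude]
            exact (zq.I_mul 0).amplitude (hPot s)
          · change IsAmplitude (R + 1) fun ξ y => _ * amplitude _ _ ξ y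
            rw [mul_amplitude]
            exact ((zη 2).I_mul 0).amplitude (h.profile_Ψ s)
          · exact (zv 1).amplitude (h.profile_Φ s))
        (fun ξ => by
          rw [Fin.sum_univ_four]
          have := h.momentum_identity_zero (ε := ε) hL s x.2 ξ
          simp only [Matrix.cons_val]
          push_cast
          linear_combination this)
      rw [Fin.sum_univ_four] at key
      simp only [Matrix.cons_val] at key
      simp only [Fin.zero_eta, e0, T0, dir0, e, modeUnknowns, etaPot, Matrix.cons_val,
        Pi.single_apply]
      simp
      linear_combination ρ₀ s x.2 * key
    · have key := sum_wave_eq_zero (R := R + 1) hμ hM (t, x)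
        (F := ![fun ξ y => (rate lam ξ : ℂ) * amplitude (velCoef Ω R ε lam 1) (Φ s) ξ y,
          fun ξ y => Complex.I * (ξ 1 : ℂ) * amplitude (presCoef R ε lam) (presPot g lam (Φ s) (Ψ s)) ξ y,
          fun ξ y => Complex.I * (ξ 1 : ℂ) * amplitude (etaCoef Ω R ε lam 2) (Ψ s) ξ y,
          amplitude (velCoef Ω R ε lam 0) (Φ s)])
        ![1, 1, g, 2 * Ω]
        (fun i => by
          fin_cases i
          · change IsAmplitude (R + 1) fun ξ y => _ * amplitude _ _ ξ y
            rw [mul_amplitude]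
            exact (h.coef_rate_mul hL (zv 1)).amplitude (h.profile_Φ s)
          · change IsAmplitude (R + 1) fun ξ y => _ * amplitude _ _ ξ y
            rw [mul_amplitude]
            exact (zq.I_mul 1).amplitude (hPot s)
          · change IsAmplitude (R + 1) fun ξ y => _ * amplitude _ _ ξ y
            rw [mul_amplitude]
            exact ((zη 2).I_mul 1).amplitude (h.profile_Ψ s)
          · exact (zv 0).amplitude (h.profile_Φ s))
        (fun ξ => by
          rw [Fin.sum_univ_four]
          have := h.momentum_identity_one (ε := ε) hL s x.2 ξ
          simp only [Matrix.cons_val]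
          push_cast
          linear_combination this)
      rw [Fin.sum_univ_four] at key
      simp only [Matrix.cons_val] at key
      simp only [Fin.mk_one, e1, T1, dir1, e, modeUnknowns, etaPot, Matrix.cons_val,
        Pi.single_apply]
      simp
      linear_combination ρ₀ s x.2 * key
    -- In the vertical component the contribution of `ρ₀'` to the pressure gradient cancels `-g q`
    -- exactly; the rest is `ρ₀` times `momentum_identity_two`.
    · have key := sum_wave_eq_zero (R := R + 1) hμ hM (t, x)
        (F := ![fun ξ y => (rate lam ξ : ℂ) * amplitude (velCoef Ω R ε lam 2) (Ψ s) ξ y,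
          amplitude (presCoef R ε lam) (presPot g lam (Φ' s) (Ψ' s)),
          amplitude (etaCoef Ω R ε lam 2) (Ψ' s)])
        ![1, 1, g]
        (fun i => by
          fin_cases i
          · change IsAmplitude (R + 1) fun ξ y => _ * amplitude _ _ ξ y
            rw [mul_amplitude]
            exact (h.coef_rate_mul hL (zv 2)).amplitude (h.profile_Ψ s)
          · exact zq.amplitude (hPot' s)
          · exact (zη 2).amplitude (h.profile_Ψ' s))
        (fun ξ => by
          rw [Fin.sum_univ_three]
          have := h.momentum_identity_two (ε := ε) hL hx' ξ
          simp only [Matrix.cons_val]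
          push_cast
          linear_combination this)
      rw [Fin.sum_univ_three] at key
      simp only [Matrix.cons_val] at key
      simp only [Fin.reduceFinMk, e2, T2, dir2, e, modeUnknowns, etaPot, Matrix.cons_val,
        Pi.single_apply, hκ s _ hx']
      simp
      linear_combination ρ₀ s x.2 * key
  · intro t _ x'
    have key := sum_wave_eq_zero (R := R + 1) hμ hM (t, (x', 0))
      (F := ![amplitude (velCoef Ω R ε lam 2) (Ψ .upper), amplitude (velCoef Ω R ε lam 2) (Ψ .lower)])
      ![1, -1]
      (fun i => by
        fin_cases i
        exacts [(zv 2).amplitude (h.profile_Ψ _), (zv 2).amplitude (h.profile_Ψ _)])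
      (fun ξ => by
        rw [Fin.sum_univ_two]
        by_cases hξ : ‖ξ‖ ∈ Icc R (R + 1)
        · simp [amplitude, h.jump_Ψ _ hξ]
        · simp [amplitude, velCoef, etaCoef, bump_eq_zero hξ])
    rw [Fin.sum_univ_two] at key
    simp only [Matrix.cons_val] at key
    simp only [modeUnknowns, etaPot, Matrix.cons_val]
    linarith
  · intro t _ x'
    have key := sum_wave_eq_zero (R := R + 1) hμ hM (t, (x', 0))
      (F := ![amplitude (presCoef R ε lam) (presPot g lam (Φ .upper) (Ψ .upper)),
        amplitude (presCoef R ε lam) (presPot g lam (Φ .lower) (Ψ .lower))])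
      ![ρ₀ .upper 0, -ρ₀ .lower 0]
      (fun i => by
        fin_cases i
        exacts [zq.amplitude (hPot _), zq.amplitude (hPot _)])
      (fun ξ => by
        rw [Fin.sum_univ_two]
        by_cases hξ : ‖ξ‖ ∈ Icc R (R + 1)
        · have hj := h.jump_Φ _ hξ
          rw [div_eq_mul_inv] at hj
          have hj' := congrArg (fun u : ℝ => (u : ℂ)) hj
          simp only [Matrix.cons_val, amplitude, presPot]
          push_cast at hj' ⊢
          linear_combination presCoef R ε lam ξ * hj'
        · simp [amplitude, presCoef, bump_eq_zero hξ])
    rw [Fin.sum_univ_two] at key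
    simp only [Matrix.cons_val] at key
    have hcu : deriv (p .upper) (ρ₀ .upper 0) ≠ 0 := (hρ.soundSq_pos hp .upper (hzero _)).ne'
    have hcl : deriv (p .lower) (ρ₀ .lower 0) ≠ 0 := (hρ.soundSq_pos hp .lower (hzero _)).ne'
    simp only [modeUnknowns]
    rw [hκ _ _ (hzero _), hκ _ _ (hzero _), soundSq, soundSq, ← mul_assoc, ← mul_assoc,
      mul_div_cancel₀ _ hcu, mul_div_cancel₀ _ hcl]
    linarith
  · intro t _ x'
    have key := sum_wave_eq_zero (R := R + 1) hμ hM (t, (x', -m))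
      (F := ![amplitude (velCoef Ω R ε lam 2) (Ψ .lower)]) ![1]
      (fun i => by
        fin_cases i
        exact (zv 2).amplitude (h.profile_Ψ _))
      (fun ξ => by
        by_cases hξ : ‖ξ‖ ∈ Icc R (R + 1)
        · have := h.wall .lower _ hξ
          simp only [Layer.wall] at this
          simp [amplitude, this]
        · simp [amplitude, velCoef, etaCoef, bump_eq_zero hξ])
    simpa [modeUnknowns, etaPot] using key
  · intro t _ x'
    have key := sum_wave_eq_zero (R := R + 1) hμ hM (t, (x', l))
      (F := ![amplitude (velCoef Ω R ε lam 2) (Ψ .upper)]) ![1]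
      (fun i => by
        fin_cases i
        exact (zv 2).amplitude (h.profile_Ψ _))
      (fun ξ => by
        by_cases hξ : ‖ξ‖ ∈ Icc R (R + 1)
        · have := h.wall .upper _ hξ
          simp only [Layer.wall] at this
          simp [amplitude, this]
        · simp [amplitude, velCoef, etaCoef, bump_eq_zero hξ])
    simpa [modeUnknowns, etaPot] using key

end ModeFamily

end

section

/-! ### Sobolev norms of superpositions of normal modes -/

/-- The vertical derivatives of the horizontal Fourier transform of a superposition of modes. -/
def waveJet (lam : ℝ → ℝ) (t : ℝ) (z : Plane → ℂ) (h : ℝ → ℝ → ℝ) (I : Set ℝ) (j : ℕ) (x : Pt) :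
    ℂ :=
  Complex.exp ((rate lam x.1 : ℂ) * t) * (z x.1 * ((iteratedDerivWithin j (h ‖x.1‖) I x.2 : ℝ) : ℂ))

theorem norm_waveJet (lam : ℝ → ℝ) (t : ℝ) (z : Plane → ℂ) (h : ℝ → ℝ → ℝ) (I : Set ℝ) (j : ℕ)
    (x : Pt) : ‖waveJet lam t z h I j x‖
      = Real.exp (lam ‖x.1‖ * t) * (‖z x.1‖ * |iteratedDerivWithin j (h ‖x.1‖) I x.2|) := by
  rw [waveJet, norm_mul, norm_mul, Complex.norm_real, Complex.norm_exp, Real.norm_eq_abs, rate,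
    ← Complex.ofReal_mul, Complex.ofReal_re]

variable {a b R M t : ℝ} {S : Set ℝ} {k : ℕ} {lam : ℝ → ℝ} {z : Plane → ℂ} {h : ℝ → ℝ → ℝ}

/-- The set `S` contains the wave numbers which occur. Smoothness of the profile up to the end
points and bounds for its derivatives are needed only there, because elsewhere the coefficient
vanishes and with it the jet. -/
theorem isFourierJet_waveJet (hab : a < b) (hlam : Measurable lam) (hM : ∀ r, |lam r| ≤ M)
    (hz : IsCoefficient R z) (hz0 : ∀ ξ, ‖ξ‖ ∉ S → z ξ = 0)
    (hzn : ∀ ξ, z (-ξ) = starRingEnd ℂ (z ξ)) (hh : IsProfile h)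
    (hs : ∀ r ∈ S, ContDiffOn ℝ ∞ (h r) (Icc a b))
    (hb : ∀ j ≤ k, ∃ C : ℝ, ∀ r ∈ S, ∀ y ∈ Icc a b, |iteratedDerivWithin j (h r) (Icc a b) y| ≤ C)
    (t : ℝ) {f : Pt → ℝ} (hf : Measurable f)
    (hfe : ∀ x', ∀ y ∈ Ioo a b, f (x', y) = (wave (rate lam) (amplitude z h) (t, (x', y))).re) :
    IsFourierJet (Ioo a b) k f (waveJet lam t z h (Icc a b)) := by
  have hl : Measurable fun ξ : Plane => lam ‖ξ‖ := hlam.comp measurable_norm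
  refine isFourierJet_of_hasDerivAt (R := R) ?_ (fun j _ ξ y _ hξ => ?_) (fun j hj => ?_)
    (fun j _ ξ y hy => ?_) hf fun x' y hy => ?_
  · refine Measurable.indicator ?_ (MeasurableSet.univ.prod measurableSet_Ioo)
    have h1 : Measurable fun x : Pt => h ‖x.1‖ x.2 :=
      hh.measurable.comp (measurable_fst.norm.prodMk measurable_snd)
    have h2 : Measurable fun x : Pt => lam ‖x.1‖ := hl.comp measurable_fst
    have h3 : Measurable fun x : Pt => z x.1 := hz.measurable.comp measurable_fst
    change Measurable fun x => waveJet lam t z h (Icc a b) 0 x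
    simp only [waveJet, iteratedDerivWithin_zero, rate]
    exact ((Complex.measurable_ofReal.comp h2).mul_const _).cexp.mul
      (h3.mul (Complex.measurable_ofReal.comp h1))
  · simp [waveJet, hz.support ξ hξ]
  · obtain ⟨C, hC⟩ := hb j hj
    obtain ⟨C', hC'⟩ := hz.bounded
    have hC0 : 0 ≤ C' := (norm_nonneg _).trans (hC' 0)
    refine ⟨Real.exp (M * |t|) * (C' * |C|), fun ξ y hy => ?_⟩
    rw [norm_waveJet]
    by_cases hξ : ‖ξ‖ ∈ S
    · have h1 : lam ‖ξ‖ * t ≤ M * |t| :=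
        (le_abs_self _).trans (by rw [abs_mul]; gcongr; exact hM _)
      have h2 := (hC _ hξ y (Ioo_subset_Icc_self hy)).trans (le_abs_self C)
      exact mul_le_mul (Real.exp_le_exp.2 h1)
        (mul_le_mul (hC' ξ) h2 (abs_nonneg _) hC0) (by positivity) (by positivity)
    · simp only [hz0 ξ hξ, norm_zero, zero_mul, mul_zero]
      positivity
  · by_cases hξ : ‖ξ‖ ∈ S
    · exact (hasDerivAt_amplitude (z := z ξ)
        (hasDerivAt_iteratedDerivWithin hab (hs _ hξ) j hy)).const_mul
          (Complex.exp ((rate lam ξ : ℂ) * t))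
    · simp only [waveJet, hz0 ξ hξ, zero_mul, mul_zero]
      exact hasDerivAt_const y _
  · rw [hfe x' y hy, ofReal_re_wave (fun ξ => by simp [rate])
      (fun ξ y => by simp [amplitude, hzn]), wave_eq_fourierInv]
    simp only [waveJet, iteratedDerivWithin_zero, amplitude]

theorem sobolevSq_le_of_jet {I : Set ℝ} (hI : IsOpen I) {f : Pt → ℝ} {F : ℕ → Pt → ℂ}
    (hF : IsFourierJet I k f F) {K : ℝ} (hK : 0 ≤ K) {W : Pt → ℝ}
    (hb : ∀ j ≤ k, ∀ x ∈ (univ : Set Plane) ×ˢ I,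
      (1 + ‖x.1‖ ^ 2) ^ (k - j) * ‖F j x‖ ^ 2 ≤ K * W x ^ 2) :
    sobolevSq I k f ≤ ENNReal.ofReal ((k + 1) * K) * ∫⁻ x in univ ×ˢ I, ENNReal.ofReal (W x ^ 2) := by
  rw [hF.sobolevSq_eq hI]
  have h1 : ∀ j ∈ Finset.range (k + 1),
      ∫⁻ x in univ ×ˢ I, ENNReal.ofReal ((1 + ‖x.1‖ ^ 2) ^ (k - j)) * ‖F j x‖ₑ ^ 2
        ≤ ENNReal.ofReal K * ∫⁻ x in univ ×ˢ I, ENNReal.ofReal (W x ^ 2) := by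
    intro j hj
    rw [← lintegral_const_mul' _ _ ENNReal.ofReal_ne_top]
    refine setLIntegral_mono' (MeasurableSet.univ.prod hI.measurableSet) fun x hx => ?_
    rw [← ofReal_norm, ← ENNReal.ofReal_pow (norm_nonneg _), ← ENNReal.ofReal_mul (by positivity),
      ← ENNReal.ofReal_mul hK]
    exact ENNReal.ofReal_le_ofReal (hb j (Nat.lt_succ_iff.1 (Finset.mem_range.1 hj)) x hx)
  refine (Finset.sum_le_sum h1).trans ?_
  rw [Finset.sum_const, Finset.card_range, nsmul_eq_mul, ENNReal.ofReal_mul (by positivity),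
    mul_assoc]
  gcongr
  rw [← ENNReal.ofReal_natCast]
  exact ENNReal.ofReal_le_ofReal (by push_cast; rfl)

/-- Only the term without vertical derivatives is kept, and its weight is at least `1`. -/
theorem le_sobolevSq_of_jet {I : Set ℝ} (hI : IsOpen I) {f : Pt → ℝ} {F : ℕ → Pt → ℂ}
    (hF : IsFourierJet I k f F) :
    ∫⁻ x in univ ×ˢ I, ‖F 0 x‖ₑ ^ 2 ≤ sobolevSq I k f := by
  rw [hF.sobolevSq_eq hI]
  refine le_trans ?_ (Finset.single_le_sum (fun _ _ => zero_le) (Finset.mem_range.2 k.succ_pos))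
  refine lintegral_mono fun x => ?_
  refine le_mul_of_one_le_left zero_le ?_
  rw [← ENNReal.ofReal_one]
  exact ENNReal.ofReal_le_ofReal (one_le_pow₀ (by nlinarith [sq_nonneg ‖x.1‖]))

theorem sobolevSq_le_sobolevSq_of_jet {I : Set ℝ} (hI : IsOpen I) {f f' : Pt → ℝ}
    {F F' : ℕ → Pt → ℂ} (hF : IsFourierJet I k f F) (hF' : IsFourierJet I k f' F')
    (hle : ∀ j x, ‖F j x‖ ≤ ‖F' j x‖) : sobolevSq I k f ≤ sobolevSq I k f' := by
  rw [hF.sobolevSq_eq hI, hF'.sobolevSq_eq hI]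
  refine Finset.sum_le_sum fun j _ => lintegral_mono fun x => ?_
  have : ‖F j x‖ₑ ≤ ‖F' j x‖ₑ := by
    rw [← ofReal_norm, ← ofReal_norm]; exact ENNReal.ofReal_le_ofReal (hle j x)
  gcongr

/-- On the annulus the Fourier weight is at most `(1 + (R + 1)²) ^ k`, and every derivative of the
profile is controlled by the same weight `w`. The norm is thus a constant times one integral,
independent of the order and of the component. -/
theorem sobolevSq_waveJet_le {ε Cz Ch : ℝ} (hR : 0 ≤ R) {w : ℝ → ℝ → ℝ}
    (hM : ∀ r, |lam r| ≤ M) {f : Pt → ℝ}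
    (hF : IsFourierJet (Ioo a b) k f (waveJet lam t z h (Icc a b)))
    (hz : ∀ ξ, ‖z ξ‖ ≤ Cz * bump R ε ξ)
    (hh : ∀ j ≤ k, ∀ r ∈ Icc R (R + 1), ∀ y ∈ Icc a b,
      |iteratedDerivWithin j (h r) (Icc a b) y| ≤ Ch * w r y) :
    sobolevSq (Ioo a b) k f
      ≤ ENNReal.ofReal ((k + 1) * ((1 + (R + 1) ^ 2) ^ k * (Real.exp (M * |t|) * (Cz * Ch)) ^ 2))
        * ∫⁻ x in univ ×ˢ Ioo a b, ENNReal.ofReal ((bump R ε x.1 * w ‖x.1‖ x.2) ^ 2) := by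
  refine sobolevSq_le_of_jet isOpen_Ioo hF (by positivity) fun j hj x hx => ?_
  by_cases hξ : ‖x.1‖ ∈ Icc R (R + 1)
  swap
  · have h0 := hz x.1
    rw [bump_eq_zero hξ, mul_zero] at h0
    simp [norm_waveJet, norm_le_zero_iff.1 h0, bump_eq_zero hξ]
  have h1 : lam ‖x.1‖ * t ≤ M * |t| :=
    (le_abs_self _).trans (by rw [abs_mul]; gcongr; exact hM _)
  have h2 : ‖waveJet lam t z h (Icc a b) j x‖
      ≤ Real.exp (M * |t|) * (Cz * Ch) * (bump R ε x.1 * w ‖x.1‖ x.2) := by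
    have := hh j hj _ hξ x.2 (Ioo_subset_Icc_self hx.2)
    have h3 := (norm_nonneg _).trans (hz x.1)
    calc _ = _ := norm_waveJet ..
      _ ≤ Real.exp (M * |t|) * ((Cz * bump R ε x.1) * (Ch * w ‖x.1‖ x.2)) := by
        gcongr
        exact hz _
      _ = _ := by ring
  have h4 : (1 + ‖x.1‖ ^ 2) ^ (k - j) ≤ (1 + (R + 1) ^ 2) ^ k := by
    refine (pow_le_pow_left₀ (by positivity) (b := 1 + (R + 1) ^ 2) ?_ _).trans
      (pow_le_pow_right₀ (by nlinarith [sq_nonneg (R + 1)]) (Nat.sub_le _ _))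
    gcongr
    exact hξ.2
  calc _ ≤ (1 + (R + 1) ^ 2) ^ k
        * (Real.exp (M * |t|) * (Cz * Ch) * (bump R ε x.1 * w ‖x.1‖ x.2)) ^ 2 := by gcongr
    _ = _ := by ring

end

/-! ### Bounds for the vertical profiles -/

section

variable {g Ω m l : ℝ} {p ρ₀ : Layer → ℝ → ℝ}

/-- The size of a mode, which controls all its vertical derivatives. -/
def modeWeight (Φ Ψ : Layer → ℝ → ℝ → ℝ) (s : Layer) (r y : ℝ) : ℝ := |Φ s r y| + |Ψ s r y|

theorem modeWeight_nonneg (Φ Ψ : Layer → ℝ → ℝ → ℝ) (s : Layer) (r y : ℝ) :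
    0 ≤ modeWeight Φ Ψ s r y := by
  unfold modeWeight
  positivity

/-- The vertical profiles of a family of modes, with `κ` times the pressure perturbation for the
density perturbation, are smooth in the layer `s`, with derivatives up to the order `n` bounded by
multiples of the weight. -/
structure HasSmoothProfiles (g m l R C : ℝ) (lam : ℝ → ℝ) (Φ Ψ : Layer → ℝ → ℝ → ℝ)
    (κ : Layer → ℝ → ℝ) (n : ℕ) (s : Layer) : Prop where
  smooth_eta : ∀ r ∈ Icc R (R + 1), ∀ i,
    ContDiffOn ℝ ∞ (etaPot (Φ s) (Ψ s) i r) (s.closedInterval m l)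
  smooth_pres : ∀ r ∈ Icc R (R + 1),
    ContDiffOn ℝ ∞ (fun y => κ s y * presPot g lam (Φ s) (Ψ s) r y) (s.closedInterval m l)
  bound_eta : ∀ j ≤ n, ∀ r ∈ Icc R (R + 1), ∀ y ∈ s.closedInterval m l, ∀ i,
    |iteratedDerivWithin j (etaPot (Φ s) (Ψ s) i r) (s.closedInterval m l) y|
      ≤ C * ((R + 1) ^ 2) ^ n * modeWeight Φ Ψ s r y
  bound_pres : ∀ j ≤ n, ∀ r ∈ Icc R (R + 1), ∀ y ∈ s.closedInterval m l,
    |iteratedDerivWithin j (fun y => κ s y * presPot g lam (Φ s) (Ψ s) r y)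
      (s.closedInterval m l) y| ≤ C * ((R + 1) ^ 2) ^ n * modeWeight Φ Ψ s r y

/-- Both parameters `λ²` and `waveNumberSq` of the profile equation are at most `(R + 1)²`, so
`exists_bound_of_system` applies with this bound. The constant `C` is fixed before the family of
modes: `L` tends to infinity later. -/
theorem exists_hasSmoothProfiles (hρ : IsSteadyState g m l p ρ₀) (hp : ∀ s, IsPressureLaw (p s))
    (hm : 0 < m) (hl : 0 < l) {κ : Layer → ℝ → ℝ}
    (hκ : ∀ s, ∀ y ∈ s.closedInterval m l, κ s y = ρ₀ s y / soundSq p ρ₀ s y) (n : ℕ)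
    (s : Layer) :
    ∃ C : ℝ, 0 ≤ C ∧ ∀ {L R : ℝ} {lam : ℝ → ℝ} {Φ Φ' Ψ Ψ' : Layer → ℝ → ℝ → ℝ},
      ModeFamily g Ω m l p ρ₀ L R lam Φ Φ' Ψ Ψ' → 1 ≤ L → 0 ≤ R →
      HasSmoothProfiles g m l R C lam Φ Ψ κ n s := by
  have hab := s.bot_lt_top hm hl
  have hI : s.closedInterval m l = Icc (s.bot m) (s.top l) := rfl
  have hU : UniqueDiffOn ℝ (s.closedInterval m l) := uniqueDiffOn_Icc hab
  have hc := hρ.contDiffOn_soundSq hp hm hl s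
  have hc0 : ∀ y ∈ s.closedInterval m l, soundSq p ρ₀ s y ≠ 0 := fun y hy =>
    (hρ.soundSq_pos hp s hy).ne'
  have hα : ContDiffOn ℝ ∞ (fun y => g / soundSq p ρ₀ s y) (s.closedInterval m l) :=
    contDiffOn_const.div hc hc0
  have hβ : ContDiffOn ℝ ∞ (fun y => 1 / soundSq p ρ₀ s y) (s.closedInterval m l) :=
    contDiffOn_const.div hc hc0
  have hκs : ContDiffOn ℝ ∞ (κ s) (s.closedInterval m l) :=
    ((hρ.contDiffOn hp hm hl s).div hc hc0).congr (hκ s)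
  obtain ⟨C, hC0, hC⟩ := exists_bound_of_system hab hα hβ n
  obtain ⟨A, hA0, hA⟩ := exists_bound_iteratedDerivWithin hab hκs n
  -- The second summand is for the density perturbation: Leibniz' rule with `κ`, and `1 + |g|`
  -- because `|g λ⁻²| ≤ |g|`.
  refine ⟨C + 2 ^ n * (A * ((1 + |g|) * C)), by positivity, fun {L R lam Φ Φ' Ψ Ψ'} h hL hR => ?_⟩
  set B := (R + 1) ^ 2 with hB
  have hB1 : 1 ≤ B := one_le_pow₀ (by linarith)
  have hlam : ∀ r, |lam r ^ 2| ≤ B := fun r => by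
    rw [abs_of_nonneg (sq_nonneg _)]
    exact pow_le_pow_left₀ (by linarith [(h.lam_mem r).1]) (h.lam_mem r).2 2
  have hν : ∀ r ∈ Icc R (R + 1), |waveNumberSq Ω r (lam r)| ≤ B := fun r hr => by
    rw [abs_of_nonneg (waveNumberSq_nonneg _ _ _)]
    exact (waveNumberSq_le (by linarith [(h.lam_mem r).1])).trans
      (pow_le_pow_left₀ (hR.trans hr.1) hr.2 2)
  have h1 : ∀ r ∈ Icc R (R + 1), ∀ y ∈ s.closedInterval m l,
      HasDerivWithinAt (Φ s r) (Ψ s r y) (s.closedInterval m l) y := fun r hr y hy => by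
    rw [← h.Φ'_eq s r hr y hy]
    exact (h.deriv_Φ s r y).hasDerivWithinAt
  have h2 : ∀ r ∈ Icc R (R + 1), ∀ y ∈ s.closedInterval m l, HasDerivWithinAt (Ψ s r)
      (g / soundSq p ρ₀ s y * Ψ s r y
        + (lam r ^ 2 * (1 / soundSq p ρ₀ s y) + waveNumberSq Ω r (lam r)) * Φ s r y)
      (s.closedInterval m l) y := fun r hr y hy => by
    rw [← h.Ψ'_eq s r hr y hy]
    exact (h.deriv_Ψ s r y).hasDerivWithinAt
  have hsm := fun r hr => contDiffOn_of_system hab hα hβ (h1 r hr) (h2 r hr)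
  have hbd := fun r hr => hC B hB1 _ _ (hlam r) (hν r hr) _ _ (h1 r hr) (h2 r hr)
  have hpres : ∀ r ∈ Icc R (R + 1),
      ContDiffOn ℝ ∞ (presPot g lam (Φ s) (Ψ s) r) (s.closedInterval m l) := fun r hr =>
    (hsm r hr).1.add (contDiffOn_const.mul (hsm r hr).2)
  have hpbd : ∀ r ∈ Icc R (R + 1), ∀ i ≤ n, ∀ y ∈ s.closedInterval m l,
      |iteratedDerivWithin i (presPot g lam (Φ s) (Ψ s) r) (s.closedInterval m l) y|
        ≤ (1 + |g|) * C * B ^ n * modeWeight Φ Ψ s r y := by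
    intro r hr i hi y hy
    have hle : (i : ℕ∞ω) ≤ (∞ : ℕ∞ω) := by exact_mod_cast le_top
    have e1 := iteratedDerivWithin_fun_add (n := i) hy hU (((hsm r hr).1 y hy).of_le hle)
      (((contDiffOn_const (c := g * (lam r ^ 2)⁻¹)).mul (hsm r hr).2 y hy).of_le hle)
    rw [show presPot g lam (Φ s) (Ψ s) r = fun y => Φ s r y + g * (lam r ^ 2)⁻¹ * Ψ s r y from rfl,
      e1, iteratedDerivWithin_const_mul_field]
    have hl1 : 1 ≤ lam r ^ 2 := one_le_pow₀ (hL.trans (h.lam_mem r).1)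
    have hg : |g * (lam r ^ 2)⁻¹| ≤ |g| := by
      rw [abs_mul, abs_of_pos (by positivity : 0 < (lam r ^ 2)⁻¹)]
      exact mul_le_of_le_one_right (abs_nonneg _) (inv_le_one_of_one_le₀ hl1)
    obtain ⟨b1, b2⟩ := hbd r hr i hi y hy
    calc _ ≤ _ := abs_add_le _ _
      _ ≤ C * B ^ n * modeWeight Φ Ψ s r y + |g| * (C * B ^ n * modeWeight Φ Ψ s r y) := by
        rw [abs_mul]
        exact add_le_add b1 (mul_le_mul hg b2 (abs_nonneg _) (abs_nonneg _))
      _ = _ := by ring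
  have hw := modeWeight_nonneg Φ Ψ s
  have hB0 : 0 ≤ B := by positivity
  refine ⟨fun r hr i => ?_, fun r hr => hκs.mul (hpres r hr), fun j hj r hr y hy i => ?_,
    fun j hj r hr y hy => ?_⟩
  · fin_cases i
    exacts [(hsm r hr).1, (hsm r hr).1, (hsm r hr).2]
  · have hle : C * B ^ n * modeWeight Φ Ψ s r y
        ≤ (C + 2 ^ n * (A * ((1 + |g|) * C))) * B ^ n * modeWeight Φ Ψ s r y := by
      gcongr
      · exact hw r y
      · exact le_add_of_nonneg_right (by positivity)
    obtain ⟨b1, b2⟩ := hbd r hr j hj y hy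
    fin_cases i
    exacts [b1.trans hle, b1.trans hle, b2.trans hle]
  · refine (abs_iteratedDerivWithin_mul_le hab hκs (hpres r hr) hy
      (fun i hi => hA i (hi.trans hj) y hy) fun i hi => hpbd r hr i (hi.trans hj) y hy).trans ?_
    have hw' := hw r y
    calc _ ≤ 2 ^ n * (A * ((1 + |g|) * C * B ^ n * modeWeight Φ Ψ s r y)) := by
          gcongr
          norm_num
      _ = 2 ^ n * (A * ((1 + |g|) * C)) * B ^ n * modeWeight Φ Ψ s r y := by ring
      _ ≤ _ := by
        gcongr
        exact le_add_of_nonneg_left hC0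

theorem HasSmoothProfiles.mono {R C C' : ℝ} {lam : ℝ → ℝ} {Φ Ψ : Layer → ℝ → ℝ → ℝ}
    {κ : Layer → ℝ → ℝ} {n : ℕ} {s : Layer} (h : HasSmoothProfiles g m l R C lam Φ Ψ κ n s)
    (hC : C ≤ C') : HasSmoothProfiles g m l R C' lam Φ Ψ κ n s := by
  have hw := modeWeight_nonneg Φ Ψ s
  refine ⟨h.smooth_eta, h.smooth_pres, fun j hj r hr y hy i =>
    (h.bound_eta j hj r hr y hy i).trans ?_, fun j hj r hr y hy =>
    (h.bound_pres j hj r hr y hy).trans ?_⟩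
  all_goals
    have := hw r y
    gcongr

end

/-! ### Fourier jets and energy of the solutions -/

section

/-- A factor depending on the height alone can be moved into the profile, so that the density
perturbation has a jet of the same kind as the velocity. -/
theorem wave_mul_profile (μ : Plane → ℝ) (z : Plane → ℂ) (h : ℝ → ℝ → ℝ) (κ : ℝ → ℝ)
    (x : ℝ × Pt) :
    wave μ (amplitude z fun r y => κ y * h r y) x = κ x.2.2 * wave μ (amplitude z h) x := by
  rw [wave, wave, superpose, superpose, ← integral_const_mul]
  congr 1
  ext ζ
  simp only [amplitude]
  push_cast
  ring

theorem IsProfile.mul_left {h : ℝ → ℝ → ℝ} (hh : IsProfile h) {κ : ℝ → ℝ} (hκ : Continuous κ) :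
    IsProfile fun r y => κ y * h r y := by
  refine ⟨(hκ.measurable.comp measurable_snd).mul hh.measurable, fun r => hκ.mul (hh.continuous r),
    fun Y => ?_⟩
  obtain ⟨C, hC⟩ := hh.bounded Y
  obtain ⟨A, hA⟩ := (isCompact_Icc (a := -Y) (b := Y)).exists_bound_of_continuousOn
    hκ.continuousOn
  refine ⟨A * C, fun r y hy => ?_⟩
  have h1 : |κ y| ≤ A := hA y (abs_le.1 hy)
  rw [abs_mul]
  exact mul_le_mul h1 (hC r y hy) (abs_nonneg _) ((abs_nonneg _).trans h1)

variable {g Ω m l R ε L C t : ℝ} {p ρ₀ : Layer → ℝ → ℝ} {lam : ℝ → ℝ}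
  {Φ Φ' Ψ Ψ' : Layer → ℝ → ℝ → ℝ} {κ : Layer → ℝ → ℝ} {n : ℕ} {s : Layer}

theorem Layer.abs_le_of_mem (hm : 0 < m) (hl : 0 < l) {y : ℝ} (hy : y ∈ s.closedInterval m l) :
    |y| ≤ m + l := by
  cases s
  · have h1 : -m ≤ y := hy.1
    have h2 : y ≤ 0 := hy.2
    exact abs_le.2 ⟨by linarith, by linarith⟩
  · have h1 : 0 ≤ y := hy.1
    have h2 : y ≤ l := hy.2
    exact abs_le.2 ⟨by linarith, by linarith⟩

namespace ModeFamily

theorem exists_modeWeight_le (h : ModeFamily g Ω m l p ρ₀ L R lam Φ Φ' Ψ Ψ') (hm : 0 < m)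
    (hl : 0 < l) (s : Layer) :
    ∃ W : ℝ, ∀ r, ∀ y ∈ s.closedInterval m l, modeWeight Φ Ψ s r y ≤ W := by
  obtain ⟨A, hA⟩ := (h.profile_Φ s).bounded (m + l)
  obtain ⟨A', hA'⟩ := (h.profile_Ψ s).bounded (m + l)
  exact ⟨A + A', fun r y hy => add_le_add (hA r y (Layer.abs_le_of_mem hm hl hy))
    (hA' r y (Layer.abs_le_of_mem hm hl hy))⟩

theorem measurable_wave (h : ModeFamily g Ω m l p ρ₀ L R lam Φ Φ' Ψ Ψ') (hL : 1 ≤ L) (hR : 0 ≤ R)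
    {F F' : Plane → ℝ → ℂ} (hF : IsAmplitude (R + 1) F) (hF' : IsAmplitude (R + 1) F')
    (hd : ∀ ξ y, HasDerivAt (F ξ) (F' ξ y) y) (t : ℝ) :
    Measurable fun x => (wave (rate lam) F (t, x)).re := by
  have h1 := (contDiff_wave (by linarith) h.measurable_rate (h.abs_rate_le hL) hF hF' hd).continuous
  exact (Complex.continuous_re.comp (h1.comp (Continuous.prodMk_right t))).measurable

theorem abs_lam_le (h : ModeFamily g Ω m l p ρ₀ L R lam Φ Φ' Ψ Ψ') (hL : 1 ≤ L) (r : ℝ) :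
    |lam r| ≤ R + 1 := by
  rw [abs_of_nonneg (by linarith [(h.lam_mem r).1])]
  exact (h.lam_mem r).2

theorem isFourierJet_eta (h : ModeFamily g Ω m l p ρ₀ L R lam Φ Φ' Ψ Ψ') (hm : 0 < m) (hl : 0 < l)
    (hL : 1 ≤ L) (hR : 0 ≤ R) (hε : 0 ≤ ε) (hC : 0 ≤ C)
    (hS : HasSmoothProfiles g m l R C lam Φ Ψ κ n s) (t : ℝ) (i : Fin 3) :
    IsFourierJet (s.interval m l) n (fun x => (modeUnknowns g Ω R ε lam Φ Ψ κ).η s t x i)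
      (waveJet lam t (etaCoef Ω R ε lam i) (etaPot (Φ s) (Ψ s) i) (s.closedInterval m l)) := by
  obtain ⟨W, hW⟩ := h.exists_modeWeight_le hm hl s
  have zη := isCoefficient_etaCoef (Ω := Ω) hε hL h.measurable_lam h.lam_mem i
  refine isFourierJet_waveJet (S := Icc R (R + 1)) (s.bot_lt_top hm hl) h.measurable_lam
    (h.abs_lam_le hL) zη (fun ξ hξ => ?_) (etaCoef_neg i) (h.profile_etaPot s i)
    (fun r hr => hS.smooth_eta r hr i) (fun j hj => ⟨C * ((R + 1) ^ 2) ^ n * W, fun r hr y hy =>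
      (hS.bound_eta j hj r hr y hy i).trans ?_⟩) t
    (h.measurable_wave hL hR (zη.amplitude (h.profile_etaPot s i))
      (zη.amplitude (h.profile_etaPot' s i))
      (hasDerivAt_amplitude_profile (h.deriv_etaPot s i)) t) fun x' y _ => rfl
  · have := norm_etaCoef_le (Ω := Ω) hε hL h.lam_mem i ξ
    rwa [bump_eq_zero hξ, mul_zero, norm_le_zero_iff] at this
  · exact mul_le_mul_of_nonneg_left (hW r y hy) (by positivity)

theorem isFourierJet_vel (h : ModeFamily g Ω m l p ρ₀ L R lam Φ Φ' Ψ Ψ') (hm : 0 < m) (hl : 0 < l)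
    (hL : 1 ≤ L) (hR : 0 ≤ R) (hε : 0 ≤ ε) (hC : 0 ≤ C)
    (hS : HasSmoothProfiles g m l R C lam Φ Ψ κ n s) (t : ℝ) (i : Fin 3) :
    IsFourierJet (s.interval m l) n (fun x => (modeUnknowns g Ω R ε lam Φ Ψ κ).v s t x i)
      (waveJet lam t (velCoef Ω R ε lam i) (etaPot (Φ s) (Ψ s) i) (s.closedInterval m l)) := by
  obtain ⟨W, hW⟩ := h.exists_modeWeight_le hm hl s
  have zv := h.coef_vel (Ω := Ω) hL hε i
  refine isFourierJet_waveJet (S := Icc R (R + 1)) (s.bot_lt_top hm hl) h.measurable_lam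
    (h.abs_lam_le hL) zv (fun ξ hξ => ?_) (velCoef_neg i) (h.profile_etaPot s i)
    (fun r hr => hS.smooth_eta r hr i) (fun j hj => ⟨C * ((R + 1) ^ 2) ^ n * W, fun r hr y hy =>
      (hS.bound_eta j hj r hr y hy i).trans ?_⟩) t
    (h.measurable_wave hL hR (zv.amplitude (h.profile_etaPot s i))
      (zv.amplitude (h.profile_etaPot' s i))
      (hasDerivAt_amplitude_profile (h.deriv_etaPot s i)) t) fun x' y _ => rfl
  · have := norm_etaCoef_le (Ω := Ω) hε hL h.lam_mem i ξ
    rw [bump_eq_zero hξ, mul_zero, norm_le_zero_iff] at this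
    rw [velCoef, this, mul_zero]
  · exact mul_le_mul_of_nonneg_left (hW r y hy) (by positivity)

theorem isFourierJet_pres (h : ModeFamily g Ω m l p ρ₀ L R lam Φ Φ' Ψ Ψ') (hm : 0 < m)
    (hl : 0 < l) (hL : 1 ≤ L) (hR : 0 ≤ R) (hε : 0 ≤ ε) (hC : 0 ≤ C) (hκ : Continuous (κ s))
    (hS : HasSmoothProfiles g m l R C lam Φ Ψ κ n s) (t : ℝ) :
    IsFourierJet (s.interval m l) n (fun x => (modeUnknowns g Ω R ε lam Φ Ψ κ).q s t x)
      (waveJet lam t (presCoef R ε lam) (fun r y => κ s y * presPot g lam (Φ s) (Ψ s) r y)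
        (s.closedInterval m l)) := by
  obtain ⟨W, hW⟩ := h.exists_modeWeight_le hm hl s
  have zq := isCoefficient_presCoef hε hL h.measurable_lam h.lam_mem
  have hP := isProfile_presPot (g := g) h.measurable_lam hL h.lam_mem
    (h.profile_Φ s) (h.profile_Ψ s)
  have hP' := isProfile_presPot (g := g) h.measurable_lam hL h.lam_mem
    (h.profile_Φ' s) (h.profile_Ψ' s)
  refine isFourierJet_waveJet (S := Icc R (R + 1)) (s.bot_lt_top hm hl) h.measurable_lam
    (h.abs_lam_le hL) zq (fun ξ hξ => ?_) presCoef_neg (hP.mul_left hκ)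
    (fun r hr => hS.smooth_pres r hr) (fun j hj => ⟨C * ((R + 1) ^ 2) ^ n * W, fun r hr y hy =>
      (hS.bound_pres j hj r hr y hy).trans ?_⟩) t
    ((hκ.measurable.comp measurable_snd).mul (h.measurable_wave hL hR (zq.amplitude hP)
      (zq.amplitude hP') (hasDerivAt_amplitude_profile (h.deriv_presPot s)) t)) fun x' y _ => ?_
  · have := norm_presCoef_le hε hL h.lam_mem ξ
    rwa [bump_eq_zero hξ, norm_le_zero_iff] at this
  · exact mul_le_mul_of_nonneg_left (hW r y hy) (by positivity)
  · rw [wave_mul_profile, Complex.re_ofReal_mul]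
    rfl

end ModeFamily

/-- The energy to which the Sobolev norms of a superposition of modes are compared. -/
def modeEnergy (m l R ε : ℝ) (Φ Ψ : Layer → ℝ → ℝ → ℝ) (s : Layer) : ℝ≥0∞ :=
  ∫⁻ x in univ ×ˢ s.interval m l,
    ENNReal.ofReal ((bump R ε x.1 * modeWeight Φ Ψ s ‖x.1‖ x.2) ^ 2)

theorem modeEnergy_eq_mul (m l R ε : ℝ) (Φ Ψ : Layer → ℝ → ℝ → ℝ) (s : Layer) :
    modeEnergy m l R ε Φ Ψ s = ENNReal.ofReal (ε ^ 2) * modeEnergy m l R 1 Φ Ψ s := by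
  rw [modeEnergy, modeEnergy, ← lintegral_const_mul' _ _ ENNReal.ofReal_ne_top]
  congr 1
  ext x
  rw [← ENNReal.ofReal_mul (sq_nonneg _)]
  congr 1
  by_cases hξ : ‖x.1‖ ∈ Icc R (R + 1)
  · rw [bump_eq hξ, bump_eq hξ]
    ring
  · rw [bump_eq_zero hξ, bump_eq_zero hξ]
    ring

/-! ### The energy is finite and not zero. -/

namespace ModeFamily

theorem modeEnergy_lt_top (h : ModeFamily g Ω m l p ρ₀ L R lam Φ Φ' Ψ Ψ') (hm : 0 < m)
    (hl : 0 < l) (s : Layer) : modeEnergy m l R 1 Φ Ψ s < ⊤ := by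
  obtain ⟨W, hW⟩ := h.exists_modeWeight_le hm hl s
  have hmeas : MeasurableSet (Metric.closedBall (0 : Plane) (R + 1) ×ˢ s.interval m l) :=
    Metric.isClosed_closedBall.measurableSet.prod measurableSet_Ioo
  have h1 : modeEnergy m l R 1 Φ Ψ s ≤ ∫⁻ x : Pt,
      (Metric.closedBall (0 : Plane) (R + 1) ×ˢ s.interval m l).indicator
        (fun _ => ENNReal.ofReal (W ^ 2)) x := by
    have hI : MeasurableSet ((univ : Set Plane) ×ˢ s.interval m l) :=
      MeasurableSet.univ.prod measurableSet_Ioo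
    rw [modeEnergy, ← lintegral_indicator hI]
    refine lintegral_mono fun x => ?_
    by_cases hx : x ∈ (univ : Set Plane) ×ˢ s.interval m l
    · rw [indicator_of_mem hx]
      by_cases hξ : ‖x.1‖ ∈ Icc R (R + 1)
      · have hx' : x ∈ Metric.closedBall (0 : Plane) (R + 1) ×ˢ s.interval m l :=
          ⟨by simpa using hξ.2, hx.2⟩
        rw [indicator_of_mem hx', bump_eq hξ, one_mul]
        exact ENNReal.ofReal_le_ofReal (pow_le_pow_left₀ (modeWeight_nonneg ..)
          (hW _ _ (Ioo_subset_Icc_self hx.2)) 2)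
      · rw [bump_eq_zero hξ]
        simp
    · rw [indicator_of_notMem hx]
      exact zero_le
  refine h1.trans_lt ?_
  rw [lintegral_indicator_const hmeas, Measure.volume_eq_prod, Measure.prod_prod]
  exact ENNReal.mul_lt_top ENNReal.ofReal_lt_top
    (ENNReal.mul_lt_top measure_closedBall_lt_top measure_Ioo_lt_top)

/-- Zero energy would make the lower profile `Φ` vanish almost everywhere for some wave number in
the annulus, hence by continuity also at the wall, where it is positive. -/
theorem modeEnergy_ne_zero (h : ModeFamily g Ω m l p ρ₀ L R lam Φ Φ' Ψ Ψ') (hm : 0 < m)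
    (hR : 0 ≤ R) : modeEnergy m l R 1 Φ Ψ .lower ≠ 0 := by
  intro h0
  have hmw : Measurable fun x : Pt => modeWeight Φ Ψ .lower ‖x.1‖ x.2 := by
    have hn : Measurable fun x : Pt => (‖x.1‖, x.2) := measurable_fst.norm.prodMk measurable_snd
    have h1 := ((h.profile_Φ .lower).measurable.comp hn).abs
    exact h1.add ((h.profile_Ψ .lower).measurable.comp hn).abs
  have hmb : Measurable fun x : Pt => bump R 1 x.1 := (measurable_bump R 1).comp measurable_fst
  rw [modeEnergy, lintegral_eq_zero_iff (by fun_prop), Measure.volume_eq_prod,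
    ← Measure.prod_restrict, Measure.restrict_univ] at h0
  have h1 := Measure.ae_ae_of_ae_prod h0
  -- The ball of radius `1/2` about a point of norm `R + 1/2` lies in the annulus and has positive
  -- measure.
  have hpos : 0 < volume (Metric.ball (EuclideanSpace.single 0 (R + 1 / 2) : Plane) (1 / 2)) :=
    Metric.measure_ball_pos _ _ (by norm_num)
  obtain ⟨ξ, hξ, hz⟩ := Filter.Frequently.exists
    ((frequently_ae_mem_iff.2 hpos.ne').and_eventually h1)
  have hξ' : ‖ξ‖ ∈ Icc R (R + 1) := by
    have h2 : |‖ξ‖ - (R + 1 / 2)| ≤ 1 / 2 := by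
      have h3 := abs_norm_sub_norm_le ξ (EuclideanSpace.single 0 (R + 1 / 2))
      rw [PiLp.norm_single, Real.norm_of_nonneg (by linarith)] at h3
      exact h3.trans (le_of_lt (by simpa [dist_eq_norm] using hξ))
    rw [abs_le] at h2
    exact ⟨by linarith, by linarith⟩
  have hz' : (fun y => Φ .lower ‖ξ‖ y) =ᵐ[volume.restrict (Icc (-m) 0)] fun _ => 0 := by
    rw [restrict_Ioo_eq_restrict_Icc.symm]
    filter_upwards [hz] with y hy
    simp only [Pi.zero_apply, ENNReal.ofReal_eq_zero, bump_eq hξ', one_mul, modeWeight] at hy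
    have h4 := abs_nonneg (Φ .lower ‖ξ‖ y)
    have h5 := abs_nonneg (Ψ .lower ‖ξ‖ y)
    have h6 : |Φ .lower ‖ξ‖ y| = 0 := by nlinarith
    exact abs_eq_zero.1 h6
  have := Measure.eqOn_Icc_of_ae_eq volume (by linarith : (-m : ℝ) ≠ 0) hz'
    ((h.profile_Φ .lower).continuous ‖ξ‖).continuousOn continuousOn_const
    (left_mem_Icc.2 (by linarith))
  exact (h.nontrivial _ hξ').ne' this

end ModeFamily

end

/-! ### Bounds for the Sobolev norms -/

section

variable {g Ω m l R ε L C t : ℝ} {p ρ₀ : Layer → ℝ → ℝ} {lam : ℝ → ℝ}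
  {Φ Φ' Ψ Ψ' : Layer → ℝ → ℝ → ℝ} {κ : Layer → ℝ → ℝ} {n : ℕ} {s : Layer}

/-- The constant in the upper bound for the Sobolev norms of order `n` at the time `t`. -/
def upperConst (Ω R C t : ℝ) (n : ℕ) : ℝ :=
  (n + 1) * ((1 + (R + 1) ^ 2) ^ n
    * (Real.exp ((R + 1) * |t|) * ((1 + 2 * |Ω|) * (R + 1) ^ 2 * (C * ((R + 1) ^ 2) ^ n))) ^ 2)

/-- The constant in the lower bound for the norm in `L²` of the displacement at the time `t`. -/
def lowerConst (Ω R L t : ℝ) : ℝ :=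
  Real.exp (L * t) ^ 2 / (2 * (1 + 4 * Ω ^ 2) * (R + 1) ^ 6)

/-- By `(λξ₀ + 2Ωξ₁)² + (λξ₁ - 2Ωξ₀)² = (λ² + 4Ω²) |ξ|²` the horizontal coefficients together
control `Φ`, and the vertical one controls `Ψ`. Neither horizontal component suffices, as it may
vanish for some directions of `ξ`. The loss is a power of `R + 1`. -/
theorem sum_norm_sq_etaCoef_ge (hL : 1 ≤ L) (hR : 1 ≤ R) (hlam : ∀ r, lam r ∈ Icc L (R + 1))
    (ξ : Plane) (φ ψ : ℝ) :
    (bump R ε ξ * (|φ| + |ψ|)) ^ 2 / (2 * (1 + 4 * Ω ^ 2) * (R + 1) ^ 6)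
      ≤ (‖etaCoef Ω R ε lam 0 ξ‖ * |φ|) ^ 2 + (‖etaCoef Ω R ε lam 1 ξ‖ * |φ|) ^ 2
        + (‖etaCoef Ω R ε lam 2 ξ‖ * |ψ|) ^ 2 := by
  by_cases hξ : ‖ξ‖ ∈ Icc R (R + 1)
  swap
  · rw [bump_eq_zero hξ]
    simp only [zero_mul, ne_eq, OfNat.ofNat_ne_zero, not_false_eq_true, zero_pow, zero_div]
    positivity
  have h1 : 1 ≤ lam ‖ξ‖ := hL.trans (hlam _).1
  have h2 : lam ‖ξ‖ ≤ R + 1 := (hlam _).2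
  have hn : ξ 0 ^ 2 + ξ 1 ^ 2 = ‖ξ‖ ^ 2 := by
    rw [EuclideanSpace.real_norm_sq_eq, Fin.sum_univ_two]
  have e0 : ‖etaCoef Ω R ε lam 0 ξ‖ = |bump R ε ξ * ((lam ‖ξ‖ * ξ 0 + 2 * Ω * ξ 1)
      * (lam ‖ξ‖ ^ 2)⁻¹ * (lam ‖ξ‖ ^ 2 + 4 * Ω ^ 2)⁻¹)| := norm_neg_I_mul_ofReal _
  have e1 : ‖etaCoef Ω R ε lam 1 ξ‖ = |bump R ε ξ * ((lam ‖ξ‖ * ξ 1 - 2 * Ω * ξ 0)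
      * (lam ‖ξ‖ ^ 2)⁻¹ * (lam ‖ξ‖ ^ 2 + 4 * Ω ^ 2)⁻¹)| := norm_neg_I_mul_ofReal _
  have e2 : ‖etaCoef Ω R ε lam 2 ξ‖ = |bump R ε ξ * (lam ‖ξ‖ ^ 3)⁻¹| := by
    change ‖-((_ : ℝ) : ℂ)‖ = _
    rw [norm_neg, Complex.norm_real, Real.norm_eq_abs]
  rw [e0, e1, e2, mul_pow, mul_pow _ |φ|, mul_pow _ |φ|, mul_pow _ |ψ|, sq_abs, sq_abs, sq_abs,
    sq_abs, sq_abs]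
  generalize lam ‖ξ‖ = x at h1 h2
  generalize bump R ε ξ = b
  have hx : 0 < x := by linarith
  have hr : 1 ≤ ‖ξ‖ ^ 2 := one_le_pow₀ (hR.trans hξ.1)
  have hx6 : x ^ 6 ≤ (R + 1) ^ 6 := pow_le_pow_left₀ hx.le h2 6
  have hd : 0 < x ^ 2 + 4 * Ω ^ 2 := by positivity
  have hd' : x ^ 4 * (x ^ 2 + 4 * Ω ^ 2) ≤ (1 + 4 * Ω ^ 2) * (R + 1) ^ 6 := by
    have h3 : x ^ 4 * 1 ≤ x ^ 4 * x ^ 2 := by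
      have := one_le_pow₀ h1 (n := 2)
      gcongr
    nlinarith [sq_nonneg Ω]
  have hE : x ^ 6 ≤ (1 + 4 * Ω ^ 2) * (R + 1) ^ 6 := by nlinarith [sq_nonneg Ω, pow_pos hx 6]
  set E := (1 + 4 * Ω ^ 2) * (R + 1) ^ 6 with hEdef
  have hE0 : 0 < E := by positivity
  have f1 : 1 / E ≤ ‖ξ‖ ^ 2 / (x ^ 4 * (x ^ 2 + 4 * Ω ^ 2)) :=
    div_le_div₀ (by positivity) hr (by positivity) hd'
  have f2 : 1 / E ≤ 1 / x ^ 6 := one_div_le_one_div_of_le (by positivity) hE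
  have f3 : (b * ((x * ξ 0 + 2 * Ω * ξ 1) * (x ^ 2)⁻¹ * (x ^ 2 + 4 * Ω ^ 2)⁻¹)) ^ 2 * φ ^ 2
      + (b * ((x * ξ 1 - 2 * Ω * ξ 0) * (x ^ 2)⁻¹ * (x ^ 2 + 4 * Ω ^ 2)⁻¹)) ^ 2 * φ ^ 2
      = b ^ 2 * φ ^ 2 * (‖ξ‖ ^ 2 / (x ^ 4 * (x ^ 2 + 4 * Ω ^ 2))) := by
    rw [← hn]
    field_simp
    ring
  have f4 : (b * (x ^ 3)⁻¹) ^ 2 * ψ ^ 2 = b ^ 2 * ψ ^ 2 * (1 / x ^ 6) := by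
    field_simp
  rw [f3, f4]
  have f5 : (|φ| + |ψ|) ^ 2 ≤ 2 * (φ ^ 2 + ψ ^ 2) := by
    rw [← sq_abs φ, ← sq_abs ψ]
    nlinarith [sq_nonneg (|φ| - |ψ|)]
  calc b ^ 2 * (|φ| + |ψ|) ^ 2 / (2 * (1 + 4 * Ω ^ 2) * (R + 1) ^ 6)
      = b ^ 2 * (|φ| + |ψ|) ^ 2 / 2 * (1 / E) := by rw [hEdef]; field_simp
    _ ≤ b ^ 2 * (2 * (φ ^ 2 + ψ ^ 2)) / 2 * (1 / E) := by gcongr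
    _ = b ^ 2 * φ ^ 2 * (1 / E) + b ^ 2 * ψ ^ 2 * (1 / E) := by ring
    _ ≤ _ := by gcongr

namespace ModeFamily

theorem sobolevSq_eta_le (h : ModeFamily g Ω m l p ρ₀ L R lam Φ Φ' Ψ Ψ') (hm : 0 < m) (hl : 0 < l)
    (hL : 1 ≤ L) (hR : 0 ≤ R) (hε : 0 ≤ ε) (hC : 0 ≤ C)
    (hS : HasSmoothProfiles g m l R C lam Φ Ψ κ n s) (t : ℝ) (i : Fin 3) :
    sobolevSq (s.interval m l) n (fun x => (modeUnknowns g Ω R ε lam Φ Ψ κ).η s t x i)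
      ≤ ENNReal.ofReal (upperConst Ω R C t n) * modeEnergy m l R ε Φ Ψ s := by
  refine sobolevSq_waveJet_le hR (h.abs_lam_le hL)
    (h.isFourierJet_eta hm hl hL hR hε hC hS t i) (fun ξ => ?_)
    fun j hj r hr y hy => hS.bound_eta j hj r hr y hy i
  refine (norm_etaCoef_le hε hL h.lam_mem i ξ).trans ?_
  have := bump_nonneg hε ξ (R := R)
  gcongr
  -- One power of `R + 1` would do here. The second is needed for the velocity, which carries the
  -- factor `λ`, and one constant serves all the unknowns.
  nlinarith

theorem norm_etaCoef_le_norm_velCoef (h : ModeFamily g Ω m l p ρ₀ L R lam Φ Φ' Ψ Ψ') (hL : 1 ≤ L)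
    (i : Fin 3) (ξ : Plane) : ‖etaCoef Ω R ε lam i ξ‖ ≤ ‖velCoef Ω R ε lam i ξ‖ := by
  have h1 : 1 ≤ lam ‖ξ‖ := hL.trans (h.lam_mem _).1
  rw [velCoef, norm_mul, Complex.norm_real, Real.norm_of_nonneg (by linarith)]
  exact le_mul_of_one_le_left (norm_nonneg _) h1

theorem sobolevSq_vel_le (h : ModeFamily g Ω m l p ρ₀ L R lam Φ Φ' Ψ Ψ') (hm : 0 < m) (hl : 0 < l)
    (hL : 1 ≤ L) (hR : 0 ≤ R) (hε : 0 ≤ ε) (hC : 0 ≤ C)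
    (hS : HasSmoothProfiles g m l R C lam Φ Ψ κ n s) (t : ℝ) (i : Fin 3) :
    sobolevSq (s.interval m l) n (fun x => (modeUnknowns g Ω R ε lam Φ Ψ κ).v s t x i)
      ≤ ENNReal.ofReal (upperConst Ω R C t n) * modeEnergy m l R ε Φ Ψ s := by
  refine sobolevSq_waveJet_le hR (h.abs_lam_le hL)
    (h.isFourierJet_vel hm hl hL hR hε hC hS t i) (fun ξ => ?_)
    fun j hj r hr y hy => hS.bound_eta j hj r hr y hy i
  rw [velCoef, norm_mul, Complex.norm_real]
  calc _ ≤ (R + 1) * ((1 + 2 * |Ω|) * (R + 1) * bump R ε ξ) :=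
        mul_le_mul (h.abs_lam_le hL _) (norm_etaCoef_le hε hL h.lam_mem i ξ) (norm_nonneg _)
          (by linarith)
    _ = _ := by ring

theorem sobolevSq_pres_le (h : ModeFamily g Ω m l p ρ₀ L R lam Φ Φ' Ψ Ψ') (hm : 0 < m) (hl : 0 < l)
    (hL : 1 ≤ L) (hR : 0 ≤ R) (hε : 0 ≤ ε) (hC : 0 ≤ C) (hκ : Continuous (κ s))
    (hS : HasSmoothProfiles g m l R C lam Φ Ψ κ n s) (t : ℝ) :
    sobolevSq (s.interval m l) n (fun x => (modeUnknowns g Ω R ε lam Φ Ψ κ).q s t x)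
      ≤ ENNReal.ofReal (upperConst Ω R C t n) * modeEnergy m l R ε Φ Ψ s := by
  refine sobolevSq_waveJet_le hR (h.abs_lam_le hL)
    (h.isFourierJet_pres hm hl hL hR hε hC hκ hS t) (fun ξ => ?_)
    fun j hj r hr y hy => hS.bound_pres j hj r hr y hy
  refine (norm_presCoef_le hε hL h.lam_mem ξ).trans
    (le_mul_of_one_le_left (bump_nonneg hε ξ) ?_)
  have h1 : 1 ≤ (R + 1) ^ 2 := one_le_pow₀ (by linarith)
  nlinarith [abs_nonneg Ω]

theorem sobolevSq_eta_le_vel (h : ModeFamily g Ω m l p ρ₀ L R lam Φ Φ' Ψ Ψ') (hm : 0 < m)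
    (hl : 0 < l) (hL : 1 ≤ L) (hR : 0 ≤ R) (hε : 0 ≤ ε) (hC : 0 ≤ C)
    (hS : HasSmoothProfiles g m l R C lam Φ Ψ κ n s) (t : ℝ) (i : Fin 3) :
    sobolevSq (s.interval m l) n (fun x => (modeUnknowns g Ω R ε lam Φ Ψ κ).η s t x i)
      ≤ sobolevSq (s.interval m l) n (fun x => (modeUnknowns g Ω R ε lam Φ Ψ κ).v s t x i) := by
  refine sobolevSq_le_sobolevSq_of_jet isOpen_Ioo (h.isFourierJet_eta hm hl hL hR hε hC hS t i)
    (h.isFourierJet_vel hm hl hL hR hε hC hS t i) fun j x => ?_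
  rw [norm_waveJet, norm_waveJet]
  have := h.norm_etaCoef_le_norm_velCoef (Ω := Ω) (ε := ε) hL i x.1
  gcongr

/-- The `L²` norm alone suffices: the lower bound is the same for every order `n`. Nonnegative time
is needed for `exp (λ t) ≥ exp (L t)`. -/
theorem le_sum_sobolevSq_eta (h : ModeFamily g Ω m l p ρ₀ L R lam Φ Φ' Ψ Ψ') (hm : 0 < m)
    (hl : 0 < l) (hL : 1 ≤ L) (hR : 1 ≤ R) (hε : 0 ≤ ε) (hC : 0 ≤ C)
    (hS : HasSmoothProfiles g m l R C lam Φ Ψ κ n s) (ht : 0 ≤ t) :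
    ENNReal.ofReal (lowerConst Ω R L t) * modeEnergy m l R ε Φ Ψ s
      ≤ ∑ i, sobolevSq (s.interval m l) n
        (fun x => (modeUnknowns g Ω R ε lam Φ Ψ κ).η s t x i) := by
  have hR0 : 0 ≤ R := by linarith
  have hJ := fun i => h.isFourierJet_eta (Ω := Ω) (ε := ε) hm hl hL hR0 hε hC hS t i
  refine le_trans ?_ (Finset.sum_le_sum fun i _ => le_sobolevSq_of_jet
    (I := s.interval m l) isOpen_Ioo (hJ i))
  rw [← lintegral_finsetSum' _ fun i _ =>
    ((hJ i).jet_memLp 0 (Nat.zero_le _)).1.enorm.pow_const 2, modeEnergy,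
    ← lintegral_const_mul' _ _ ENNReal.ofReal_ne_top]
  refine lintegral_mono fun x => ?_
  simp only [← ofReal_norm, ← ENNReal.ofReal_pow (norm_nonneg _)]
  rw [← ENNReal.ofReal_sum_of_nonneg fun i _ => sq_nonneg _, ← ENNReal.ofReal_mul (by
    unfold lowerConst; positivity), Fin.sum_univ_three]
  refine ENNReal.ofReal_le_ofReal ?_
  simp only [norm_waveJet, iteratedDerivWithin_zero, etaPot, Matrix.cons_val]
  have h1 := sum_norm_sq_etaCoef_ge (Ω := Ω) (ε := ε) hL hR h.lam_mem x.1 (Φ s ‖x.1‖ x.2)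
    (Ψ s ‖x.1‖ x.2)
  have h2 : Real.exp (L * t) ≤ Real.exp (lam ‖x.1‖ * t) :=
    Real.exp_le_exp.2 (mul_le_mul_of_nonneg_right (h.lam_mem _).1 ht)
  calc lowerConst Ω R L t * (bump R ε x.1 * modeWeight Φ Ψ s ‖x.1‖ x.2) ^ 2
      = Real.exp (L * t) ^ 2 * ((bump R ε x.1 * (|Φ s ‖x.1‖ x.2| + |Ψ s ‖x.1‖ x.2|)) ^ 2
          / (2 * (1 + 4 * Ω ^ 2) * (R + 1) ^ 6)) := by rw [lowerConst, modeWeight]; ring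
    _ ≤ Real.exp (lam ‖x.1‖ * t) ^ 2 * _ :=
      mul_le_mul (pow_le_pow_left₀ (Real.exp_pos _).le h2 2) h1 (by positivity) (by positivity)
    _ = _ := by ring

end ModeFamily

end

/-! ### Solutions with small data and large growth -/

section

variable {g Ω m l R ε L C t : ℝ} {p ρ₀ : Layer → ℝ → ℝ} {lam : ℝ → ℝ}
  {Φ Φ' Ψ Ψ' : Layer → ℝ → ℝ → ℝ} {κ : Layer → ℝ → ℝ} {n : ℕ}

theorem exists_sum_modeEnergy_eq (h : ModeFamily g Ω m l p ρ₀ L R lam Φ Φ' Ψ Ψ') (hm : 0 < m)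
    (hl : 0 < l) (hR : 0 ≤ R) {δ : ℝ} (hδ : 0 ≤ δ) :
    ∃ ε, 0 ≤ ε ∧ ∑ s, modeEnergy m l R ε Φ Ψ s = ENNReal.ofReal δ := by
  set E := ∑ s, modeEnergy m l R 1 Φ Ψ s with hE
  have h1 : E ≠ ⊤ := (ENNReal.sum_lt_top.2 fun s _ => h.modeEnergy_lt_top hm hl s).ne
  have h2 : E ≠ 0 := fun h0 => h.modeEnergy_ne_zero hm hR
    (Finset.sum_eq_zero_iff.1 h0 .lower (Finset.mem_univ _))
  have h3 : 0 < E.toReal := ENNReal.toReal_pos h2 h1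
  -- The energy is quadratic in the height `ε` of the cut-off.
  refine ⟨√(δ / E.toReal), Real.sqrt_nonneg _, ?_⟩
  simp only [modeEnergy_eq_mul m l R √(δ / E.toReal)]
  rw [← Finset.mul_sum, ← hE, Real.sq_sqrt (by positivity), ← ENNReal.ofReal_toReal h1,
    ← ENNReal.ofReal_mul (by positivity), ENNReal.toReal_ofReal h3.le, div_mul_cancel₀ _ h3.ne']

theorem ofReal_rpow_half {x : ℝ} (hx : 0 ≤ x) :
    ENNReal.ofReal x ^ (1 / 2 : ℝ) = ENNReal.ofReal √x := by
  rw [ENNReal.ofReal_rpow_of_nonneg hx (by norm_num), Real.sqrt_eq_rpow]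

theorem vectorNorm_le {u : Layer → Pt → Fin 3 → ℝ} {K δ : ℝ} {E : Layer → ℝ≥0∞} (hK : 0 ≤ K)
    (hδ : 0 ≤ δ) (hE : ∑ s, E s = ENNReal.ofReal δ)
    (h : ∀ s i, sobolevSq (s.interval m l) n (fun x => u s x i) ≤ ENNReal.ofReal K * E s) :
    vectorNorm m l n u ≤ ENNReal.ofReal √(3 * (K * δ)) := by
  rw [← ofReal_rpow_half (by positivity), vectorNorm]
  refine ENNReal.rpow_le_rpow ?_ (by norm_num)
  refine (Finset.sum_le_sum fun s _ => Finset.sum_le_sum fun i _ => h s i).trans (le_of_eq ?_)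
  simp only [Finset.sum_const, Finset.card_univ, Fintype.card_fin, nsmul_eq_mul]
  rw [← Finset.mul_sum, ← Finset.mul_sum, hE, ENNReal.ofReal_mul (by norm_num),
    ENNReal.ofReal_mul hK]
  norm_num

/-- The factor `3`, which counts components in `vectorNorm_le`, is superfluous here; it gives the
three norms a common bound. -/
theorem scalarNorm_le {u : Layer → Pt → ℝ} {K δ : ℝ} {E : Layer → ℝ≥0∞} (hK : 0 ≤ K)
    (hδ : 0 ≤ δ) (hE : ∑ s, E s = ENNReal.ofReal δ)
    (h : ∀ s, sobolevSq (s.interval m l) n (u s) ≤ ENNReal.ofReal K * E s) :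
    scalarNorm m l n u ≤ ENNReal.ofReal √(3 * (K * δ)) := by
  have h0 : 0 ≤ K * δ := by positivity
  refine le_trans ?_ (ENNReal.ofReal_le_ofReal
    (Real.sqrt_le_sqrt (by linarith : K * δ ≤ 3 * (K * δ))))
  rw [← ofReal_rpow_half h0, scalarNorm]
  refine ENNReal.rpow_le_rpow ((Finset.sum_le_sum fun s _ => h s).trans (le_of_eq ?_)) (by norm_num)
  rw [← Finset.mul_sum, hE, ENNReal.ofReal_mul hK]

theorem le_vectorNorm {u : Layer → Pt → Fin 3 → ℝ} {c δ a : ℝ} {E : Layer → ℝ≥0∞}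
    (hc : 0 ≤ c) (ha : a ^ 2 ≤ c * δ) (hE : ∑ s, E s = ENNReal.ofReal δ)
    (h : ∀ s, ENNReal.ofReal c * E s ≤ ∑ i, sobolevSq (s.interval m l) n (fun x => u s x i)) :
    ENNReal.ofReal a ≤ vectorNorm m l n u := by
  refine (ENNReal.ofReal_le_ofReal (Real.le_sqrt_of_sq_le ha)).trans ?_
  rw [← ofReal_rpow_half ((sq_nonneg a).trans ha), vectorNorm]
  refine ENNReal.rpow_le_rpow (le_trans (le_of_eq ?_) (Finset.sum_le_sum fun s _ => h s))
    (by norm_num)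
  rw [← Finset.mul_sum, hE, ENNReal.ofReal_mul hc]

theorem upperConst_zero_le {C : ℝ} (hR : 0 ≤ R) :
    upperConst Ω R C 0 n ≤ (n + 1) * 2 ^ n * ((1 + 2 * |Ω|) * C) ^ 2 * (R + 1) ^ (6 * n + 4) := by
  have h1 : (1 + (R + 1) ^ 2) ^ n ≤ (2 * (R + 1) ^ 2) ^ n :=
    pow_le_pow_left₀ (by positivity) (by nlinarith) n
  calc upperConst Ω R C 0 n = (n + 1) * ((1 + (R + 1) ^ 2) ^ n
        * ((1 + 2 * |Ω|) * (R + 1) ^ 2 * (C * ((R + 1) ^ 2) ^ n)) ^ 2) := by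
        simp [upperConst]
    _ ≤ (n + 1) * ((2 * (R + 1) ^ 2) ^ n
        * ((1 + 2 * |Ω|) * (R + 1) ^ 2 * (C * ((R + 1) ^ 2) ^ n)) ^ 2) := by gcongr
    _ = _ := by
      rw [mul_pow 2, ← pow_mul]
      ring

/-- With `R + 1 ≤ (γ + 1) L²` the quotient of the polynomial constants is at most a multiple of `L ^
(2 (6n + 10))`: the exponent `6n + 4` comes from the upper constant at time zero and `6` from the
lower one. It is beaten by `exp (2 T L)`, for any `T > 0`. -/
theorem eventually_upperConst_le {γ T : ℝ} (hγ : 0 ≤ γ) (hT : 0 < T) (c : ℝ) (hc : 0 ≤ c) :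
    ∀ᶠ L : ℝ in Filter.atTop,
      c * upperConst Ω (γ * L ^ 2) C 0 n ≤ lowerConst Ω (γ * L ^ 2) L T := by
  set A := c * ((n + 1) * 2 ^ n * ((1 + 2 * |Ω|) * C) ^ 2) * (2 * (1 + 4 * Ω ^ 2))
    * (γ + 1) ^ (6 * n + 10) with hA
  have hA0 : 0 ≤ A := by positivity
  have ho := (isLittleO_pow_exp_pos_mul_atTop (k := 2 * (6 * n + 10)) (by positivity : 0 < 2 * T)).bound
    (by positivity : 0 < (A + 1)⁻¹)
  filter_upwards [ho, Filter.eventually_ge_atTop 1] with L hL hL1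
  rw [Real.norm_of_nonneg (by positivity), Real.norm_of_nonneg (by positivity),
    ← div_eq_inv_mul, le_div_iff₀ (by positivity)] at hL
  have hR : 0 ≤ γ * L ^ 2 := by positivity
  have hB : γ * L ^ 2 + 1 ≤ (γ + 1) * L ^ 2 := by nlinarith
  rw [lowerConst, le_div_iff₀ (by positivity)]
  calc _ ≤ c * ((n + 1) * 2 ^ n * ((1 + 2 * |Ω|) * C) ^ 2 * (γ * L ^ 2 + 1) ^ (6 * n + 4))
        * (2 * (1 + 4 * Ω ^ 2) * (γ * L ^ 2 + 1) ^ 6) := by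
        gcongr
        exact upperConst_zero_le hR
    _ = c * ((n + 1) * 2 ^ n * ((1 + 2 * |Ω|) * C) ^ 2) * (2 * (1 + 4 * Ω ^ 2))
        * (γ * L ^ 2 + 1) ^ (6 * n + 10) := by ring
    _ ≤ c * ((n + 1) * 2 ^ n * ((1 + 2 * |Ω|) * C) ^ 2) * (2 * (1 + 4 * Ω ^ 2))
        * ((γ + 1) * L ^ 2) ^ (6 * n + 10) := by gcongr
    _ = L ^ (2 * (6 * n + 10)) * A := by
      rw [hA, mul_pow (γ + 1), ← pow_mul]
      ring
    _ ≤ L ^ (2 * (6 * n + 10)) * (A + 1) := by gcongr; linarith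
    _ ≤ Real.exp (2 * T * L) := hL
    _ = _ := by
      rw [← Real.exp_nat_mul]
      congr 1
      push_cast
      ring

theorem exists_hasSmoothProfiles_both (hρ : IsSteadyState g m l p ρ₀)
    (hp : ∀ s, IsPressureLaw (p s)) (hm : 0 < m) (hl : 0 < l) {κ : Layer → ℝ → ℝ}
    (hκ : ∀ s, ∀ y ∈ s.closedInterval m l, κ s y = ρ₀ s y / soundSq p ρ₀ s y) (n : ℕ) :
    ∃ C : ℝ, 0 < C ∧ ∀ {L R : ℝ} {lam : ℝ → ℝ} {Φ Φ' Ψ Ψ' : Layer → ℝ → ℝ → ℝ},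
      ModeFamily g Ω m l p ρ₀ L R lam Φ Φ' Ψ Ψ' → 1 ≤ L → 0 ≤ R →
      ∀ s, HasSmoothProfiles g m l R C lam Φ Ψ κ n s := by
  choose C hC0 hC using fun s => exists_hasSmoothProfiles (Ω := Ω) hρ hp hm hl hκ n s
  refine ⟨∑ s, C s + 1, add_pos_of_nonneg_of_pos (Finset.sum_nonneg fun s _ => hC0 s) one_pos,
    fun h hL hR s => (hC s h hL hR).mono ?_⟩
  linarith [Finset.single_le_sum (fun s _ => hC0 s) (Finset.mem_univ s)]

/-- For each `N ≥ 1` there is a superposition of growing modes with initial norms of size `1 / N`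
which exceeds the level `α` after the time `T`. -/
theorem exists_growing_solution (hg : 0 < g) (hm : 0 < m) (hl : 0 < l)
    (hp : ∀ s, IsPressureLaw (p s)) (hρ : IsSteadyState g m l p ρ₀) (k j : ℕ) {T α : ℝ}
    (hT : 0 < T) {N : ℕ} (hN : 1 ≤ N) :
    ∃ U : Unknowns, IsSolution g Ω m l p ρ₀ U ∧
      (∀ t : ℝ, 0 ≤ t → vectorNorm m l j (fun s => U.η s t) < ⊤ ∧
        vectorNorm m l j (fun s => U.v s t) < ⊤ ∧ scalarNorm m l j (fun s => U.q s t) < ⊤) ∧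
      vectorNorm m l j (fun s => U.η s 0) + vectorNorm m l j (fun s => U.v s 0)
        + scalarNorm m l j (fun s => U.q s 0) ≤ ENNReal.ofReal (1 / (N : ℝ)) ∧
      ∀ t : ℝ, T ≤ t →
        vectorNorm m l k (fun s => U.η s t) ≤ vectorNorm m l k (fun s => U.v s t) ∧
        ENNReal.ofReal α ≤ vectorNorm m l k (fun s => U.η s t) := by
  have hκ : ∀ s : Layer, ∃ κ : ℝ → ℝ, Continuous κ ∧
      ∀ y ∈ s.closedInterval m l, κ y = ρ₀ s y / soundSq p ρ₀ s y := fun s =>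
    exists_continuous_extension (s.bot_lt_top hm hl).le
      ((hρ.contDiffOn hp hm hl s).div (hρ.contDiffOn_soundSq hp hm hl s)
        fun y hy => (hρ.soundSq_pos hp s hy).ne').continuousOn
  choose κ hκc hκ using hκ
  obtain ⟨C, hC0, hC⟩ := exists_hasSmoothProfiles_both (Ω := Ω) hρ hp hm hl hκ j
  obtain ⟨C', hC0', hC'⟩ := exists_hasSmoothProfiles_both (Ω := Ω) hρ hp hm hl hκ k
  obtain ⟨γ, hγ, hev⟩ := exists_modeFamily hg hm hl hp hρ Ω
  have hN0 : (0 : ℝ) < N := by exact_mod_cast hN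
  -- `L` is chosen last, after `C`, `C'` and `γ`. The factor `27 N² α²` is what the growth condition
  -- asks for after the normalization of the energy below.
  obtain ⟨L, ⟨⟨lam, Φ, Φ', Ψ, Ψ', h⟩, hgrow⟩, hL⟩ := ((hev.and (eventually_upperConst_le (Ω := Ω)
    (C := C) (n := j) (zero_le_one.trans hγ) hT (27 * (N : ℝ) ^ 2 * α ^ 2) (by positivity))).and
    (Filter.eventually_ge_atTop 1)).exists
  set R := γ * L ^ 2 with hRdef
  have hR : 1 ≤ R := one_le_mul_of_one_le_of_one_le hγ (one_le_pow₀ hL)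
  have hR0 : 0 ≤ R := by linarith
  set K := upperConst Ω R C 0 j with hK
  have hKpos : ∀ t, 0 < upperConst Ω R C t j := fun t => by
    unfold upperConst
    positivity
  have hK0 : 0 < K := hKpos 0
  -- With this energy each of the three initial norms is at most `√(3 K δ) = 1 / (3N)`, where `δ = 1
  -- / (27 N² K)`.
  obtain ⟨ε, hε, hE⟩ := exists_sum_modeEnergy_eq h hm hl hR0
    (by positivity : 0 ≤ 1 / (27 * (N : ℝ) ^ 2 * K))
  have hS := hC h hL hR0
  have hS' := hC' h hL hR0
  have hδ : 0 ≤ 1 / (27 * (N : ℝ) ^ 2 * K) := by positivity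
  have hη := fun t => vectorNorm_le (hKpos t).le hδ hE
    fun s i => h.sobolevSq_eta_le hm hl hL hR0 hε hC0.le (hS s) t i
  have hv := fun t => vectorNorm_le (hKpos t).le hδ hE
    fun s i => h.sobolevSq_vel_le hm hl hL hR0 hε hC0.le (hS s) t i
  have hq := fun t => scalarNorm_le (hKpos t).le hδ hE
    fun s => h.sobolevSq_pres_le hm hl hL hR0 hε hC0.le (hκc s) (hS s) t
  refine ⟨modeUnknowns g Ω R ε lam Φ Ψ κ, h.isSolution hρ hp hm hl hL hR0 hε hκ, fun t _ =>
    ⟨(hη t).trans_lt ENNReal.ofReal_lt_top, (hv t).trans_lt ENNReal.ofReal_lt_top,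
      (hq t).trans_lt ENNReal.ofReal_lt_top⟩, ?_, fun t ht => ⟨?_, ?_⟩⟩
  · have h3 : √(3 * (upperConst Ω R C 0 j * (1 / (27 * (N : ℝ) ^ 2 * K)))) = 1 / (3 * N) := by
      rw [← hK, show 3 * (K * (1 / (27 * (N : ℝ) ^ 2 * K))) = (1 / (3 * N)) ^ 2 by
        field_simp
        norm_num]
      exact Real.sqrt_sq (by positivity)
    refine (add_le_add (add_le_add (hη 0) (hv 0)) (hq 0)).trans (le_of_eq ?_)
    rw [h3, ← ENNReal.ofReal_add (by positivity) (by positivity),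
      ← ENNReal.ofReal_add (by positivity) (by positivity)]
    congr 1
    field_simp
    norm_num
  · refine ENNReal.rpow_le_rpow (Finset.sum_le_sum fun s _ => Finset.sum_le_sum fun i _ => ?_)
      (by norm_num)
    exact h.sobolevSq_eta_le_vel hm hl hL hR0 hε hC0'.le (hS' s) t i
  -- The lower bound increases with time, so it is enough to compare it with the initial norms at `t
  -- = T`.
  · have h4 : lowerConst Ω R L T ≤ lowerConst Ω R L t := by
      unfold lowerConst
      gcongr
    refine le_vectorNorm (c := lowerConst Ω R L t) (by unfold lowerConst; positivity) ?_ hE fun s =>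
      h.le_sum_sobolevSq_eta hm hl hL hR hε hC0'.le (hS' s) (hT.le.trans ht)
    rw [mul_one_div, le_div_iff₀ (by positivity)]
    calc _ = 27 * (N : ℝ) ^ 2 * α ^ 2 * K := by ring
      _ ≤ _ := hgrow.trans h4

end

end RotatingRT

end

theorem theorem1p1 (g Ω m l : ℝ) (hg : 0 < g) (hm : 0 < m) (hl : 0 < l)
    (p ρ₀ : RotatingRT.Layer → ℝ → ℝ)
    (hp : ∀ s, RotatingRT.IsPressureLaw (p s))
    (hρ₀ : RotatingRT.IsSteadyState g m l p ρ₀)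
    (k j : ℕ) (hkj : k ≤ j) (T₀ α : ℝ) (hT₀ : 0 < T₀) (hα : 0 < α) :
    ∃ U : ℕ → RotatingRT.Unknowns, ∀ n : ℕ, 1 ≤ n →
      RotatingRT.IsSolution g Ω m l p ρ₀ (U n) ∧
      (∀ t : ℝ, 0 ≤ t →
        RotatingRT.vectorNorm m l j (fun s => (U n).η s t) < ⊤ ∧
        RotatingRT.vectorNorm m l j (fun s => (U n).v s t) < ⊤ ∧
        RotatingRT.scalarNorm m l j (fun s => (U n).q s t) < ⊤) ∧
      RotatingRT.vectorNorm m l j (fun s => (U n).η s 0)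
          + RotatingRT.vectorNorm m l j (fun s => (U n).v s 0)
          + RotatingRT.scalarNorm m l j (fun s => (U n).q s 0)
        ≤ ENNReal.ofReal (1 / (n : ℝ)) ∧
      ∀ t : ℝ, T₀ ≤ t →
        RotatingRT.vectorNorm m l k (fun s => (U n).η s t)
            ≤ RotatingRT.vectorNorm m l k (fun s => (U n).v s t) ∧
        ENNReal.ofReal α ≤ RotatingRT.vectorNorm m l k (fun s => (U n).η s t) := by
  -- The construction needs a positive index, so index `0` reuses the solution for `1`.
  choose U hU using fun n : ℕ => RotatingRT.exists_growing_solution (Ω := Ω) (α := α) hg hm hl hp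
    hρ₀ k j hT₀ (le_max_right n 1)
  refine ⟨U, fun n hn => ?_⟩
  have h := hU n
  rwa [max_eq_left hn] at h
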